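/- **Theorem.** Let $G=(V,E)$ be a simple undirected graph with $V=\{0,\dots,n-1\}$ and $m=|E|\ge 1$, given as a list of its edges (in any order, each edge written as a pair in either direction), and let $k\ge 3$ be an integer. *Notions.* The degeneracy $\delta$ of $G$ is the largest $d$ such that some non-empty set of vertices induces a subgraph of minimum degree at least $d$. For an ordering $\pi=\langle e_1,\dots,e_m\rangle$ of the edges let $\overline g_i$ be the graph formed by the edges $e_i,\dots,e_m$, and for a graph $H$ and an edge $e=\{u,v\}$ let $N(e,H)$ be the set of common neighbours of $u$ and $v$ in $H$. The ordering $\pi$ is *truss-based* if $|N(e_i,\overline g_i)|\le|N(e_j,\overline g_i)|$ for all $i\le j$. Put $\tau=\max_i|N(e_i,\overline g_i)|$, for a truss-based ordering. *Algorithm EBBkC-H.* It maintains branches $(S,g,l)$, where $S$ is a clique, $g$ is a graph on common neighbours of $S$, and $l=k-|S|$. At the root it computes a truss-based ordering $e_1,\dots,e_m$ of $E$ and, for each $i$, forms the branch $(e_i,\,g_i,\,k-2)$, $g_i=\overline g_i[N(e_i,\overline g_i)]$. It colours $g_i$ greedily with colours $1,2,\dots$ (each vertex in turn gets the smallest colour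 not used by a neighbour), orders $V(g_i)$ by non-increasing colour (ties by vertex name), and directs each edge of $g_i$ from the earlier to the later vertex. (If $k=3$, only the vertex set of $g_i$ is needed, and the edges and colours of $g_i$ are not computed.) Then it handles each branch $(S,g,l)$ recursively. If $|V(g)|<l$ it returns. If $l=1$ it lists $S\cup\{v\}$ for all $v\in V(g)$, and if $l=2$ it lists $S\cup\{u,v\}$ for all edges $uv$ of $g$. If $l\ge3$, it takes the arcs $u\to v$ of $g$ in the lexicographic order of the positions of $(u,v)$ (the colour-based edge ordering) and calls itself on $(S\cup\{u,v\},\,g',\,l-2)$, where $g'$ is induced in $g$ by the common out-neighbours of $u$ and $v$, unless (1) $\mathrm{col}(u)<l$ or $\mathrm{col}(v)<l-1$, or (2) the vertices of $g'$ have fewer than $l-2$ distinct colours. *Cost.* The machine is a unit-cost random access machine. Its cells are arranged in tables with at most two indices (so an adjacency query is one access) and, apart from the input, initially hold $0$. Time counts reads, writes, printed words, conditional jumps and loop iterations. Space counts the distinct cells that hold the input or are ever written; the output is not counted. *Claim.* There is an implementation of EBBkC-H on this machine (one explicit program, the same for all inputs) and an absolute constant $C$ such that, for all $G$ and $k$ as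 above: 1. it lists all $k$-cliques of $G$, each exactly once; 2. the edge ordering that it computes and uses at the root is truss-based; 3. $\tau<\delta$, and its running time is at most $C\bigl(\delta m+k\,m\,(\tau/2)^{k-2}\bigr)$, where $\tau$ may be computed from any truss-based ordering of $G$; 4. it uses at most $C(m+n)$ space. -/

import Mathlib

/-! ### Graph notions: degeneracy, edge orderings, the truss-based edge ordering, `τ` -/

/-- The degeneracy `δ(G)`: the largest `d` such that the `d`-core of `G` is non-empty, that is, such
that some non-empty set of vertices induces a subgraph of minimum degree at least `d`. -/
noncomputable def degeneracy {n : ℕ} (G : SimpleGraph (Fin n)) : ℕ :=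
  sSup {d | ∃ A : Set (Fin n), A.Nonempty ∧ ∀ v ∈ A, d ≤ {w | w ∈ A ∧ G.Adj v w}.ncard}

/-- `π 0, π 1, …, π (m-1)` lists every edge of `G` exactly once (so `m` is the number of edges). -/
def IsEdgeOrdering {n m : ℕ} (G : SimpleGraph (Fin n)) (π : Fin m → Sym2 (Fin n)) : Prop :=
  Function.Injective π ∧ Set.range π = G.edgeSet

theorem IsEdgeOrdering.card_eq {n m : ℕ} {G : SimpleGraph (Fin n)} {π : Fin m → Sym2 (Fin n)}
    (h : IsEdgeOrdering G π) : m = G.edgeSet.ncard := by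
  rw [← h.2, ← Set.image_univ, Set.ncard_image_of_injective _ h.1, Set.ncard_univ, Nat.card_fin]

/-- The subgraph formed by the edges `π i, π (i+1), …, π (m-1)`. -/
def suffixGraph {n m : ℕ} (π : Fin m → Sym2 (Fin n)) (i : Fin m) : SimpleGraph (Fin n) :=
  SimpleGraph.fromEdgeSet (π '' {j | i ≤ j})

/-- `|N(V(e), H)|`: the number of common neighbours in `H` of the two ends of `e`. -/
noncomputable def numCommonNbrs {n : ℕ} (H : SimpleGraph (Fin n)) (e : Sym2 (Fin n)) : ℕ :=
  {w | ∀ u ∈ e, H.Adj u w}.ncard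

/-- Truss-based edge ordering: every edge has, among the edges that are still present when its turn
comes, the fewest common neighbours of its ends in the graph of the edges still present. -/
def IsTrussOrdering {n m : ℕ} (G : SimpleGraph (Fin n)) (π : Fin m → Sym2 (Fin n)) : Prop :=
  IsEdgeOrdering G π ∧ ∀ i j : Fin m, i ≤ j →
    numCommonNbrs (suffixGraph π i) (π i) ≤ numCommonNbrs (suffixGraph π i) (π j)

/-- `τ`: the largest number of vertices of a graph instance produced by branching on the edges in
the order `π`; the `i`-th instance lives on the common neighbours of the ends of `π i` in
`suffixGraph π i`. -/
noncomputable def tau {n m : ℕ} (π : Fin m → Sym2 (Fin n)) : ℕ :=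
  Finset.univ.sup fun i => numCommonNbrs (suffixGraph π i) (π i)

/-- The word sequence `out` lists the `k`-cliques of `G`: it is a concatenation of blocks of `k`
vertices, and the blocks are the `k`-cliques of `G`, each one exactly once. -/
def ListsCliques {n : ℕ} (G : SimpleGraph (Fin n)) (k : ℕ) (out : List ℕ) : Prop :=
  ∃ L : List (List (Fin n)), out = L.flatten.map Fin.val ∧ (∀ c ∈ L, c.length = k) ∧
    (L.map List.toFinset).Nodup ∧ ∀ s : Finset (Fin n), s ∈ L.map List.toFinset ↔ G.IsNClique k s

/-! ### The machine: a unit-cost random access machine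

Memory consists of words addressed by a table name and at most two indices; all cells outside the
input are initially `0`. Reading a cell, writing a cell, printing a word, a conditional jump and
each loop iteration cost one time step; the bounded arithmetic on registers (increments,
comparisons, sums of two counters) is part of the instruction that uses its result. The space used is
the number of distinct cells that hold the input or are ever written. The output is write-only. -/

/-- Memory cells. Edges are named `1, …, m` (`0` is the null name). -/
inductive Loc : Type
  /-- `inp f 0` and `inp f 1`: the two ends of the edge `f` (the input) -/
  | inp (f b : ℕ)
  /-- degree of the vertex `u` -/
  | deg (u : ℕ)
  /-- the `j`-th neighbour of `u` -/
  | adj (u j : ℕ)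
  /-- name of the edge between `u` and `v`, or `0` if there is none -/
  | eid (u v : ℕ)
  /-- support of the edge `f`: its current number of triangles -/
  | sup (f : ℕ)
  /-- number of edges of initial support `s` -/
  | cnt (s : ℕ)
  /-- next free place for an edge of support `s` -/
  | nxt (s : ℕ)
  /-- first place of the block of edges of current support `s` -/
  | bin (s : ℕ)
  /-- the edge at place `i` of the edge ordering -/
  | ord (i : ℕ)
  /-- the place of the edge `f` in the edge ordering -/
  | pos (f : ℕ)
  /-- the `j`-th vertex of the graph instance under construction at the root -/
  | cand (j : ℕ)
  /-- colour of the vertex `u` -/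
  | col (u : ℕ)
  /-- scratch marks on colours -/
  | mark (c : ℕ)
  /-- the `j`-th vertex of the current graph instance of the branch with `|S| = s` -/
  | lev (s j : ℕ)
  /-- the `j`-th vertex of the partial clique `S` -/
  | part (j : ℕ)
  /-- registers saved by the suspended call with `|S| = s` -/
  | frame (s r : ℕ)
  deriving DecidableEq

/-- A machine state: memory, occupied cells, words printed so far, time steps taken so far. -/
structure MState where
  mem : Loc → ℕ
  used : Finset Loc
  out : List ℕ
  time : ℕ

/-- The space used. -/
def MState.space (σ : MState) : ℕ := σ.used.card

/-- Programs. -/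
abbrev Prog (α : Type) : Type := StateM MState α

namespace Prog

/-- Spend one time step. -/
def tick : Prog Unit := fun σ => ((), { σ with time := σ.time + 1 })

/-- Read a cell (one step). -/
def rd (x : Loc) : Prog ℕ := fun σ => (σ.mem x, { σ with time := σ.time + 1 })

/-- Write a cell (one step). -/
def wr (x : Loc) (a : ℕ) : Prog Unit := fun σ =>
  ((), { σ with mem := Function.update σ.mem x a, used := insert x σ.used, time := σ.time + 1 })

/-- Print a word (one step). -/
def prt (a : ℕ) : Prog Unit := fun σ =>
  ((), { σ with out := σ.out ++ [a], time := σ.time + 1 })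

/-- Do nothing. -/
def skip : Prog Unit := pure ()

/-- Conditional jump (one step). -/
def branch {α : Type} (c : Prop) [Decidable c] (p q : Prog α) : Prog α := do
  tick
  if c then p else q

/-- Loop `i = 0, …, n-1` with an accumulator (one step per iteration, and one to leave). -/
def foldN {α : Type} : ℕ → α → (ℕ → α → Prog α) → Prog α
  | 0, a, _ => do
    tick
    pure a
  | n + 1, a, body => do
    let b ← foldN n a body
    tick
    body n b

/-- Loop `i = 0, …, n-1`. -/
def forN (n : ℕ) (body : ℕ → Prog Unit) : Prog Unit := foldN n () fun i _ => body i

end Prog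

/-! ### The algorithm EBBkC-H -/

namespace EBBkCH

open Prog

/-- Build degrees, neighbour lists and the edge dictionary from the list of `m` edges. -/
def readGraph (m : ℕ) : Prog Unit := forN m fun j => do
  let u ← rd (.inp (j + 1) 0)
  let v ← rd (.inp (j + 1) 1)
  let du ← rd (.deg u)
  wr (.adj u du) v
  wr (.deg u) (du + 1)
  let dv ← rd (.deg v)
  wr (.adj v dv) u
  wr (.deg v) (dv + 1)
  wr (.eid u v) (j + 1)
  wr (.eid v u) (j + 1)

/-- The ends of the edge `f`, one of smallest degree first. -/
def ends (f : ℕ) : Prog (ℕ × ℕ) := do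
  let u ← rd (.inp f 0)
  let v ← rd (.inp f 1)
  let du ← rd (.deg u)
  let dv ← rd (.deg v)
  branch (du ≤ dv) (pure (u, v)) (pure (v, u))

/-- Loop over the triangles `a, b, w` of `G` on the edge `f = (a, b)`; the body receives `w` and the
names of the edges `(a, w)` and `(w, b)`. -/
def foldTriangles {α : Type} (f : ℕ) (x : α) (body : ℕ → ℕ → ℕ → α → Prog α) : Prog α := do
  let (a, b) ← ends f
  let da ← rd (.deg a)
  foldN da x fun j y => do
    let w ← rd (.adj a j)
    let f₁ ← rd (.eid a w)
    let f₂ ← rd (.eid w b)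
    branch (f₂ = 0) (pure y) (body w f₁ f₂ y)

/-- The supports of all edges in `G`. -/
def supports (m : ℕ) : Prog Unit := forN m fun j => do
  let s ← foldTriangles (j + 1) 0 fun _ _ _ s => pure (s + 1)
  wr (.sup (j + 1)) s

/-- Sort the edges by support (counting sort), with the start of each block in `bin`. -/
def sortEdges (m : ℕ) : Prog Unit := do
  forN m fun j => do
    let s ← rd (.sup (j + 1))
    let c ← rd (.cnt s)
    wr (.cnt s) (c + 1)
  let _ ← foldN (m + 1) 0 fun s start => do
    wr (.bin s) start
    wr (.nxt s) start
    let c ← rd (.cnt s)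
    pure (start + c)
  forN m fun j => do
    let s ← rd (.sup (j + 1))
    let p ← rd (.nxt s)
    wr (.ord p) (j + 1)
    wr (.pos (j + 1)) p
    wr (.nxt s) (p + 1)

/-- Lower the support of the edge `f` by one, moving `f` to the block of its new support. -/
def lower (f : ℕ) : Prog Unit := do
  let s ← rd (.sup f)
  let p ← rd (.pos f)
  let q ← rd (.bin s)
  let g ← rd (.ord q)
  wr (.ord q) f
  wr (.pos f) q
  wr (.ord p) g
  wr (.pos g) p
  wr (.bin s) (q + 1)
  wr (.sup f) (s - 1)

/-- Repeatedly remove an edge of smallest current support: the `i`-th removed edge stays at place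
`i`, and the supports of the edges in its remaining triangles drop by one. -/
def peel (m : ℕ) : Prog Unit := forN m fun i => do
  let f ← rd (.ord i)
  let s ← rd (.sup f)
  wr (.bin s) (i + 1)
  wr (.bin (s - 1)) (i + 1)
  foldTriangles f () fun _ f₁ f₂ _ => do
    let p₁ ← rd (.pos f₁)
    let p₂ ← rd (.pos f₂)
    branch (i < p₁ ∧ i < p₂) (do lower f₁; lower f₂) skip

/-- Compute the truss-based edge ordering of `G` in the table `ord`, with its inverse in `pos`. -/
def trussOrder (m : ℕ) : Prog Unit := do
  supports m
  sortEdges m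
  peel m

/-- Whether `u` and `v` are joined by an edge behind place `i` of the edge ordering. -/
def later (i u v : ℕ) : Prog Bool := do
  let f ← rd (.eid u v)
  branch (f = 0) (pure false) do
    let p ← rd (.pos f)
    branch (i < p) (pure true) (pure false)

/-- The vertices of the graph instance `g` of the `i`-th branch below the root, whose edge is `f`:
the common neighbours of the ends of `f` through edges behind place `i`. They go to `cand`; the
result is their number. -/
def instanceVertices (i f : ℕ) : Prog ℕ :=
  foldTriangles f 0 fun w f₁ f₂ q => do
    let p₁ ← rd (.pos f₁)
    let p₂ ← rd (.pos f₂)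
    branch (i < p₁ ∧ i < p₂)
      (do
        wr (.cand q) w
        pure (q + 1))
      (pure q)

/-- Greedy colouring of `g` (vertices `cand 0, …, cand (p-1)`, edges behind place `i`): each vertex
in turn gets the smallest colour among `1, 2, …` that none of its coloured neighbours has. -/
def colour (i p : ℕ) : Prog Unit := forN p fun j => do
  let v ← rd (.cand j)
  forN j fun t => do
    let u ← rd (.cand t)
    let b ← later i u v
    branch (b = true)
      (do
        let c ← rd (.col u)
        wr (.mark c) 1)
      skip
  let c ← foldN j 1 fun _ c => do
    let x ← rd (.mark c)
    branch (x = 0) (pure c) (pure (c + 1))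
  wr (.col v) c
  forN j fun t => do
    let u ← rd (.cand t)
    let c' ← rd (.col u)
    wr (.mark c') 0

/-- The colour-based vertex ordering: write the vertices of `g` to `lev 2` by non-increasing colour,
ties broken by vertex name. The place of a vertex in `lev 2` is its `id`. -/
def orderByColour (p : ℕ) : Prog Unit := forN p fun j => do
  let v ← rd (.cand j)
  let c ← rd (.col v)
  let r ← foldN p 0 fun t r => do
    let u ← rd (.cand t)
    let c' ← rd (.col u)
    branch (c < c' ∨ (c' = c ∧ u < v)) (pure (r + 1)) (pure r)
  wr (.lev 2 r) v

/-- Write the vertices of `g` to `lev 2` without colouring. -/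
def copyVertices (p : ℕ) : Prog Unit := forN p fun j => do
  let v ← rd (.cand j)
  wr (.lev 2 j) v

/-- Print the partial clique `S`, `|S| = s`. -/
def printS (s : ℕ) : Prog Unit := forN s fun j => do
  let v ← rd (.part j)
  prt v

/-- The number of distinct colours of the vertices `lev s 0, …, lev s (q-1)`. -/
def countColours (s q : ℕ) : Prog ℕ := do
  let r ← foldN q 0 fun j r => do
    let w ← rd (.lev s j)
    let c ← rd (.col w)
    let x ← rd (.mark c)
    branch (x = 0)
      (do
        wr (.mark c) 1
        pure (r + 1))
      (pure r)
  forN q fun j => do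
    let w ← rd (.lev s j)
    let c ← rd (.col w)
    wr (.mark c) 0
  pure r

/-- `N⁺({u, v}, g)` for the arc from `u` to `v = lev s y`: the common out-neighbours of `u` and `v`
in the instance `lev s 0, …, lev s (p-1)`, written to `lev (s+2)`; the result is their number. -/
def commonOut (i s p y u v : ℕ) : Prog ℕ :=
  foldN (p - (y + 1)) 0 fun z q => do
    let w ← rd (.lev s (y + 1 + z))
    let b₁ ← later i u w
    let b₂ ← later i v w
    branch (b₁ = true ∧ b₂ = true)
      (do
        wr (.lev (s + 2) q) w
        pure (q + 1))
      (pure q)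

/-- The recursive procedure at a branch `(S, g, l)` below the `i`-th child of the root. Its arguments
are `i`, `l`, `s = |S|` and `p = |V(g)|`. The vertices of `g` are `lev s 0, …, lev s (p-1)` in the
order of their `id`; the arcs of `g` are the pairs joined by an edge behind place `i`, directed
towards the larger `id`. The branching step scans the arcs in the colour-based edge ordering, which
is the lexicographic order of the pairs of `id`s. -/
def listRec (i : ℕ) : ℕ → ℕ → ℕ → Prog Unit
  | 0, _, _ => skip
  | 1, s, p => branch (p < 1) skip <|
      forN p fun x => do
        let v ← rd (.lev s x)
        printS s
        prt v
  | 2, s, p => branch (p < 2) skip <|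
      forN p fun x => do
        let u ← rd (.lev s x)
        forN (p - (x + 1)) fun y => do
          let v ← rd (.lev s (x + 1 + y))
          let b ← later i u v
          branch (b = true)
            (do
              printS s
              prt u
              prt v)
            skip
  | l + 3, s, p => branch (p < l + 3) skip <|
      forN p fun x => do
        let u ← rd (.lev s x)
        forN (p - (x + 1)) fun y => do
          let v ← rd (.lev s (x + 1 + y))
          let b ← later i u v
          branch (b = true)
            (do
              let cu ← rd (.col u)
              let cv ← rd (.col v)
              -- pruning rule (1)
              branch (cu < l + 3 ∨ cv < l + 2) skip do
                let q ← commonOut i s p (x + 1 + y) u v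
                let c ← countColours (s + 2) q
                -- pruning rule (2)
                branch (c < l + 1) skip do
                  wr (.part s) u
                  wr (.part (s + 1)) v
                  wr (.frame s 0) x
                  wr (.frame s 1) y
                  wr (.frame s 2) p
                  listRec i (l + 1) (s + 2) q)
            skip

/-- The branching step at the root: for each edge in the truss-based ordering, form the branch
`(S, g, k-2)`, colour and order `g`, and call the recursive procedure. A branch with `k - 2 = 1` is
terminated by listing the vertices of `g`, so neither its edges nor its colours are computed. -/
def root (m k : ℕ) : Prog Unit := forN m fun i => do
  let f ← rd (.ord i)
  let (a, b) ← ends f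
  wr (.part 0) a
  wr (.part 1) b
  let p ← instanceVertices i f
  branch (k - 2 = 1) (copyVertices p)
    (do
      colour i p
      orderByColour p)
  listRec i (k - 2) 2 p

/-- EBBkC-H. -/
def program (m k : ℕ) : Prog Unit := do
  readGraph m
  trussOrder m
  root m k

/-- The initial state: the memory holds the list `inp` of edges and is `0` elsewhere. -/
def initial {n m : ℕ} (inp : Fin m → Fin n × Fin n) : MState where
  mem
    | .inp f b =>
      if h : 0 < f ∧ f - 1 < m then
        if b = 0 then ((inp ⟨f - 1, h.2⟩).1 : ℕ) else if b = 1 then ((inp ⟨f - 1, h.2⟩).2 : ℕ) else 0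
      else 0
    | _ => 0
  used := Finset.univ.image fun x : Fin m × Fin 2 => Loc.inp (x.1 + 1) x.2
  out := []
  time := 0

/-- The final state of EBBkC-H on the graph with edge list `inp` and on the integer `k`. -/
def run {n m : ℕ} (inp : Fin m → Fin n × Fin n) (k : ℕ) : MState :=
  (program m k (initial inp)).2

end EBBkCH

/-- The edge sequence given by a list of pairs of vertices. -/
def edgesOf {n m : ℕ} (inp : Fin m → Fin n × Fin n) (j : Fin m) : Sym2 (Fin n) :=
  s((inp j).1, (inp j).2)

/-! Correctness. Each clique is charged to its first edge in the ordering. If this edge stands at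
place `i`, the other vertices of the clique are common neighbours of its ends through edges behind
place `i`; so the blocks printed at different places are disjoint and together exhaust the cliques
(`blocks_of_edge`, `isCliqueFrom_unique`, `exists_isCliqueFrom_iff`). Inside an instance, branching
on an arc amounts to two consecutive steps of ordinary vertex branching (`cliqueLists_add_two`). The
pruning rules lose nothing because colours strictly decrease along a clique.

Ordering. Removing an edge lowers the support of any other edge by at most one (`supp_succ`). Hence
an array of edges sorted by support can be maintained by one swap per lowered support
(`lower_spec`), and its first remaining entry always has minimal support.

Time. Every scan for triangles costs the smaller degree of the two ends, and these minima sum to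
`O(δ m)` (`sum_min_le_degeneracy`). In the recursion on `p` vertices, the arc between places `x < y`
leaves at most `q = p - 1 - y` candidates, and these numbers sum to at most `p³/6` over all pairs.
Keeping one factor `q/2` and bounding the others by `p/2`, two levels cost a factor `p²/6`, where
the claim allows `(p/2)² = p²/4`; the difference pays for the local work (`sum_listTime_le`). The
value `τ` is the same for all truss-based orderings because each of them minimises it over all edge
orderings (`tau_le_tau`).

Space. The recursion needs `O(τ² + n)` cells. Since `τ < δ` (`tau_lt_degeneracy`) and `δ(δ + 1) ≤
2m` (`degeneracy_mul_le`), this is `O(m + n)`.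

The program is analysed by triples `Spec` that control result, memory, output, time and written
cells at once, over a model `NamedGraph` with natural numbers as vertices and edges; the results are
carried to `SimpleGraph` at the end. -/

/-! ### A program logic for results, output, time and written cells. -/

namespace Prog

/-- Started with memory `μ`, the program `p` takes time at most `c`, writes only to cells in `W`, and
ends with a result, a memory and a printed word sequence that satisfy `Q`. -/
def Spec {α : Type} (p : Prog α) (μ : Loc → ℕ) (W : Set Loc) (c : ℝ)
    (Q : α → (Loc → ℕ) → List ℕ → Prop) : Prop :=
  ∀ σ : MState, σ.mem = μ → ∃ o : List ℕ, Q (p σ).1 (p σ).2.mem o ∧ (p σ).2.out = σ.out ++ o ∧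
    (∀ x, x ∉ W → (p σ).2.mem x = μ x) ∧ (∀ x ∈ (p σ).2.used, x ∈ σ.used ∨ x ∈ W) ∧
    ((p σ).2.time : ℝ) ≤ σ.time + c

variable {α β : Type} {μ : Loc → ℕ} {W : Set Loc} {c : ℝ}

theorem Spec.pure {a : α} {Q : α → (Loc → ℕ) → List ℕ → Prop} (hc : 0 ≤ c) (h : Q a μ []) :
    Spec (pure a) μ W c Q := by
  rintro σ rfl
  refine ⟨[], h, (List.append_nil _).symm, fun _ _ => rfl, fun _ h => Or.inl h, ?_⟩
  change (σ.time : ℝ) ≤ σ.time + c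
  linarith

theorem Spec.skip {Q : Unit → (Loc → ℕ) → List ℕ → Prop} (hc : 0 ≤ c) (h : Q () μ []) :
    Spec skip μ W c Q := Spec.pure hc h

theorem Spec.mono {p : Prog α} {W' : Set Loc} {c' : ℝ} {Q Q' : α → (Loc → ℕ) → List ℕ → Prop}
    (h : Spec p μ W' c' Q') (hW : W' ⊆ W) (hc : c' ≤ c)
    (hQ : ∀ a ν o, Q' a ν o → (∀ x, x ∉ W' → ν x = μ x) → Q a ν o) : Spec p μ W c Q := by
  rintro σ rfl
  obtain ⟨o, h1, h2, h3, h4, h5⟩ := h σ rfl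
  exact ⟨o, hQ _ _ _ h1 h3, h2, fun x hx => h3 x fun h => hx (hW h),
    fun x hx => (h4 x hx).imp_right fun h => hW h, by linarith⟩

/-- The continuation is told that cells outside `W'` kept their values. This frame information is
what carries the tables of earlier phases through later ones. -/
theorem Spec.bind {p : Prog α} {f : α → Prog β} {W' : Set Loc} (c' : ℝ)
    {R : α → (Loc → ℕ) → List ℕ → Prop} {Q : β → (Loc → ℕ) → List ℕ → Prop}
    (h : Spec p μ W' c' R) (hW : W' ⊆ W)
    (hf : ∀ a ν o, R a ν o → (∀ x, x ∉ W' → ν x = μ x) →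
      Spec (f a) ν W (c - c') fun b ν' o' => Q b ν' (o ++ o')) :
    Spec (p >>= f) μ W c Q := by
  rintro σ rfl
  obtain ⟨o, h1, h2, h3, h4, h5⟩ := h σ rfl
  obtain ⟨o', g1, g2, g3, g4, g5⟩ := hf _ _ _ h1 h3 (p σ).2 rfl
  refine ⟨o ++ o', g1, ?_, fun x hx => ?_, fun x hx => ?_, ?_⟩
  · rw [← List.append_assoc, ← h2]
    exact g2
  · exact (g3 x hx).trans (h3 x fun h => hx (hW h))
  · rcases g4 x hx with h | h
    · exact (h4 x h).imp_right fun h => hW h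
    · exact Or.inr h
  · change ((f (p σ).1 (p σ).2).2.time : ℝ) ≤ _
    linarith

theorem Spec.tick_bind {f : Unit → Prog β} {Q : β → (Loc → ℕ) → List ℕ → Prop}
    (h : Spec (f ()) μ W (c - 1) Q) : Spec (tick >>= f) μ W c Q := by
  refine Spec.bind (W' := ∅) (R := fun _ ν o => ν = μ ∧ o = []) 1 ?_ (Set.empty_subset _) ?_
  · rintro σ rfl
    refine ⟨[], ⟨rfl, rfl⟩, (List.append_nil _).symm, fun _ _ => rfl, fun _ h => Or.inl h, ?_⟩
    exact (Nat.cast_succ (R := ℝ) σ.time).le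
  · rintro ⟨⟩ ν o ⟨rfl, rfl⟩ -
    exact h

theorem Spec.rd_bind {x : Loc} {f : ℕ → Prog β} {Q : β → (Loc → ℕ) → List ℕ → Prop}
    (h : Spec (f (μ x)) μ W (c - 1) Q) : Spec (rd x >>= f) μ W c Q := by
  refine Spec.bind (W' := ∅) (R := fun a ν o => a = μ x ∧ ν = μ ∧ o = []) 1 ?_
    (Set.empty_subset _) ?_
  · rintro σ rfl
    refine ⟨[], ⟨rfl, rfl, rfl⟩, (List.append_nil _).symm, fun _ _ => rfl, fun _ h => Or.inl h, ?_⟩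
    exact (Nat.cast_succ (R := ℝ) σ.time).le
  · rintro _ ν o ⟨rfl, rfl, rfl⟩ -
    exact h

theorem Spec.wr {x : Loc} {a : ℕ} {Q : Unit → (Loc → ℕ) → List ℕ → Prop} (hx : x ∈ W)
    (hc : 0 ≤ c - 1) (h : Q () (Function.update μ x a) []) : Spec (wr x a) μ W c Q := by
  rintro σ rfl
  refine ⟨[], h, (List.append_nil _).symm, fun y hy => ?_, fun y hy => ?_, ?_⟩
  · exact Function.update_of_ne (fun h : y = x => hy (h ▸ hx)) _ _
  · rcases Finset.mem_insert.1 hy with rfl | h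
    exacts [Or.inr hx, Or.inl h]
  · refine (Nat.cast_succ (R := ℝ) σ.time).le.trans ?_
    linarith

theorem Spec.wr_bind {x : Loc} {a : ℕ} {f : Unit → Prog β} {Q : β → (Loc → ℕ) → List ℕ → Prop}
    (hx : x ∈ W) (h : Spec (f ()) (Function.update μ x a) W (c - 1) Q) :
    Spec (Prog.wr x a >>= f) μ W c Q := by
  refine Spec.bind (W' := W) (R := fun _ ν o => ν = Function.update μ x a ∧ o = []) 1
    (Spec.wr hx (by norm_num) ⟨rfl, rfl⟩) subset_rfl ?_
  rintro _ ν o ⟨rfl, rfl⟩ -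
  exact h

theorem Spec.prt {a : ℕ} {Q : Unit → (Loc → ℕ) → List ℕ → Prop}
    (hc : 0 ≤ c - 1) (h : Q () μ [a]) : Spec (prt a) μ W c Q := by
  rintro σ rfl
  refine ⟨[a], h, rfl, fun y hy => rfl, fun y hy => Or.inl hy, ?_⟩
  refine (Nat.cast_succ (R := ℝ) σ.time).le.trans ?_
  linarith

theorem Spec.prt_bind {a : ℕ} {f : Unit → Prog β} {Q : β → (Loc → ℕ) → List ℕ → Prop}
    (h : Spec (f ()) μ W (c - 1) fun b ν o => Q b ν (a :: o)) :
    Spec (Prog.prt a >>= f) μ W c Q := by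
  refine Spec.bind (W' := ∅) (R := fun _ ν o => ν = μ ∧ o = [a]) 1
    (Spec.prt (by norm_num) ⟨rfl, rfl⟩) (Set.empty_subset _) ?_
  rintro _ ν o ⟨rfl, rfl⟩ -
  exact h

theorem Spec.branch {b : Prop} [Decidable b] {p q : Prog α} {Q : α → (Loc → ℕ) → List ℕ → Prop}
    (hp : b → Spec p μ W (c - 1) Q) (hq : ¬b → Spec q μ W (c - 1) Q) :
    Spec (branch b p q) μ W c Q := by
  refine Spec.tick_bind ?_
  split_ifs with h
  exacts [hp h, hq h]

/-- The loop rule, with a running time that may depend on the state. -/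
theorem Spec.foldN_time {n : ℕ} {a : α} {body : ℕ → α → Prog α}
    {Q : α → (Loc → ℕ) → List ℕ → Prop} (I : ℕ → α → (Loc → ℕ) → List ℕ → ℝ → Prop)
    (h0 : I 0 a μ [] 0)
    (hs : ∀ i < n, ∀ b ν o t, I i b ν o t → (∀ x, x ∉ W → ν x = μ x) →
      ∃ d, Spec (body i b) ν W d fun b' ν' o' => I (i + 1) b' ν' (o ++ o') (t + (d + 1)))
    (hf : ∀ b ν o t, I n b ν o t → (∀ x, x ∉ W → ν x = μ x) → t + 1 ≤ c ∧ Q b ν o) :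
    Spec (foldN n a body) μ W c Q := by
  rintro σ rfl
  -- The extra step in `t + 1` is the tick in the base case of `foldN`, which is paid before all
  -- iterations.
  suffices H : ∀ k ≤ n, ∃ o t, I k (foldN k a body σ).1 (foldN k a body σ).2.mem o t ∧
      (foldN k a body σ).2.out = σ.out ++ o ∧
      (∀ x, x ∉ W → (foldN k a body σ).2.mem x = σ.mem x) ∧
      (∀ x ∈ (foldN k a body σ).2.used, x ∈ σ.used ∨ x ∈ W) ∧
      ((foldN k a body σ).2.time : ℝ) ≤ σ.time + (t + 1) by
    obtain ⟨o, t, h1, h2, h3, h4, h5⟩ := H n le_rfl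
    obtain ⟨hc, hQ⟩ := hf _ _ _ _ h1 h3
    exact ⟨o, hQ, h2, h3, h4, by linarith⟩
  intro k
  induction k with
  | zero =>
    intro _
    refine ⟨[], 0, h0, (List.append_nil _).symm, fun _ _ => rfl, fun _ h => Or.inl h, ?_⟩
    rw [zero_add]
    exact (Nat.cast_succ (R := ℝ) σ.time).le
  | succ k ih =>
    intro hk
    obtain ⟨o, t, h1, h2, h3, h4, h5⟩ := ih (Nat.le_of_succ_le hk)
    obtain ⟨d, hd⟩ := hs k hk _ _ _ _ h1 h3
    obtain ⟨o', g1, g2, g3, g4, g5⟩ := hd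
      { (foldN k a body σ).2 with time := (foldN k a body σ).2.time + 1 } rfl
    refine ⟨o ++ o', _, g1, ?_, fun x hx => (g3 x hx).trans (h3 x hx), fun x hx => ?_, ?_⟩
    · rw [← List.append_assoc, ← h2]
      exact g2
    · rcases g4 x hx with h | h
      exacts [h4 x h, Or.inr h]
    · refine g5.trans ?_
      push_cast
      linarith

/-- The loop rule. -/
theorem Spec.foldN {n : ℕ} {a : α} {body : ℕ → α → Prog α}
    {Q : α → (Loc → ℕ) → List ℕ → Prop} (I : ℕ → α → (Loc → ℕ) → List ℕ → Prop) (d : ℕ → ℝ)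
    (hc : ∑ i ∈ Finset.range n, (d i + 1) + 1 ≤ c) (h0 : I 0 a μ [])
    (hs : ∀ i < n, ∀ b ν o, I i b ν o → (∀ x, x ∉ W → ν x = μ x) →
      Spec (body i b) ν W (d i) fun b' ν' o' => I (i + 1) b' ν' (o ++ o'))
    (hf : ∀ b ν o, I n b ν o → (∀ x, x ∉ W → ν x = μ x) → Q b ν o) :
    Spec (foldN n a body) μ W c Q := by
  refine Spec.foldN_time
    (fun i b ν o t => I i b ν o ∧ t = ∑ i ∈ Finset.range i, (d i + 1)) ⟨h0, by simp⟩ ?_ ?_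
  · rintro i hi b ν o t ⟨h, rfl⟩ hW
    refine ⟨d i, (hs i hi b ν o h hW).mono subset_rfl le_rfl fun b' ν' o' h' _ => ⟨h', ?_⟩⟩
    rw [Finset.sum_range_succ]
  · rintro b ν o t ⟨h, rfl⟩ hW
    exact ⟨hc, hf b ν o h hW⟩

/-- The loop rule, with the same running time for all iterations. -/
theorem Spec.foldN_const {n : ℕ} {a : α} {body : ℕ → α → Prog α}
    {Q : α → (Loc → ℕ) → List ℕ → Prop} (I : ℕ → α → (Loc → ℕ) → List ℕ → Prop) (d : ℝ)
    (hc : n * (d + 1) + 1 ≤ c) (h0 : I 0 a μ [])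
    (hs : ∀ i < n, ∀ b ν o, I i b ν o → (∀ x, x ∉ W → ν x = μ x) →
      Spec (body i b) ν W d fun b' ν' o' => I (i + 1) b' ν' (o ++ o'))
    (hf : ∀ b ν o, I n b ν o → (∀ x, x ∉ W → ν x = μ x) → Q b ν o) :
    Spec (Prog.foldN n a body) μ W c Q :=
  Spec.foldN I (fun _ => d)
    (by simpa only [Finset.sum_const, Finset.card_range, nsmul_eq_mul] using hc) h0 hs hf

end Prog

/-! ### Graphs with named edges, and reading the input. -/

/-- A simple graph on vertices below `n` whose `m` edges are named `1, …, m`; `name u v` is the name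
of the edge `uv`, or `0`. -/
structure NamedGraph (n m : ℕ) where
  fst : ℕ → ℕ
  snd : ℕ → ℕ
  name : ℕ → ℕ → ℕ
  name_comm : ∀ u v, name u v = name v u
  name_self : ∀ u, name u u = 0
  name_le : ∀ u v, name u v ≤ m
  name_ends : ∀ f, 1 ≤ f → f ≤ m → name (fst f) (snd f) = f
  ends_name : ∀ u v, name u v ≠ 0 →
    (fst (name u v) = u ∧ snd (name u v) = v) ∨ (fst (name u v) = v ∧ snd (name u v) = u)
  lt_of_name : ∀ u v, name u v ≠ 0 → u < n

namespace NamedGraph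

variable {n m : ℕ} (D : NamedGraph n m)

/-- The neighbours of `u` through the edges with names at most `j`. -/
def nbrs (j u : ℕ) : Finset ℕ := (Finset.range n).filter fun v => D.name u v ≠ 0 ∧ D.name u v ≤ j

/-- The smaller degree of the ends of an edge. -/
def minDeg (f : ℕ) : ℕ := min (D.nbrs m (D.fst f)).card (D.nbrs m (D.snd f)).card

/-- The third vertices of the triangles on the edge `f` whose other two edges have place at least
`i`. -/
def tri (pos : ℕ → ℕ) (i f : ℕ) : Finset ℕ := (Finset.range n).filter fun w =>
  (D.name (D.fst f) w ≠ 0 ∧ D.name w (D.snd f) ≠ 0) ∧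
    i ≤ pos (D.name (D.fst f) w) ∧ i ≤ pos (D.name w (D.snd f))

/-- The support of `f` in the graph of the edges with place at least `i`. -/
def supp (pos : ℕ → ℕ) (i f : ℕ) : ℕ := (D.tri pos i f).card

variable {D}

theorem mem_nbrs {j u v : ℕ} : v ∈ D.nbrs j u ↔ D.name u v ≠ 0 ∧ D.name u v ≤ j := by
  rw [nbrs, Finset.mem_filter, Finset.mem_range, and_iff_right_iff_imp]
  exact fun h => D.lt_of_name v u (D.name_comm u v ▸ h.1)

theorem mem_nbrs_all {u v : ℕ} : v ∈ D.nbrs m u ↔ D.name u v ≠ 0 :=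
  mem_nbrs.trans (and_iff_left (D.name_le u v))

theorem mem_tri {pos : ℕ → ℕ} {i f w : ℕ} : w ∈ D.tri pos i f ↔
    (D.name (D.fst f) w ≠ 0 ∧ D.name w (D.snd f) ≠ 0) ∧
      i ≤ pos (D.name (D.fst f) w) ∧ i ≤ pos (D.name w (D.snd f)) := by
  rw [tri, Finset.mem_filter, Finset.mem_range, and_iff_right_iff_imp]
  exact fun h => D.lt_of_name _ _ h.1.2

theorem mem_tri_zero {pos : ℕ → ℕ} {f w : ℕ} : w ∈ D.tri pos 0 f ↔
    D.name (D.fst f) w ≠ 0 ∧ D.name w (D.snd f) ≠ 0 :=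
  mem_tri.trans (and_iff_left ⟨Nat.zero_le _, Nat.zero_le _⟩)

/-- At `0` the conditions on places are void. So initial supports make sense before any ordering
exists, with `id` as a dummy. -/
theorem supp_zero (pos pos' : ℕ → ℕ) (f : ℕ) : D.supp pos 0 f = D.supp pos' 0 f := by
  rw [supp, supp]
  congr 1
  ext w
  rw [mem_tri_zero, mem_tri_zero]

theorem name_inj {u v u' v' : ℕ} (h : D.name u v ≠ 0) (e : D.name u' v' = D.name u v) :
    (u' = u ∧ v' = v) ∨ (u' = v ∧ v' = u) := by
  have h1 := D.ends_name u v h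
  have h2 := D.ends_name u' v' (e ▸ h)
  rw [e] at h2
  omega

theorem fst_ne_snd {f : ℕ} (h1 : 1 ≤ f) (h2 : f ≤ m) : D.fst f ≠ D.snd f := by
  intro h
  have := D.name_ends f h1 h2
  rw [h, D.name_self] at this
  omega

theorem name_right_inj {u v v' : ℕ} (h : D.name u v ≠ 0) (e : D.name u v' = D.name u v) :
    v' = v := by
  rcases name_inj h e with h | h <;> omega

/-- Sending the third vertex `w` to the edge from `fst f` to `w` is injective. The bound confines
the tables indexed by supports to `m + 1` cells each. -/
theorem supp_le (pos : ℕ → ℕ) (i f : ℕ) : D.supp pos i f ≤ m := by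
  have : (D.tri pos i f).card ≤ (Finset.Icc 1 m).card :=
    Finset.card_le_card_of_injOn (fun w => D.name (D.fst f) w)
      (fun w hw => by
        have := mem_tri.1 hw
        exact Finset.mem_Icc.2 ⟨Nat.one_le_iff_ne_zero.2 this.1.1, D.name_le _ _⟩)
      (fun w hw w' hw' e => (name_right_inj (mem_tri.1 hw).1.1 e.symm).symm)
  simpa [supp] using this

end NamedGraph

/-- The cells that hold the input and the graph. -/
def graphCells : Set Loc
  | .inp _ _ | .deg _ | .adj _ _ | .eid _ _ => True
  | _ => False

/-- The memory holds the input and the tables of the graph formed by its first `j` edges. -/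
structure GraphMem {n m : ℕ} (D : NamedGraph n m) (j : ℕ) (μ : Loc → ℕ) : Prop where
  inp : ∀ f, 1 ≤ f → f ≤ m → μ (.inp f 0) = D.fst f ∧ μ (.inp f 1) = D.snd f
  deg : ∀ u, μ (.deg u) = (D.nbrs j u).card
  adj : ∀ u, (Finset.range (D.nbrs j u).card).image (fun t => μ (.adj u t)) = D.nbrs j u
  eid : ∀ u v, μ (.eid u v) = if D.name u v ≤ j then D.name u v else 0

namespace GraphMem

variable {n m j : ℕ} {D : NamedGraph n m} {μ ν : Loc → ℕ}

theorem congr (h : GraphMem D j μ) (e : ∀ x ∈ graphCells, ν x = μ x) : GraphMem D j ν := by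
  have e1 : ∀ f b, ν (.inp f b) = μ (.inp f b) := fun f b => e (.inp f b) trivial
  have e2 : ∀ u, ν (.deg u) = μ (.deg u) := fun u => e (.deg u) trivial
  have e3 : ∀ u t, ν (.adj u t) = μ (.adj u t) := fun u t => e (.adj u t) trivial
  have e4 : ∀ u v, ν (.eid u v) = μ (.eid u v) := fun u v => e (.eid u v) trivial
  exact ⟨by simpa only [e1] using h.inp, by simpa only [e2] using h.deg,
    by simpa only [e3] using h.adj, by simpa only [e4] using h.eid⟩

theorem eid_all (h : GraphMem D m μ) (u v : ℕ) : μ (.eid u v) = D.name u v := by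
  rw [h.eid, if_pos (D.name_le u v)]

theorem adj_mem (h : GraphMem D j μ) {u t : ℕ} (ht : t < (D.nbrs j u).card) :
    μ (.adj u t) ∈ D.nbrs j u := by
  rw [← h.adj u]
  exact Finset.mem_image_of_mem _ (Finset.mem_range.2 ht)

theorem adj_inj (h : GraphMem D j μ) {u t t' : ℕ} (ht : t < (D.nbrs j u).card)
    (ht' : t' < (D.nbrs j u).card) (e : μ (.adj u t) = μ (.adj u t')) : t = t' := by
  have : Set.InjOn (fun t => μ (.adj u t)) (Finset.range (D.nbrs j u).card) := by
    rw [← Finset.card_image_iff, h.adj u, Finset.card_range]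
  exact this (Finset.mem_coe.2 (Finset.mem_range.2 ht)) (Finset.mem_coe.2 (Finset.mem_range.2 ht')) e

end GraphMem

namespace EBBkCH

open Prog NamedGraph

variable {n m : ℕ} {D : NamedGraph n m}

/-- The cells that are written while the graph is read. -/
def readCells (n m : ℕ) (D : NamedGraph n m) : Set Loc
  | .deg u => u < n
  | .adj u j => u < n ∧ j < (D.nbrs m u).card
  | .eid u v => D.name u v ≠ 0
  | _ => False

theorem readGraph_spec {μ : Loc → ℕ} (h : GraphMem D 0 μ) :
    Spec (readGraph m) μ (readCells n m D) (11 * m + 1) fun _ ν o => o = [] ∧ GraphMem D m ν := by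
  refine Spec.foldN_const (fun j _ ν o => o = [] ∧ GraphMem D j ν) 10 (by linarith) ⟨rfl, h⟩ ?_
    fun _ ν o h _ => h
  rintro j hj _ ν o ⟨rfl, hν⟩ -
  have hin := hν.inp (j + 1) (by omega) (by omega)
  have hn := D.name_ends (j + 1) (by omega) (by omega)
  have huv := D.fst_ne_snd (f := j + 1) (by omega) (by omega)
  refine Spec.rd_bind (Spec.rd_bind ?_)
  rw [hin.1, hin.2]
  set u := D.fst (j + 1)
  set v := D.snd (j + 1)
  have hn' : D.name v u = j + 1 := D.name_comm u v ▸ hn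
  have hun : u < n := D.lt_of_name u v (by omega)
  have hvn : v < n := D.lt_of_name v u (by omega)
  -- For either end `a` of the new edge: exactly one neighbour is new, and the old degree is still
  -- below the final one, so the cell of `adj` about to be written belongs to `readCells`.
  have key : ∀ {a b}, D.name a b = j + 1 → D.nbrs (j + 1) a = insert b (D.nbrs j a) ∧
      b ∉ D.nbrs j a ∧ (D.nbrs j a).card < (D.nbrs m a).card := by
    intro a b hab
    have h1 : D.nbrs (j + 1) a = insert b (D.nbrs j a) := by
      ext x
      rw [Finset.mem_insert, mem_nbrs, mem_nbrs]
      constructor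
      · rintro ⟨h1, h2⟩
        by_cases h3 : D.name a x = j + 1
        · exact Or.inl (name_right_inj (by omega) (h3.trans hab.symm))
        · omega
      · rintro (rfl | h) <;> omega
    have h2 : b ∉ D.nbrs j a := by rw [mem_nbrs]; omega
    refine ⟨h1, h2, ?_⟩
    have : (D.nbrs (j + 1) a).card ≤ (D.nbrs m a).card := Finset.card_le_card fun x hx => by
      rw [mem_nbrs] at hx ⊢; omega
    rw [h1, Finset.card_insert_of_notMem h2] at this
    omega
  have key' : ∀ {a}, a ≠ u → a ≠ v → D.nbrs (j + 1) a = D.nbrs j a := by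
    intro a h1 h2
    ext x
    have : D.name a x ≠ j + 1 := fun e => by
      rcases D.name_inj (u := u) (v := v) (by omega) (e.trans hn.symm) with h | h <;> omega
    rw [mem_nbrs, mem_nbrs]
    omega
  obtain ⟨ku1, ku2, ku3⟩ := key hn
  obtain ⟨kv1, kv2, kv3⟩ := key hn'
  refine Spec.rd_bind ?_
  rw [hν.deg u]
  refine Spec.wr_bind ⟨hun, ku3⟩ (Spec.wr_bind hun (Spec.rd_bind ?_))
  rw [show (Function.update (Function.update ν (Loc.adj u (D.nbrs j u).card) v) (Loc.deg u)
    ((D.nbrs j u).card + 1)) (Loc.deg v) = (D.nbrs j v).card by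
      simp [hν.deg, huv.symm]]
  refine Spec.wr_bind ⟨hvn, kv3⟩ (Spec.wr_bind hvn (Spec.wr_bind ?_ (Spec.wr ?_ ?_ ?_)))
  · exact ne_of_eq_of_ne hn (by omega)
  · exact ne_of_eq_of_ne hn' (by omega)
  · norm_num
  refine ⟨rfl, ?_, ?_, ?_, ?_⟩
  · intro f h1 h2
    simpa using hν.inp f h1 h2
  · intro a
    by_cases h1 : a = u
    · rw [h1, ku1, Finset.card_insert_of_notMem ku2]
      simp [huv]
    by_cases h2 : a = v
    · rw [h2, kv1, Finset.card_insert_of_notMem kv2]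
      simp
    · rw [key' h1 h2]
      simp [h1, h2, hν.deg]
  · intro a
    by_cases h1 : a = u
    · subst h1
      rw [ku1, Finset.card_insert_of_notMem ku2, Finset.range_add_one, Finset.image_insert]
      congr 1
      · simp [huv]
      · conv_rhs => rw [← hν.adj u]
        refine Finset.image_congr fun t ht => ?_
        have : t ≠ (D.nbrs j u).card := (Finset.mem_range.1 ht).ne
        simp [huv, this]
    by_cases h2 : a = v
    · subst h2
      rw [kv1, Finset.card_insert_of_notMem kv2, Finset.range_add_one, Finset.image_insert]
      congr 1
      · simp
      · conv_rhs => rw [← hν.adj v]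
        refine Finset.image_congr fun t ht => ?_
        have : t ≠ (D.nbrs j v).card := (Finset.mem_range.1 ht).ne
        simp [huv.symm, this]
    · rw [key' h1 h2]
      conv_rhs => rw [← hν.adj a]
      exact Finset.image_congr fun t ht => by simp [h1, h2]
  · intro a b
    by_cases h1 : D.name a b = j + 1
    · rw [h1, if_pos le_rfl]
      rcases D.name_inj (u := u) (v := v) (by omega) (h1.trans hn.symm) with ⟨rfl, rfl⟩ | ⟨rfl, rfl⟩
      · simp [huv]
      · simp
    · have h2 : ¬(a = u ∧ b = v) := by rintro ⟨rfl, rfl⟩; exact h1 hn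
      have h3 : ¬(a = v ∧ b = u) := by rintro ⟨rfl, rfl⟩; exact h1 hn'
      simp only [Function.update_apply, Loc.eid.injEq, h2, h3, if_false, reduceCtorEq, hν.eid]
      split_ifs <;> omega

end EBBkCH

/-! ### Ranks, supports, and the counting sort of the edges. -/

/-- The rank of `x` in `A` with respect to the relation `r`. -/
def rank {ι : Type*} (A : Finset ι) (r : ι → ι → Prop) [DecidableRel r] (x : ι) : ℕ :=
  (A.filter fun y => r y x).card

section rank

variable {ι : Type*} {A : Finset ι} {r : ι → ι → Prop} [DecidableRel r]

theorem rank_lt_card (hi : ∀ x, ¬r x x) {x : ι} (hx : x ∈ A) : rank A r x < A.card :=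
  Finset.card_lt_card (Finset.filter_ssubset.2 ⟨x, hx, hi x⟩)

theorem rank_lt_rank (hi : ∀ x, ¬r x x) (ht : ∀ x y z, r x y → r y z → r x z) {x y : ι}
    (hx : x ∈ A) (h : r x y) : rank A r x < rank A r y := by
  refine Finset.card_lt_card (Finset.ssubset_iff_subset_ne.2 ⟨fun z hz => ?_, fun e => ?_⟩)
  · rw [Finset.mem_filter] at hz ⊢
    exact ⟨hz.1, ht z x y hz.2 h⟩
  · have : x ∈ A.filter fun z => r z x := e ▸ Finset.mem_filter.2 ⟨hx, h⟩
    exact hi x (Finset.mem_filter.1 this).2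

theorem rank_injOn (hi : ∀ x, ¬r x x) (ht : ∀ x y z, r x y → r y z → r x z)
    (hc : ∀ x ∈ A, ∀ y ∈ A, x ≠ y → r x y ∨ r y x) {x y : ι} (hx : x ∈ A) (hy : y ∈ A)
    (h : rank A r x = rank A r y) : x = y := by
  by_contra hne
  rcases hc x hx y hy hne with h' | h'
  · exact (rank_lt_rank hi ht hx h').ne h
  · exact (rank_lt_rank hi ht hy h').ne' h

/-- Ranks are distinct and below `A.card`, so by counting they take every such value. Hence putting
each element at its rank fills all places; the edge sort and the colour-based vertex ordering both
rest on this. -/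
theorem exists_rank_eq (hi : ∀ x, ¬r x x) (ht : ∀ x y z, r x y → r y z → r x z)
    (hc : ∀ x ∈ A, ∀ y ∈ A, x ≠ y → r x y ∨ r y x) {p : ℕ} (hp : p < A.card) :
    ∃ x ∈ A, rank A r x = p := by
  have h := Finset.surj_on_of_inj_on_of_card_le (s := A) (t := Finset.range A.card)
    (fun x _ => rank A r x) (fun x hx => Finset.mem_range.2 (rank_lt_card hi hx))
    (fun x y hx hy e => rank_injOn hi ht hc hx hy e) (by simp) p (Finset.mem_range.2 hp)
  obtain ⟨x, hx, e⟩ := h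
  exact ⟨x, hx, e.symm⟩

end rank

/-- `ord` lists the edges `1, …, m` at the places `0, …, m - 1`, and `pos` is its inverse. -/
structure IsOrder (m : ℕ) (ord pos : ℕ → ℕ) : Prop where
  one_le : ∀ p < m, 1 ≤ ord p
  le : ∀ p < m, ord p ≤ m
  pos_ord : ∀ p < m, pos (ord p) = p
  pos_lt : ∀ f, 1 ≤ f → f ≤ m → pos f < m
  ord_pos : ∀ f, 1 ≤ f → f ≤ m → ord (pos f) = f

/-- The edges at places `i, …, m - 1` are sorted by their values under `S`, and for `t ≥ s₀` the
cell `bin t` holds the first place of the edges of value at least `t`. -/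
structure Buckets (m i s₀ : ℕ) (S : ℕ → ℕ) (μ : Loc → ℕ) : Prop where
  order : IsOrder m (fun p => μ (.ord p)) (fun f => μ (.pos f))
  sup : ∀ f, 1 ≤ f → f ≤ m → i ≤ μ (.pos f) → μ (.sup f) = S f
  sorted : ∀ p q, i ≤ p → p ≤ q → q < m → S (μ (.ord p)) ≤ S (μ (.ord q))
  bin : ∀ t, s₀ ≤ t → t ≤ m → i ≤ μ (.bin t) ∧ μ (.bin t) ≤ m ∧
    ∀ p, i ≤ p → p < m → (p < μ (.bin t) ↔ S (μ (.ord p)) < t)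

namespace EBBkCH

open Prog NamedGraph

variable {n m : ℕ} {D : NamedGraph n m} {μ : Loc → ℕ} {W : Set Loc} {c : ℝ}

theorem ends_spec {f : ℕ} {Q : ℕ × ℕ → (Loc → ℕ) → List ℕ → Prop} (h : GraphMem D m μ)
    (h1 : 1 ≤ f) (h2 : f ≤ m) (hc : 5 ≤ c)
    (hQ : ∀ a b, (a = D.fst f ∧ b = D.snd f) ∨ (a = D.snd f ∧ b = D.fst f) →
      (D.nbrs m a).card = D.minDeg f → Q (a, b) μ []) : Spec (ends f) μ W c Q := by
  refine Spec.rd_bind (Spec.rd_bind ?_)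
  rw [(h.inp f h1 h2).1, (h.inp f h1 h2).2]
  refine Spec.rd_bind (Spec.rd_bind ?_)
  rw [h.deg, h.deg]
  refine Spec.branch (fun hle => Spec.pure (by linarith) (hQ _ _ (Or.inl ⟨rfl, rfl⟩) ?_))
    (fun hle => Spec.pure (by linarith) (hQ _ _ (Or.inr ⟨rfl, rfl⟩) ?_)) <;>
  · unfold minDeg
    omega

/-- The invariant is indexed by the set `P` of third vertices already met, because the order of a
neighbour list is not specified. The two edge names may arrive in either order, since the scan
starts at the end of smaller degree. Each neighbour costs three reads, a jump and a loop step
besides the body, which gives `d + 5`. -/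
theorem foldTriangles_spec {α : Type} {f : ℕ} {x : α} {body : ℕ → ℕ → ℕ → α → Prog α}
    {Q : α → (Loc → ℕ) → List ℕ → Prop} (h : GraphMem D m μ) (h1 : 1 ≤ f) (h2 : f ≤ m)
    (hW : ∀ x ∈ graphCells, x ∉ W) (pos : ℕ → ℕ)
    (I : Finset ℕ → α → (Loc → ℕ) → List ℕ → Prop) {d : ℝ} (hd : 0 ≤ d)
    (hc : D.minDeg f * (d + 5) + 7 ≤ c) (h0 : I ∅ x μ [])
    (hs : ∀ P w y ν o, P ⊆ D.tri pos 0 f → w ∈ D.tri pos 0 f → w ∉ P → I P y ν o →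
      (∀ x, x ∉ W → ν x = μ x) → ∀ f₁ f₂,
      (f₁ = D.name (D.fst f) w ∧ f₂ = D.name w (D.snd f)) ∨
        (f₁ = D.name w (D.snd f) ∧ f₂ = D.name (D.fst f) w) →
      Spec (body w f₁ f₂ y) ν W d fun y' ν' o' => I (insert w P) y' ν' (o ++ o'))
    (hf : ∀ y ν o, I (D.tri pos 0 f) y ν o → (∀ x, x ∉ W → ν x = μ x) → Q y ν o) :
    Spec (foldTriangles f x body) μ W c Q := by
  refine Spec.bind (W' := ∅) (R := fun ab ν o => μ = ν ∧ o = [] ∧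
    ((ab.1 = D.fst f ∧ ab.2 = D.snd f) ∨ (ab.1 = D.snd f ∧ ab.2 = D.fst f)) ∧
      (D.nbrs m ab.1).card = D.minDeg f) 5
    (ends_spec h h1 h2 le_rfl fun a b hab hd => ⟨rfl, rfl, hab, hd⟩) (Set.empty_subset _) ?_
  rintro ⟨a, b⟩ _ _ ⟨rfl, rfl, hab, hdeg⟩ -
  dsimp only at hab hdeg ⊢
  refine Spec.rd_bind ?_
  rw [h.deg, hdeg]
  have htri : ∀ w, w ∈ D.tri pos 0 f ↔ D.name a w ≠ 0 ∧ D.name w b ≠ 0 := by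
    intro w
    rw [mem_tri_zero]
    rcases hab with ⟨rfl, rfl⟩ | ⟨rfl, rfl⟩
    · rfl
    · rw [D.name_comm w, D.name_comm w, and_comm]
  let P : ℕ → Finset ℕ := fun t =>
    ((Finset.range t).image fun j => μ (.adj a j)).filter fun w => D.name w b ≠ 0
  have hPm : P (D.minDeg f) = D.tri pos 0 f := by
    ext w
    rw [Finset.mem_filter, ← hdeg, h.adj, mem_nbrs_all, htri]
  refine Spec.foldN_const (fun t y ν o => I (P t) y ν o) (d + 4) (by linarith) h0 ?_ ?_
  swap
  · intro y ν o hI hν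
    exact hf y ν o (hPm ▸ hI) hν
  intro t ht y ν o hI hν
  have hg : GraphMem D m ν := h.congr fun x hx => hν x (hW x hx)
  have ht' : t < (D.nbrs m a).card := hdeg ▸ ht
  have hmem := mem_nbrs_all.1 (h.adj_mem ht')
  have hP : P (t + 1) = if D.name (μ (.adj a t)) b = 0 then P t else insert (μ (.adj a t)) (P t) := by
    change Finset.filter _ (Finset.image _ (Finset.range (t + 1))) = _
    rw [Finset.range_add_one, Finset.image_insert, Finset.filter_insert]
    split_ifs <;> simp_all [P]
  refine Spec.rd_bind ?_
  rw [hν (.adj a t) (hW (.adj a t) trivial)]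
  refine Spec.rd_bind (Spec.rd_bind ?_)
  rw [hg.eid_all, hg.eid_all]
  refine Spec.branch (fun e => Spec.pure (by linarith) ?_) (fun e => ?_)
  · rw [hP, if_pos e, List.append_nil]
    exact hI
  · rw [hP, if_neg e]
    refine (hs (P t) _ y ν o ?_ ?_ ?_ hI hν _ _ ?_).mono subset_rfl (by linarith)
      fun _ _ _ h _ => h
    · intro w hw
      rw [Finset.mem_filter, Finset.mem_image] at hw
      obtain ⟨⟨j, hj, rfl⟩, hw⟩ := hw
      exact (htri _).2 ⟨mem_nbrs_all.1 (h.adj_mem ((Finset.mem_range.1 hj).trans ht')), hw⟩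
    · exact (htri _).2 ⟨hmem, e⟩
    · rw [Finset.mem_filter, Finset.mem_image]
      rintro ⟨⟨j, hj, e'⟩, -⟩
      exact (Finset.mem_range.1 hj).ne (h.adj_inj ((Finset.mem_range.1 hj).trans ht') ht' e')
    · rcases hab with ⟨rfl, rfl⟩ | ⟨rfl, rfl⟩
      · exact Or.inl ⟨rfl, rfl⟩
      · exact Or.inr ⟨D.name_comm _ _, D.name_comm _ _⟩

/-- The cells that are written while the truss-based ordering is computed. -/
def orderCells (m : ℕ) : Set Loc
  | .sup f | .pos f => 1 ≤ f ∧ f ≤ m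
  | .cnt s | .nxt s | .bin s => s ≤ m
  | .ord p => p < m
  | _ => False

theorem graphCells_notMem_orderCells {m : ℕ} : ∀ x ∈ graphCells, x ∉ orderCells m := by
  rintro (_ | _ | _ | _ | _ | _ | _ | _ | _ | _ | _ | _ | _ | _ | _ | _) h <;> first | exact h.elim | exact fun h => h

theorem supports_spec (h : GraphMem D m μ) :
    Spec (supports m) μ {x | ∃ f, 1 ≤ f ∧ f ≤ m ∧ x = .sup f}
      (5 * ∑ j ∈ Finset.range m, (D.minDeg (j + 1) : ℝ) + 9 * m + 1)
      fun _ ν o => o = [] ∧ ∀ f, 1 ≤ f → f ≤ m → ν (.sup f) = D.supp id 0 f := by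
  have hW : ∀ x ∈ graphCells, x ∉ {x | ∃ f, 1 ≤ f ∧ f ≤ m ∧ x = Loc.sup f} := by
    rintro x hx ⟨f, -, -, rfl⟩
    exact hx
  refine Spec.foldN (fun j _ ν o => o = [] ∧ ∀ f, 1 ≤ f → f ≤ j → ν (.sup f) = D.supp id 0 f)
    (fun j => 5 * D.minDeg (j + 1) + 8) ?_ ⟨rfl, fun f _ _ => by omega⟩ ?_ fun _ ν o h _ => h
  · rw [Finset.sum_add_distrib, Finset.sum_add_distrib, ← Finset.mul_sum]
    simp only [Finset.sum_const, Finset.card_range, nsmul_eq_mul]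
    linarith
  · rintro j hj _ ν o ⟨rfl, hν⟩ hfr
    refine Spec.bind (R := fun s ν' o' => o' = [] ∧ ν' = ν ∧ s = D.supp id 0 (j + 1)) (W' := ∅)
      (5 * D.minDeg (j + 1) + 7) ?_ (Set.empty_subset _) ?_
    · refine foldTriangles_spec (h.congr fun x hx => hfr x (hW x hx)) (by omega) (by omega)
        (fun _ _ => id) id (fun P s ν' o' => o' = [] ∧ ν' = ν ∧ s = P.card) le_rfl (by linarith)
        ⟨rfl, rfl, rfl⟩ ?_ fun _ _ _ h _ => h
      rintro P w s _ _ - - hw ⟨rfl, rfl, rfl⟩ - _ _ -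
      exact Spec.pure le_rfl ⟨rfl, rfl, (Finset.card_insert_of_notMem hw).symm⟩
    · rintro _ _ _ ⟨rfl, rfl, rfl⟩ -
      refine Spec.wr ⟨j + 1, by omega, by omega, rfl⟩ (by linarith) ⟨rfl, fun f h1 h2 => ?_⟩
      by_cases e : f = j + 1
      · rw [e, Function.update_self]
      · rw [Function.update_of_ne (by simpa using e)]
        exact hν f h1 (by omega)

/-- When an edge is placed, `nxt` holds the number of edges of smaller support plus the number of
earlier edges of equal support. That is the rank of the edge in the lexicographic order by support
and name, so the result is a sorted permutation. -/
theorem sortEdges_spec {S : ℕ → ℕ} (hS : ∀ f, 1 ≤ f → f ≤ m → S f ≤ m ∧ μ (.sup f) = S f)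
    (h0 : ∀ s, μ (.cnt s) = 0) :
    Spec (sortEdges m) μ {x | x ∈ orderCells m ∧ ∀ f, x ≠ .sup f} (14 * m + 8)
      fun _ ν o => o = [] ∧ Buckets m 0 0 S ν := by
  have hsup : ∀ f, Loc.sup f ∉ {x | x ∈ orderCells m ∧ ∀ f, x ≠ .sup f} := fun f h => h.2 f rfl
  -- `N j s` is the content of `cnt s` after `j` edges, and `K s` is the first place of the block of
  -- support `s`. Loop indices start at `0` and edge names at `1`, hence `f + 1`.
  let N : ℕ → ℕ → ℕ := fun j s => ((Finset.range j).filter fun f => S (f + 1) = s).card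
  let K : ℕ → ℕ := fun s => ((Finset.range m).filter fun f => S (f + 1) < s).card
  have hN : ∀ j s, N (j + 1) s = N j s + if S (j + 1) = s then 1 else 0 := by
    intro j s
    simp only [N, Finset.range_add_one, Finset.filter_insert]
    split_ifs
    · rw [Finset.card_insert_of_notMem (by simp)]
    · rfl
  have hK : ∀ s, K (s + 1) = K s + N m s := by
    intro s
    simp only [K, N]
    rw [← Finset.card_union_of_disjoint]
    · congr 1
      ext f
      simp only [Finset.mem_filter, Finset.mem_union]
      rw [← and_or_left, Nat.lt_succ_iff_lt_or_eq]
    · exact Finset.disjoint_filter.2 fun f _ h1 h2 => by omega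
  let r : ℕ → ℕ → Prop := fun g f => S (g + 1) < S (f + 1) ∨ (S (g + 1) = S (f + 1) ∧ g < f)
  have hri : ∀ x, ¬r x x := fun x => by simp [r]
  have hrt : ∀ x y z, r x y → r y z → r x z := fun x y z => by simp only [r]; omega
  have hrc : ∀ x ∈ Finset.range m, ∀ y ∈ Finset.range m, x ≠ y → r x y ∨ r y x :=
    fun x _ y _ => by simp only [r]; omega
  have hrd : DecidableRel r := fun _ _ => inferInstanceAs (Decidable (_ ∨ _))
  let R : ℕ → ℕ := rank (Finset.range m) r
  have hRlt : ∀ f < m, R f < m := fun f hf => by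
    simpa using rank_lt_card hri (Finset.mem_range.2 hf)
  have hRinj : ∀ f < m, ∀ g < m, R f = R g → f = g := fun f hf g hg e =>
    rank_injOn hri hrt hrc (Finset.mem_range.2 hf) (Finset.mem_range.2 hg) e
  have hR : ∀ f < m, R f = K (S (f + 1)) + N f (S (f + 1)) := by
    intro f hf
    simp only [R, K, N, rank]
    rw [← Finset.card_union_of_disjoint]
    · congr 1
      ext g
      simp only [Finset.mem_filter, Finset.mem_union, Finset.mem_range, r]
      omega
    · exact Finset.disjoint_left.2 fun g h1 h2 => by
        rw [Finset.mem_filter] at h1 h2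
        omega
  -- The places before `K t` hold exactly the edges of support below `t`; this becomes the `bin`
  -- condition of `Buckets`.
  have hRK : ∀ f < m, ∀ t, R f < K t ↔ S (f + 1) < t := by
    intro f hf t
    by_cases h : S (f + 1) < t
    · refine iff_of_true (Finset.card_lt_card (Finset.ssubset_iff_subset_ne.2
        ⟨fun g hg => ?_, fun e => ?_⟩)) h
      · simp only [Finset.mem_filter, Finset.mem_range, r] at hg ⊢
        omega
      · have : f ∈ (Finset.range m).filter fun g => r g f :=
          e ▸ Finset.mem_filter.2 ⟨Finset.mem_range.2 hf, h⟩
        exact hri f (Finset.mem_filter.1 this).2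
    · refine iff_of_false (not_lt.2 (Finset.card_le_card fun g hg => ?_)) h
      simp only [Finset.mem_filter, Finset.mem_range, r] at hg ⊢
      omega
  refine Spec.bind (W' := {x | ∃ s ≤ m, x = .cnt s})
    (R := fun _ ν o => o = [] ∧ ∀ s, ν (.cnt s) = N m s) (4 * m + 1) ?_
    (by rintro _ ⟨s, hs, rfl⟩; exact ⟨hs, by simp⟩) ?_
  · refine Spec.foldN_const (fun j _ ν o => o = [] ∧ ∀ s, ν (.cnt s) = N j s) 3 (by linarith)
      ⟨rfl, by simpa [N] using h0⟩ ?_ fun _ ν o h _ => h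
    rintro j hj _ ν o ⟨rfl, hν⟩ hfr
    refine Spec.rd_bind ?_
    rw [hfr _ (by simp), (hS (j + 1) (by omega) (by omega)).2]
    refine Spec.rd_bind (Spec.wr ⟨_, (hS (j + 1) (by omega) (by omega)).1, rfl⟩ (by norm_num)
      ⟨rfl, fun s => ?_⟩)
    rw [hN, Function.update_apply]
    split_ifs with h1 h2 h2
    · rw [hν, h2]
    · exact absurd (Loc.cnt.inj h1).symm h2
    · exact absurd (congrArg Loc.cnt h2).symm h1
    · exact hν s
  rintro _ μ₁ _ ⟨rfl, hcnt⟩ hfr₁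
  refine Spec.bind (W' := {x | ∃ s ≤ m, x = .bin s ∨ x = .nxt s})
    (R := fun _ ν o => o = [] ∧ ∀ s ≤ m, ν (.bin s) = K s ∧ ν (.nxt s) = K s) (4 * m + 5) ?_
    (by rintro _ ⟨s, hs, rfl | rfl⟩ <;> exact ⟨hs, by simp⟩) ?_
  · refine Spec.foldN_const (fun j b ν o => b = K j ∧ o = [] ∧
      ∀ s < j, ν (.bin s) = K s ∧ ν (.nxt s) = K s) 3 (by push_cast; linarith)
      ⟨by simp [K], rfl, fun s hs => by omega⟩ ?_
      fun _ ν o h _ => ⟨h.2.1, fun s hs => h.2.2 s (by omega)⟩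
    rintro j hj b ν o ⟨rfl, rfl, hν⟩ hfr
    refine Spec.wr_bind ⟨j, by omega, Or.inl rfl⟩ (Spec.wr_bind ⟨j, by omega, Or.inr rfl⟩
      (Spec.rd_bind (Spec.pure (by norm_num) ⟨?_, rfl, fun s hs => ?_⟩)))
    · rw [Function.update_of_ne (by simp), Function.update_of_ne (by simp), hfr _ (by simp), hcnt,
        hK]
    · by_cases e : s = j
      · simp [e]
      · simpa [e] using hν s (by omega)
  rintro _ μ₂ _ ⟨rfl, hbin⟩ hfr₂
  refine (Spec.foldN_const (W := {x | (∃ p < m, x = .ord p) ∨ (∃ f, 1 ≤ f ∧ f ≤ m ∧ x = .pos f) ∨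
      ∃ s ≤ m, x = .nxt s}) (Q := fun _ ν o => o = [] ∧ ∀ f < m, ν (.ord (R f)) = f + 1 ∧
        ν (.pos (f + 1)) = R f) (c := 6 * m + 1)
      (fun j _ ν o => (o = [] ∧ ∀ f < j, ν (.ord (R f)) = f + 1 ∧ ν (.pos (f + 1)) = R f) ∧
        ∀ s ≤ m, ν (.nxt s) = K s + N j s) 5 (by linarith)
      ⟨⟨rfl, fun f hf => by omega⟩, fun s hs => by simp [(hbin s hs).2, N]⟩ ?_
      fun _ ν o h _ => h.1).mono ?_ (by linarith) ?_
  · rintro j hj _ ν o ⟨⟨rfl, hν⟩, hnxt⟩ hfr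
    obtain ⟨hSm, hSv⟩ := hS (j + 1) (by omega) (by omega)
    refine Spec.rd_bind ?_
    rw [hfr _ (by simp), hfr₂ _ (by simp), hfr₁ _ (by simp), hSv]
    refine Spec.rd_bind ?_
    rw [hnxt _ hSm, ← hR j hj]
    refine Spec.wr_bind (Or.inl ⟨_, hRlt j hj, rfl⟩) (Spec.wr_bind (Or.inr (Or.inl
      ⟨j + 1, by omega, by omega, rfl⟩)) (Spec.wr (Or.inr (Or.inr ⟨_, hSm, rfl⟩)) (by norm_num)
      ⟨⟨rfl, fun f hf => ?_⟩, fun s hs => ?_⟩))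
    · by_cases e : f = j
      · simp [e]
      · have : R f ≠ R j := fun e' => e (hRinj f (by omega) j hj e')
        simpa [e, this] using hν f (by omega)
    · rw [hN, Function.update_apply]
      split_ifs with h1 h2 h2
      · rw [hR j hj, h2, add_assoc]
      · exact absurd (Loc.nxt.inj h1).symm h2
      · exact absurd (congrArg Loc.nxt h2).symm h1
      · simpa using hnxt s hs
  · rintro x (⟨p, hp, rfl⟩ | ⟨f, h1, h2, rfl⟩ | ⟨s, hs, rfl⟩)
    exacts [⟨hp, by simp⟩, ⟨⟨h1, h2⟩, by simp⟩, ⟨hs, by simp⟩]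
  · rintro _ ν _ ⟨rfl, hν⟩ hfr
    have hex : ∀ p < m, ∃ f < m, R f = p := fun p hp => by
      obtain ⟨f, hf, e⟩ := exists_rank_eq (A := Finset.range m) hri hrt hrc (p := p) (by simpa using hp)
      exact ⟨f, Finset.mem_range.1 hf, e⟩
    refine ⟨rfl, ⟨⟨?_, ?_, ?_, ?_, ?_⟩, ?_, ?_, ?_⟩⟩
    · intro p hp
      obtain ⟨f, hf, rfl⟩ := hex p hp
      simp [hν f hf]
    · intro p hp
      obtain ⟨f, hf, rfl⟩ := hex p hp
      simp only [hν f hf]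
      omega
    · intro p hp
      obtain ⟨f, hf, rfl⟩ := hex p hp
      simp only [hν f hf]
    · intro f h1 h2
      obtain ⟨f, rfl⟩ := Nat.exists_eq_add_of_le' h1
      simpa only [hν f h2] using hRlt f h2
    · intro f h1 h2
      obtain ⟨f, rfl⟩ := Nat.exists_eq_add_of_le' h1
      simp only [hν f h2]
    · intro f h1 h2 _
      rw [hfr _ (by simp), hfr₂ _ (by simp), hfr₁ _ (by simp), (hS f h1 h2).2]
    · intro p q _ hpq hq
      obtain ⟨f, hf, rfl⟩ := hex p (by omega)
      obtain ⟨g, hg, rfl⟩ := hex q hq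
      rw [(hν f hf).1, (hν g hg).1]
      by_contra hlt
      exact absurd (rank_lt_rank hri hrt (Finset.mem_range.2 hg) (Or.inl (not_le.1 hlt)))
        (not_lt.2 hpq)
    · intro t _ ht
      have hb : ν (.bin t) = K t := by rw [hfr _ (by simp), (hbin t ht).1]
      refine ⟨Nat.zero_le _, ?_, fun p _ hp => ?_⟩
      · rw [hb]
        exact (Finset.card_filter_le _ _).trans_eq (Finset.card_range m)
      · obtain ⟨f, hf, rfl⟩ := hex p hp
        rw [hb, (hν f hf).1, hRK f hf]

end EBBkCH

/-! ### Peeling with buckets, and the truss-based ordering. -/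

namespace IsOrder

variable {m : ℕ} {ord pos : ℕ → ℕ}

theorem pos_inj (h : IsOrder m ord pos) {f g : ℕ} (hf : 1 ≤ f) (hf' : f ≤ m) (hg : 1 ≤ g)
    (hg' : g ≤ m) (e : pos f = pos g) : f = g := by
  rw [← h.ord_pos f hf hf', e, h.ord_pos g hg hg']

/-- The updates are nested in the order in which `lower` writes the cells. The case `p = q` is
included, as needed when the lowered edge already heads its block. -/
theorem swap (h : IsOrder m ord pos) {p q : ℕ} (hp : p < m) (hq : q < m) :
    IsOrder m (Function.update (Function.update ord q (ord p)) p (ord q))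
      (Function.update (Function.update pos (ord p) q) (ord q) p) := by
  refine ⟨fun x hx => ?_, fun x hx => ?_, fun x hx => ?_, fun f h1 h2 => ?_, fun f h1 h2 => ?_⟩
  · simp only [Function.update_apply]
    split_ifs <;> exact h.one_le _ ‹_›
  · simp only [Function.update_apply]
    split_ifs <;> exact h.le _ ‹_›
  · have := h.pos_ord x hx
    have := h.pos_ord p hp
    have := h.pos_ord q hq
    simp only [Function.update_apply]
    split_ifs <;> simp_all
  · simp only [Function.update_apply]
    split_ifs <;> first | assumption | exact h.pos_lt f h1 h2
  · have := h.pos_ord p hp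
    have := h.pos_ord q hq
    have := h.ord_pos f h1 h2
    simp only [Function.update_apply]
    split_ifs <;> simp_all

end IsOrder

namespace NamedGraph

variable {n m : ℕ} {D : NamedGraph n m}

theorem name_ne (D : NamedGraph n m) {u v : ℕ} (h : D.name u v ≠ 0) : u ≠ v := by
  rintro rfl
  exact h (D.name_self u)

theorem mem_tri_name {pos : ℕ → ℕ} {i a b w : ℕ} (h : D.name a b ≠ 0) :
    w ∈ D.tri pos i (D.name a b) ↔ (D.name a w ≠ 0 ∧ D.name b w ≠ 0) ∧
      i ≤ pos (D.name a w) ∧ i ≤ pos (D.name b w) := by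
  rw [mem_tri, D.name_comm w]
  rcases D.ends_name a b h with ⟨h1, h2⟩ | ⟨h1, h2⟩ <;> rw [h1, h2]
  rw [and_comm (a := D.name b w ≠ 0), and_comm (a := i ≤ pos (D.name b w))]

theorem tri_congr {pos pos' : ℕ → ℕ} {i : ℕ}
    (h : ∀ g, 1 ≤ g → g ≤ m → (i ≤ pos g ↔ i ≤ pos' g)) (f : ℕ) :
    D.tri pos i f = D.tri pos' i f := by
  ext w
  rw [mem_tri, mem_tri]
  refine and_congr_right fun hw => ?_
  rw [h _ (Nat.one_le_iff_ne_zero.2 hw.1) (D.name_le _ _),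
    h _ (Nat.one_le_iff_ne_zero.2 hw.2) (D.name_le _ _)]

/-- The edge `g` lies in a triangle formed by `f`, a vertex of `P`, and edges behind place `i`. -/
def Touched (D : NamedGraph n m) (pos : ℕ → ℕ) (i f : ℕ) (P : Finset ℕ) (g : ℕ) : Prop :=
  ∃ w ∈ P, w ∈ D.tri pos (i + 1) f ∧ (g = D.name (D.fst f) w ∨ g = D.name (D.snd f) w)

open Classical in
-- The triangles that `g` loses when `f` is removed are those containing both `f` and `g`. Two
-- distinct edges lie in at most one common triangle, so the loss is `0` or `1`.
theorem supp_succ {pos : ℕ → ℕ} {i f g : ℕ} (hf1 : 1 ≤ f) (hf2 : f ≤ m) (hg1 : 1 ≤ g)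
    (hg2 : g ≤ m) (hi : ∀ h, 1 ≤ h → h ≤ m → (pos h = i ↔ h = f)) (hg : i + 1 ≤ pos g) :
    D.supp pos (i + 1) g =
      D.supp pos i g - if D.Touched pos i f (D.tri pos 0 f) g then 1 else 0 := by
  obtain ⟨c, d, rfl⟩ : ∃ c d, D.name c d = g := ⟨_, _, D.name_ends g hg1 hg2⟩
  have hcd : D.name c d ≠ 0 := by omega
  have hcd' : D.name d c ≠ 0 := D.name_comm c d ▸ hcd
  have hne := D.name_ne hcd
  have hff := D.name_ends f hf1 hf2
  have hfi := (hi f hf1 hf2).2 rfl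
  have hsub : D.tri pos (i + 1) (D.name c d) ⊆ D.tri pos i (D.name c d) := fun w hw => by
    rw [mem_tri_name hcd] at hw ⊢
    exact ⟨hw.1, by omega, by omega⟩
  have hmem : ∀ w, w ∈ D.tri pos i (D.name c d) \ D.tri pos (i + 1) (D.name c d) ↔
      w ∈ D.tri pos i (D.name c d) ∧ (D.name c w = f ∨ D.name d w = f) := by
    intro w
    rw [Finset.mem_sdiff]
    refine and_congr_right fun hw => ?_
    rw [mem_tri_name hcd] at hw
    have h1 := hi _ (Nat.one_le_iff_ne_zero.2 hw.1.1) (D.name_le _ _)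
    have h2 := hi _ (Nat.one_le_iff_ne_zero.2 hw.1.2) (D.name_le _ _)
    rw [mem_tri_name hcd, ← h1, ← h2]
    rw [and_iff_right hw.1]
    omega
  -- A lost triangle has `f` as its side from `x` to an end of `g`, so `x` is the end of `f` that is
  -- not on `g`.
  have huniq : ∀ x ∈ D.tri pos i (D.name c d) \ D.tri pos (i + 1) (D.name c d),
      ∀ y ∈ D.tri pos i (D.name c d) \ D.tri pos (i + 1) (D.name c d), x = y := by
    intro x hx y hy
    rw [hmem, mem_tri_name hcd] at hx hy
    have e1 := D.name_ne hx.1.1.1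
    have e2 := D.name_ne hx.1.1.2
    have e3 := D.name_ne hy.1.1.1
    have e4 := D.name_ne hy.1.1.2
    rcases hx.2 with h1 | h1 <;> rcases hy.2 with h2 | h2 <;>
      rcases D.name_inj (by omega) (h1.trans h2.symm) with h | h <;> omega
  have hcard := Finset.card_sdiff_add_card_eq_card hsub
  rw [supp, supp, ← hcard]
  suffices H : (D.tri pos i (D.name c d) \ D.tri pos (i + 1) (D.name c d)).card =
      if D.Touched pos i f (D.tri pos 0 f) (D.name c d) then 1 else 0 by omega
  split_ifs with ht
  · rw [Finset.card_eq_one]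
    obtain ⟨w, -, hw, hgw⟩ := ht
    rw [← hff, mem_tri_name (by omega)] at hw
    have hx : ∃ x, x ∈ D.tri pos i (D.name c d) ∧ (D.name c x = f ∨ D.name d x = f) := by
      rcases hgw with e | e
      · refine ⟨D.snd f, ?_⟩
        rw [e, mem_tri_name hw.1.1, hff, D.name_comm w]
        refine ⟨⟨⟨by omega, hw.1.2⟩, hfi.ge, by omega⟩, ?_⟩
        rcases D.name_inj hw.1.1 e with ⟨h1, h2⟩ | ⟨h1, h2⟩ <;> rw [h1, h2, hff] <;> simp
      · refine ⟨D.fst f, ?_⟩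
        rw [e, mem_tri_name hw.1.2, D.name_comm _ (D.fst f), hff, D.name_comm w]
        refine ⟨⟨⟨by omega, hw.1.1⟩, hfi.ge, by omega⟩, ?_⟩
        have hff' : D.name (D.snd f) (D.fst f) = f := D.name_comm (D.fst f) _ ▸ hff
        rcases D.name_inj hw.1.2 e with ⟨h1, h2⟩ | ⟨h1, h2⟩ <;> rw [h1, h2, hff'] <;> simp
    obtain ⟨x, hx⟩ := hx
    exact ⟨x, Finset.eq_singleton_iff_unique_mem.2
      ⟨(hmem x).2 hx, fun y hy => huniq y hy x ((hmem x).2 hx)⟩⟩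
  · rw [Finset.card_eq_zero, Finset.eq_empty_iff_forall_notMem]
    intro x hx
    have hd := hx
    rw [hmem] at hx
    obtain ⟨hx, hxf⟩ := hx
    rw [mem_tri_name hcd] at hx
    have e1 := D.name_ne hx.1.1
    have e2 := D.name_ne hx.1.2
    refine ht ?_
    -- With `g = ab` and `f = ax`, the vertex `b` is the third vertex of the triangle on `f`, and it
    -- witnesses that `g` is touched.
    have key : ∀ a b, D.name a b = D.name c d → D.name a x = f → D.name b x ≠ 0 →
        i ≤ pos (D.name b x) → D.Touched pos i f (D.tri pos 0 f) (D.name c d) := by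
      intro a b hab hax hbx hp
      have hab' := D.name_ne (u := a) (v := b) (by omega)
      have hp' : i + 1 ≤ pos (D.name b x) := by
        refine Nat.lt_of_le_of_ne hp fun e => hab' ?_
        have := (hi _ (Nat.one_le_iff_ne_zero.2 hbx) (D.name_le _ _)).1 e.symm
        have hx' := D.name_ne hbx
        have hx'' := D.name_ne (u := a) (v := x) (by omega)
        rcases D.name_inj hbx (hax.trans this.symm) with h | h <;> omega
      have hb : b ∈ D.tri pos (i + 1) f := by
        rw [← hax, mem_tri_name (by omega), D.name_comm x b]
        exact ⟨⟨by omega, hbx⟩, hab ▸ hg, hp'⟩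
      refine ⟨b, ?_, hb, ?_⟩
      · have := mem_tri.1 hb
        exact mem_tri_zero.2 this.1
      · have h1 := D.ends_name a x (by omega)
        rw [hax] at h1
        rcases h1 with h1 | h1
        · left; rw [h1.1, hab]
        · right; rw [h1.2, hab]
    rcases hxf with e | e
    · exact key c d rfl e hx.1.2 hx.2.2
    · exact key d c (D.name_comm d c) e hx.1.1 hx.2.1

end NamedGraph

namespace EBBkCH

open Prog NamedGraph

variable {n m : ℕ} {D : NamedGraph n m} {μ : Loc → ℕ}

/-- The edge `f` is exchanged with the first edge of its block, and the start of the block moves one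
place to the right. So `f` becomes the last edge of the block of support `S f - 1`, and the array
stays sorted. -/
theorem lower_spec {i s₀ : ℕ} {S : ℕ → ℕ} {f : ℕ} (h : Buckets m i s₀ S μ) (h1 : 1 ≤ f)
    (h2 : f ≤ m) (hi : i ≤ μ (.pos f)) (hs : 1 ≤ S f) (hs₀ : s₀ ≤ S f) (hsm : S f ≤ m) :
    Spec (lower f) μ (orderCells m) 10 fun _ ν o => o = [] ∧
      Buckets m i s₀ (Function.update S f (S f - 1)) ν ∧
      (∀ g, 1 ≤ g → g ≤ m → ∀ j ≤ i, (j ≤ ν (.pos g) ↔ j ≤ μ (.pos g))) ∧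
      ∀ p < i, ν (.ord p) = μ (.ord p) := by
  obtain ⟨b1, b2, b3⟩ := h.bin (S f) hs₀ hsm
  have hO := h.order
  refine Spec.rd_bind ?_
  rw [h.sup f h1 h2 hi]
  refine Spec.rd_bind (Spec.rd_bind (Spec.rd_bind ?_))
  have hp : μ (.pos f) < m := hO.pos_lt f h1 h2
  have hfp : μ (.ord (μ (.pos f))) = f := hO.ord_pos f h1 h2
  generalize hpe : μ (.pos f) = p at *
  generalize hqe : μ (.bin (S f)) = q at *
  have hqp : q ≤ p := by
    by_contra hlt
    have := (b3 p hi hp).1 (by omega)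
    rw [hfp] at this
    omega
  have hq : q < m := by omega
  have hgq : μ (.pos (μ (.ord q))) = q := hO.pos_ord q hq
  have hg1 : 1 ≤ μ (.ord q) := hO.one_le q hq
  have hg2 : μ (.ord q) ≤ m := hO.le q hq
  -- Sortedness gives one inequality, since `q ≤ p`; the meaning of `bin (S f) = q` gives the other.
  have hSg : S (μ (.ord q)) = S f := by
    have h3 := h.sorted q p b1 hqp hp
    have h4 := b3 q b1 hq
    rw [hfp] at h3
    omega
  generalize hge : μ (.ord q) = g at *
  refine Spec.wr_bind hq (Spec.wr_bind ⟨h1, h2⟩ (Spec.wr_bind hp (Spec.wr_bind ⟨hg1, hg2⟩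
    (Spec.wr_bind hsm (Spec.wr ⟨h1, h2⟩ (by norm_num) ⟨rfl, ?_⟩)))))
  set ν := Function.update (Function.update (Function.update (Function.update (Function.update
    (Function.update μ (.ord q) f) (.pos f) q) (.ord p) g) (.pos g) p) (.bin (S f)) (q + 1))
    (.sup f) (S f - 1) with hν
  have eo : ∀ x, ν (.ord x) = if x = p then g else if x = q then f else μ (.ord x) := by
    intro x; simp [hν, Function.update_apply]
  have ep : ∀ x, ν (.pos x) = if x = g then p else if x = f then q else μ (.pos x) := by
    intro x; simp [hν, Function.update_apply]
  have eb : ∀ x, ν (.bin x) = if x = S f then q + 1 else μ (.bin x) := by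
    intro x; simp [hν, Function.update_apply]
  have es : ∀ x, ν (.sup x) = if x = f then S f - 1 else μ (.sup x) := by
    intro x; simp [hν, Function.update_apply]
  have hord : IsOrder m (fun p => ν (.ord p)) (fun f => ν (.pos f)) := by
    have := hO.swap hp hq
    simp only [hfp, hge] at this
    convert this using 1
    · funext x
      simp only [eo, Function.update_apply]
    · funext x
      simp only [ep, Function.update_apply]
  have hSo : ∀ x, i ≤ x → x < m → x ≠ q → Function.update S f (S f - 1) (ν (.ord x)) =
      S (μ (.ord x)) := by
    intro x hx hxm hxq
    have hxf : ν (.ord x) ≠ f := fun e => by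
      have h3 := hord.pos_ord x hxm
      simp only [e, ep, if_true] at h3
      split_ifs at h3 with h4
      · exact hxq (by rw [← hgq, ← h4, hpe, h3])
      · exact hxq h3.symm
    rw [Function.update_of_ne hxf, eo]
    split_ifs with h3
    · rw [h3, hfp, hSg]
    · rfl
  have hνq : ν (.ord q) = f := by
    rw [eo]
    split_ifs with h3
    · rw [← hge, h3, hfp]
    · rfl
    · contradiction
  have hSq : Function.update S f (S f - 1) (ν (.ord q)) = S f - 1 := by
    rw [hνq, Function.update_self]
  -- Both exchanged places are at least `i`. For `j ≤ i` the set of edges from place `j` on is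
  -- therefore unchanged, and so are the supports computed in it.
  have hpos : ∀ x, 1 ≤ x → x ≤ m → ∀ j ≤ i, (j ≤ ν (.pos x) ↔ j ≤ μ (.pos x)) := by
    intro x hx1 hx2 j hj
    rw [ep]
    split_ifs with h3 h4
    · rw [h3, hgq]; omega
    · rw [h4, hpe]; omega
    · rfl
  refine ⟨⟨hord, ?_, ?_, ?_⟩, hpos, ?_⟩
  · intro x hx1 hx2 hxi
    rw [es]
    split_ifs with h3
    · rw [h3, Function.update_self]
    · rw [Function.update_of_ne h3]
      exact h.sup x hx1 hx2 ((hpos x hx1 hx2 i le_rfl).1 hxi)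
  · intro x y hx hxy hy
    by_cases hxq : x = q
    · subst hxq
      by_cases hyq : y = x
      · rw [hyq]
      · rw [hSq, hSo y (by omega) hy hyq]
        have := h.sorted x y hx hxy hy
        rw [hge] at this
        omega
    · rw [hSo x hx (by omega) hxq]
      by_cases hyq : y = q
      · subst hyq
        rw [hSq]
        have := (b3 x hx (by omega)).1 (by omega)
        omega
      · rw [hSo y (by omega) hy hyq]
        exact h.sorted x y hx hxy hy
  · intro t ht htm
    obtain ⟨c1, c2, c3⟩ := h.bin t ht htm
    rw [eb]
    by_cases hts : t = S f
    · rw [if_pos hts]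
      refine ⟨by omega, by omega, fun x hx hxm => ?_⟩
      by_cases hxq : x = q
      · subst hxq
        rw [hSq]
        omega
      · rw [hSo x hx hxm hxq, hts, ← b3 x hx hxm]
        omega
    · rw [if_neg hts]
      refine ⟨c1, c2, fun x hx hxm => ?_⟩
      by_cases hxq : x = q
      · subst hxq
        rw [hSq, c3 x hx hxm, hge]
        omega
      · rw [hSo x hx hxm hxq, c3 x hx hxm]
  · intro x hx
    rw [eo, if_neg (by omega), if_neg (by omega)]

end EBBkCH

/-- The truss-based ordering of the edges: at each place stands an edge of smallest support among
the edges from that place on. -/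
structure IsTruss {n m : ℕ} (D : NamedGraph n m) (ord pos : ℕ → ℕ) : Prop where
  order : IsOrder m ord pos
  min : ∀ i < m, ∀ g, 1 ≤ g → g ≤ m → i ≤ pos g → D.supp pos i (ord i) ≤ D.supp pos i g

namespace NamedGraph

variable {n m : ℕ} {D : NamedGraph n m}

theorem supp_congr {pos pos' : ℕ → ℕ} {i : ℕ}
    (h : ∀ g, 1 ≤ g → g ≤ m → (i ≤ pos g ↔ i ≤ pos' g)) (f : ℕ) :
    D.supp pos i f = D.supp pos' i f := by
  rw [supp, supp, tri_congr h]

end NamedGraph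

namespace EBBkCH

open Prog NamedGraph

variable {n m : ℕ} {D : NamedGraph n m} {μ : Loc → ℕ}

open Classical in
-- The buckets already describe the places from `i + 1` on, while `S` still holds the supports at
-- stage `i`. The loop subtracts one from every edge that loses its triangle with `f`. The body
-- costs two reads, a jump and two calls of `lower`, that is `23`; the scan adds `5` per neighbour.
theorem lower_triangles_spec {i s : ℕ} {S : ℕ → ℕ} {f : ℕ} (hg : GraphMem D m μ)
    (h : Buckets m (i + 1) (s - 1) S μ) (hi : i < m) (hf : μ (.ord i) = f)
    (hS : ∀ g, 1 ≤ g → g ≤ m → i ≤ μ (.pos g) → S g = D.supp (fun g => μ (.pos g)) i g ∧ s ≤ S g) :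
    Spec (foldTriangles f () fun _ f₁ f₂ _ => do
      let p₁ ← rd (.pos f₁)
      let p₂ ← rd (.pos f₂)
      branch (i < p₁ ∧ i < p₂) (do lower f₁; lower f₂) skip) μ (orderCells m)
      (28 * D.minDeg f + 7) fun _ ν o => o = [] ∧
        Buckets m (i + 1) (s - 1)
          (fun g => S g - if D.Touched (fun g => μ (.pos g)) i f
            (D.tri (fun g => μ (.pos g)) 0 f) g then 1 else 0) ν ∧
        (∀ g, 1 ≤ g → g ≤ m → ∀ j ≤ i + 1, (j ≤ ν (.pos g) ↔ j ≤ μ (.pos g))) ∧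
        ∀ p < i + 1, ν (.ord p) = μ (.ord p) := by
  have hf1 : 1 ≤ f := hf ▸ h.order.one_le i hi
  have hf2 : f ≤ m := hf ▸ h.order.le i hi
  have hfi : μ (.pos f) = i := hf ▸ h.order.pos_ord i hi
  have hff := D.name_ends f hf1 hf2
  set pos : ℕ → ℕ := fun g => μ (.pos g) with hpos
  refine foldTriangles_spec hg hf1 hf2 graphCells_notMem_orderCells pos
    (fun P _ ν o => o = [] ∧
      Buckets m (i + 1) (s - 1) (fun g => S g - if D.Touched pos i f P g then 1 else 0) ν ∧
      (∀ g, 1 ≤ g → g ≤ m → ∀ j ≤ i + 1, (j ≤ ν (.pos g) ↔ j ≤ μ (.pos g))) ∧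
      ∀ p < i + 1, ν (.ord p) = μ (.ord p)) (d := 23) (by norm_num) (by linarith)
    ⟨rfl, ?_, fun _ _ _ _ _ => Iff.rfl, fun _ _ => rfl⟩ ?_ fun _ _ _ h _ => h
  · have : (fun g => S g - if D.Touched pos i f ∅ g then 1 else 0) = S := by
      funext g
      simp [Touched]
    rwa [this]
  rintro P w _ ν _ hP hw hwP ⟨rfl, hB, hνp, hνo⟩ - f₁ f₂ hff'
  have hw0 := mem_tri_zero.1 hw
  have hw1 : D.name (D.fst f) w ≠ 0 := hw0.1
  have hw2 : D.name (D.snd f) w ≠ 0 := D.name_comm _ _ ▸ hw0.2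
  have hne := D.fst_ne_snd hf1 hf2
  have hne1 := D.name_ne hw1
  have hne2 := D.name_ne hw2
  have hwt : w ∈ D.tri pos (i + 1) f ↔
      i + 1 ≤ pos (D.name (D.fst f) w) ∧ i + 1 ≤ pos (D.name (D.snd f) w) := by
    rw [mem_tri, and_iff_right hw0, D.name_comm w]
  have htins : ∀ g, D.Touched pos i f (insert w P) g ↔ D.Touched pos i f P g ∨
      (w ∈ D.tri pos (i + 1) f ∧ (g = D.name (D.fst f) w ∨ g = D.name (D.snd f) w)) := by
    intro g
    simp only [Touched, Finset.mem_insert]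
    constructor
    · rintro ⟨x, rfl | hx, h1, h2⟩
      exacts [Or.inr ⟨h1, h2⟩, Or.inl ⟨x, hx, h1, h2⟩]
    · rintro (⟨x, hx, h1, h2⟩ | ⟨h1, h2⟩)
      exacts [⟨x, Or.inr hx, h1, h2⟩, ⟨w, Or.inl rfl, h1, h2⟩]
  have hff2 : (f₁ = D.name (D.fst f) w ∧ f₂ = D.name (D.snd f) w) ∨
      (f₁ = D.name (D.snd f) w ∧ f₂ = D.name (D.fst f) w) := by
    rwa [D.name_comm w] at hff'
  -- Different third vertices give different edges, so neither edge has been lowered before and each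
  -- still has its value under `S`.
  have hfacts : ∀ g, (g = D.name (D.fst f) w ∨ g = D.name (D.snd f) w) →
      1 ≤ g ∧ g ≤ m ∧ ¬D.Touched pos i f P g ∧ (w ∈ D.tri pos (i + 1) f → i ≤ pos g ∧ 1 ≤ S g) := by
    intro g hgw
    have h1 : 1 ≤ g := by rcases hgw with rfl | rfl <;> omega
    have h2 : g ≤ m := by rcases hgw with rfl | rfl <;> exact D.name_le _ _
    refine ⟨h1, h2, ?_, fun hwt' => ?_⟩
    · rintro ⟨x, hxP, hx, hgx⟩
      have hxw : x ≠ w := fun e => hwP (e ▸ hxP)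
      have hx0 := (mem_tri.1 hx).1
      have hx1 := D.name_ne hx0.1
      have hx2 := D.name_ne hx0.2
      rcases hgw with h | h <;> rcases hgx with h' | h' <;>
        rcases D.name_inj (by omega) (h.symm.trans h') with h | h <;> omega
    · have hwt2 := hwt.1 hwt'
      have hgi : i ≤ pos g := by rcases hgw with rfl | rfl <;> omega
      refine ⟨hgi, ?_⟩
      -- The triangle itself makes the support of `g` positive: its third vertex seen from `g` is
      -- the end of `f` not on `g`.
      rw [(hS g h1 h2 hgi).1, supp, Nat.one_le_iff_ne_zero, Finset.card_ne_zero]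
      rcases hgw with rfl | rfl
      · refine ⟨D.snd f, ?_⟩
        rw [mem_tri_name hw1, hff, D.name_comm w]
        exact ⟨⟨by omega, hw2⟩, hfi.ge, by omega⟩
      · refine ⟨D.fst f, ?_⟩
        rw [mem_tri_name hw2, D.name_comm (D.snd f), hff, D.name_comm w]
        exact ⟨⟨by omega, hw1⟩, hfi.ge, by omega⟩
  have h1 : f₁ = D.name (D.fst f) w ∨ f₁ = D.name (D.snd f) w := by omega
  have h2 : f₂ = D.name (D.fst f) w ∨ f₂ = D.name (D.snd f) w := by omega
  have h12 : f₁ ≠ f₂ := by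
    intro e
    have : D.name (D.fst f) w = D.name (D.snd f) w := by omega
    rcases D.name_inj hw2 this with h | h <;> omega
  obtain ⟨a1, a2, a3, a4⟩ := hfacts f₁ h1
  obtain ⟨b1, b2, b3, b4⟩ := hfacts f₂ h2
  have hwt3 : w ∈ D.tri pos (i + 1) f ↔ i + 1 ≤ ν (.pos f₁) ∧ i + 1 ≤ ν (.pos f₂) := by
    rw [hwt, hνp f₁ a1 a2 _ le_rfl, hνp f₂ b1 b2 _ le_rfl]
    rcases hff2 with ⟨rfl, rfl⟩ | ⟨rfl, rfl⟩
    · rfl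
    · rw [and_comm]
  refine Spec.rd_bind (Spec.rd_bind (Spec.branch (fun hb => ?_) (fun hb => ?_)))
  · have hwt' := hwt3.2 hb
    obtain ⟨a5, a6⟩ := a4 hwt'
    obtain ⟨b5, b6⟩ := b4 hwt'
    have hsm : ∀ g, 1 ≤ g → g ≤ m → i ≤ pos g → s ≤ S g ∧ S g ≤ m := fun g x y z =>
      ⟨(hS g x y z).2, (hS g x y z).1.trans_le (supp_le _ _ _)⟩
    have a7 := hsm f₁ a1 a2 a5
    have b7 := hsm f₂ b1 b2 b5
    have hSf : ∀ g, ¬D.Touched pos i f P g → (S g - if D.Touched pos i f P g then 1 else 0) = S g :=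
      fun g hg => by rw [if_neg hg]; rfl
    refine Spec.bind 10 (lower_spec hB a1 a2 hb.1 ?_ ?_ ?_) subset_rfl ?_
    · rwa [hSf _ a3]
    · rw [hSf _ a3]; omega
    · rw [hSf _ a3]; omega
    rintro _ ν₁ _ ⟨rfl, hB₁, hp₁, ho₁⟩ -
    refine (lower_spec hB₁ b1 b2 ((hp₁ f₂ b1 b2 _ le_rfl).2 hb.2) ?_ ?_ ?_).mono subset_rfl
      (by norm_num) ?_
    · rwa [Function.update_of_ne h12.symm, hSf _ b3]
    · rw [Function.update_of_ne h12.symm, hSf _ b3]; omega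
    · rw [Function.update_of_ne h12.symm, hSf _ b3]; omega
    rintro _ ν₂ _ ⟨rfl, hB₂, hp₂, ho₂⟩ -
    refine ⟨rfl, ?_, fun g x y j hj => ?_, fun p hp => ?_⟩
    · convert hB₂ using 1
      funext g
      rw [Function.update_of_ne h12.symm, hSf _ a3, hSf _ b3]
      simp only [htins, hwt', true_and, Function.update_apply]
      by_cases e2 : g = f₂
      · rw [if_pos e2, e2, if_pos (Or.inr h2)]
      · by_cases e1 : g = f₁
        · rw [if_neg e2, if_pos e1, e1, if_pos (Or.inr h1)]
        · have : ¬(g = D.name (D.fst f) w ∨ g = D.name (D.snd f) w) := by omega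
          simp only [e1, e2, this, or_false, if_false]
    · rw [hp₂ g x y j hj, hp₁ g x y j hj, hνp g x y j hj]
    · rw [ho₂ p hp, ho₁ p hp, hνo p hp]
  · refine Spec.skip (by norm_num) ⟨rfl, ?_, hνp, hνo⟩
    have hwt' : w ∉ D.tri pos (i + 1) f := fun h => hb (hwt3.1 h)
    simpa only [htins, hwt', false_and, or_false] using hB

theorem sum_ord {ord pos : ℕ → ℕ} (h : IsOrder m ord pos) (F : ℕ → ℝ) :
    ∑ p ∈ Finset.range m, F (ord p) = ∑ f ∈ Finset.range m, F (f + 1) := by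
  refine Finset.sum_bij' (fun p _ => ord p - 1) (fun f _ => pos (f + 1)) ?_ ?_ ?_ ?_ ?_
  · intro p hp
    have hp := Finset.mem_range.1 hp
    have := h.one_le p hp
    have := h.le p hp
    exact Finset.mem_range.2 (by omega)
  · intro f hf
    exact Finset.mem_range.2 (h.pos_lt _ (by omega) (Finset.mem_range.1 hf))
  · intro p hp
    have hp := Finset.mem_range.1 hp
    rw [Nat.sub_add_cancel (h.one_le p hp), h.pos_ord p hp]
  · intro f hf
    have hf := Finset.mem_range.1 hf
    rw [h.ord_pos (f + 1) (by omega) hf]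
    rfl
  · intro p hp
    rw [Nat.sub_add_cancel (h.one_le p (Finset.mem_range.1 hp))]

open Classical in
-- Before round `i`, the places from `i` on are sorted by current support, so place `i` holds a
-- minimum. Later rounds permute only later places and thus preserve the minimality already
-- recorded.
theorem peel_spec {S : ℕ → ℕ} (hg : GraphMem D m μ) (h : Buckets m 0 0 S μ)
    (hS : ∀ f, 1 ≤ f → f ≤ m → S f = D.supp id 0 f) :
    Spec (peel m) μ (orderCells m)
      (28 * ∑ j ∈ Finset.range m, (D.minDeg (j + 1) : ℝ) + 12 * m + 1) fun _ ν o => o = [] ∧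
        IsTruss D (fun p => ν (.ord p)) (fun f => ν (.pos f)) := by
  -- The cost of a round depends on the edge found at place `i`, which is known only at run time.
  -- The total is evaluated at the end, by reindexing along the final ordering.
  refine Spec.foldN_time (fun i _ ν o t => o = [] ∧
    (∃ s S, Buckets m i s S ν ∧ (i < m → s ≤ S (ν (.ord i)) + 1) ∧
      ∀ g, 1 ≤ g → g ≤ m → i ≤ ν (.pos g) → S g = D.supp (fun g => ν (.pos g)) i g) ∧
    (∀ j < i, ∀ g, 1 ≤ g → g ≤ m → j ≤ ν (.pos g) →
      D.supp (fun g => ν (.pos g)) j (ν (.ord j)) ≤ D.supp (fun g => ν (.pos g)) j g) ∧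
    t = ∑ j ∈ Finset.range i, (28 * (D.minDeg (ν (.ord j)) : ℝ) + 12)) ?_ ?_ ?_
  · exact ⟨rfl, ⟨0, S, h, fun _ => Nat.zero_le _, fun g h1 h2 _ => (hS g h1 h2).trans
      (supp_zero _ _ _)⟩, fun j hj => by omega, by simp⟩
  · rintro i hi _ ν _ _ ⟨rfl, ⟨s₀, S, hB, hs₀, hSν⟩, hmin, rfl⟩ hfr
    have hO := hB.order
    have hf1 : 1 ≤ ν (.ord i) := hO.one_le i hi
    have hf2 : ν (.ord i) ≤ m := hO.le i hi
    have hfi : ν (.pos (ν (.ord i))) = i := hO.pos_ord i hi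
    have hle : ∀ g, 1 ≤ g → g ≤ m → i ≤ ν (.pos g) → S (ν (.ord i)) ≤ S g := by
      intro g h1 h2 h3
      have h4 := hB.sorted i _ le_rfl h3 (hO.pos_lt g h1 h2)
      have h5 : ν (.ord (ν (.pos g))) = g := hO.ord_pos g h1 h2
      rwa [h5] at h4
    have hsm : S (ν (.ord i)) ≤ m :=
      (hSν _ hf1 hf2 hfi.ge).trans_le (supp_le _ _ _)
    specialize hs₀ hi
    refine ⟨28 * D.minDeg (ν (.ord i)) + 11, Spec.rd_bind (Spec.rd_bind ?_)⟩
    rw [hB.sup _ hf1 hf2 hfi.ge]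
    generalize hfe : ν (.ord i) = f at *
    generalize hse : S f = s at *
    have hsm' : s - 1 ≤ m := by omega
    -- All remaining edges have support at least `s`, so the blocks of `s` and `s - 1` now start at
    -- `i + 1`. Block `s - 1` is needed because supports drop by at most one in this round. Cells of
    -- `bin` below `s - 1` may be stale but are no longer needed. For `s = 0` the two writes
    -- coincide by truncated subtraction.
    refine Spec.wr_bind hsm (Spec.wr_bind hsm' ?_)
    set ν₁ := Function.update (Function.update ν (.bin s) (i + 1)) (.bin (s - 1)) (i + 1) with hν₁
    have e1 : ∀ p, ν₁ (.ord p) = ν (.ord p) := fun p => by simp [hν₁]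
    have e2 : ∀ p, ν₁ (.pos p) = ν (.pos p) := fun p => by simp [hν₁]
    have e3 : ∀ p, ν₁ (.sup p) = ν (.sup p) := fun p => by simp [hν₁]
    have e4 : ∀ t, ν₁ (.bin t) = if t = s - 1 then i + 1 else if t = s then i + 1 else ν (.bin t) :=
      fun p => by simp [hν₁, Function.update_apply]
    have hsort := hB.sorted
    have hB₁ : Buckets m (i + 1) (s - 1) S ν₁ := by
      refine ⟨by simpa only [e1, e2] using hO, fun g h1 h2 h3 => ?_, fun p q h1 h2 h3 => ?_,
        fun t ht htm => ?_⟩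
      · rw [e2] at h3
        rw [e3, hB.sup g h1 h2 (by omega)]
      · rw [e1, e1]
        exact hsort p q (by omega) h2 h3
      · have hge : ∀ p, i + 1 ≤ p → p < m → s ≤ S (ν (.ord p)) := fun p h1 h2 => by
          have := hsort i p le_rfl (by omega) h2
          rwa [hfe, hse] at this
        rw [e4]
        by_cases hts : t ≤ s
        · have : (if t = s - 1 then i + 1 else if t = s then i + 1 else ν (.bin t)) = i + 1 := by
            split_ifs <;> omega
          rw [this]
          refine ⟨le_rfl, hi, fun p h1 h2 => ?_⟩
          have := hge p h1 h2
          rw [e1]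
          omega
        · rw [if_neg (by omega), if_neg (by omega)]
          obtain ⟨c1, c2, c3⟩ := hB.bin t (by omega) htm
          have c4 := c3 i le_rfl hi
          rw [hfe, hse] at c4
          refine ⟨by omega, c2, fun p h1 h2 => ?_⟩
          rw [e1, c3 p (by omega) h2]
    have hg₁ : GraphMem D m ν₁ := (hg.congr fun x hx =>
      hfr x (graphCells_notMem_orderCells x hx)).congr fun x hx => by
        rw [hν₁, Function.update_of_ne, Function.update_of_ne]
        · rintro rfl
          exact hx
        · rintro rfl
          exact hx
    refine (lower_triangles_spec hg₁ hB₁ hi ((e1 i).trans hfe) ?_).mono subset_rfl (by linarith) ?_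
    · intro g h1 h2 h3
      simp only [e2] at h3 ⊢
      exact ⟨hSν g h1 h2 h3, hle g h1 h2 h3⟩
    rintro _ ν₂ _ ⟨rfl, hB₂, hp₂, ho₂⟩ -
    simp only [e1, e2] at hB₂ hp₂ ho₂
    have hsc : ∀ j ≤ i + 1, ∀ g, D.supp (fun g => ν₂ (.pos g)) j g =
        D.supp (fun g => ν (.pos g)) j g := fun j hj g =>
      supp_congr (fun g h1 h2 => hp₂ g h1 h2 j hj) g
    refine ⟨rfl, ⟨s - 1, _, hB₂, fun hi' => ?_, fun g h1 h2 h3 => ?_⟩, fun j hj g h1 h2 h3 => ?_,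
      ?_⟩
    · have h1 : 1 ≤ ν₂ (.ord (i + 1)) := hB₂.order.one_le _ hi'
      have h2 : ν₂ (.ord (i + 1)) ≤ m := hB₂.order.le _ hi'
      have h3 : ν₂ (.pos (ν₂ (.ord (i + 1)))) = i + 1 := hB₂.order.pos_ord _ hi'
      have h4 := (hp₂ _ h1 h2 i (by omega)).1 (by omega)
      have := hle _ h1 h2 h4
      split_ifs <;> omega
    · have h4 := (hp₂ g h1 h2 _ le_rfl).1 h3
      rw [hsc _ le_rfl, supp_succ (f := f) (by omega) hf2 h1 h2 ?_ h4, ← hSν g h1 h2 (by omega)]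
      intro x hx1 hx2
      constructor
      · intro e
        exact hO.pos_inj hx1 hx2 hf1 hf2 (e.trans hfi.symm)
      · rintro rfl
        exact hfi
    · rw [hp₂ g h1 h2 j (by omega)] at h3
      rw [hsc j (by omega), hsc j (by omega), ho₂ j hj]
      rcases Nat.lt_succ_iff_lt_or_eq.1 hj with hj' | rfl
      · exact hmin j hj' g h1 h2 h3
      · rw [hfe, ← hSν _ hf1 hf2 hfi.ge, ← hSν g h1 h2 h3, hse]
        exact hle g h1 h2 h3
    · rw [Finset.sum_range_succ, ho₂ i (by omega), hfe]
      rw [Finset.sum_congr rfl fun j hj =>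
        show 28 * (D.minDeg (ν₂ (.ord j)) : ℝ) + 12 = 28 * (D.minDeg (ν (.ord j)) : ℝ) + 12 by
          rw [ho₂ j (by have := Finset.mem_range.1 hj; omega)]]
      ring
  · rintro _ ν _ _ ⟨rfl, ⟨s₀, S, hB, -, -⟩, hmin, rfl⟩ -
    refine ⟨?_, rfl, hB.order, hmin⟩
    rw [sum_ord hB.order fun f => 28 * (D.minDeg f : ℝ) + 12, Finset.sum_add_distrib,
      ← Finset.mul_sum]
    simp only [Finset.sum_const, Finset.card_range, nsmul_eq_mul]
    linarith

theorem trussOrder_spec (hg : GraphMem D m μ) (h0 : ∀ s, μ (.cnt s) = 0) :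
    Spec (trussOrder m) μ (orderCells m)
      (33 * ∑ j ∈ Finset.range m, (D.minDeg (j + 1) : ℝ) + 35 * m + 10) fun _ ν o => o = [] ∧
        IsTruss D (fun p => ν (.ord p)) (fun f => ν (.pos f)) := by
  refine Spec.bind _ (supports_spec hg) ?_ ?_
  · rintro _ ⟨f, h1, h2, rfl⟩
    exact ⟨h1, h2⟩
  rintro _ μ₁ _ ⟨rfl, hs⟩ hfr₁
  refine Spec.bind _ (sortEdges_spec (S := D.supp id 0)
    (fun f h1 h2 => ⟨supp_le _ _ _, hs f h1 h2⟩) fun s => ?_) (fun x hx => hx.1) ?_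
  · rw [hfr₁ _ (by simp), h0]
  rintro _ μ₂ _ ⟨rfl, hB⟩ hfr₂
  refine (peel_spec (D := D) ?_ hB fun f _ _ => rfl).mono subset_rfl (by linarith)
    fun _ _ _ h _ => h
  refine (hg.congr fun x hx => hfr₁ x ?_).congr fun x hx => hfr₂ x fun h =>
    graphCells_notMem_orderCells x hx h.1
  rintro ⟨f, -, -, rfl⟩
  exact hx

end EBBkCH

/-! ### Cliques as sublists, edge branching, and colour pruning. -/

/-- For each entry of a list, put it in front of the lists that `rec` returns for its later
neighbours. -/
def extendLists (A : ℕ → ℕ → Bool) (rec : List ℕ → List (List ℕ)) : List ℕ → List (List ℕ)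
  | [] => []
  | u :: r => (rec (r.filter (A u))).map (u :: ·) ++ extendLists A rec r

/-- The cliques of size `l` among the entries of a list, as sublists of it. -/
def cliqueLists (A : ℕ → ℕ → Bool) : ℕ → List ℕ → List (List ℕ)
  | 0, _ => [[]]
  | l + 1, vs => extendLists A (cliqueLists A l) vs

theorem mem_cliqueLists {A : ℕ → ℕ → Bool} {l : ℕ} {vs c : List ℕ} :
    c ∈ cliqueLists A l vs ↔ c.Sublist vs ∧ c.length = l ∧ c.Pairwise fun u v => A u v = true := by
  induction l generalizing vs c with
  | zero =>
    rw [cliqueLists, List.mem_singleton, List.length_eq_zero_iff]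
    constructor
    · rintro rfl
      exact ⟨List.nil_sublist _, rfl, List.Pairwise.nil⟩
    · exact fun h => h.2.1
  | succ l ih =>
    rw [cliqueLists]
    induction vs with
    | nil =>
      rw [extendLists]
      refine iff_of_false (by simp) ?_
      rintro ⟨h1, h2, -⟩
      rw [List.sublist_nil.1 h1] at h2
      simp at h2
    | cons u r ih' =>
      rw [extendLists, List.mem_append, ih', List.mem_map]
      constructor
      · rintro (⟨c, hc, rfl⟩ | ⟨h1, h2, h3⟩)
        · obtain ⟨h1, h2, h3⟩ := ih.1 hc
          refine ⟨(h1.trans List.filter_sublist).cons_cons u, by simp [h2], ?_⟩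
          exact List.pairwise_cons.2 ⟨fun v hv => (List.mem_filter.1 (h1.subset hv)).2, h3⟩
        · exact ⟨h1.cons u, h2, h3⟩
      · rintro ⟨h1, h2, h3⟩
        rcases List.sublist_cons_iff.1 h1 with h4 | ⟨c, rfl, h4⟩
        · exact Or.inr ⟨h4, h2, h3⟩
        · left
          rw [List.pairwise_cons] at h3
          refine ⟨c, ih.2 ⟨?_, by simpa using h2, h3.2⟩, rfl⟩
          rw [← List.filter_eq_self.2 h3.1]
          exact h4.filter _

theorem nodup_cliqueLists {A : ℕ → ℕ → Bool} {l : ℕ} {vs : List ℕ} (h : vs.Nodup) :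
    (cliqueLists A l vs).Nodup := by
  induction l generalizing vs with
  | zero => exact List.nodup_singleton _
  | succ l ih =>
    rw [cliqueLists]
    induction vs with
    | nil => exact List.nodup_nil
    | cons u r ih' =>
      rw [List.nodup_cons] at h
      rw [extendLists, List.nodup_append']
      refine ⟨(ih (h.2.filter _)).map (List.cons_injective), ih' h.2, fun c h1 h2 => ?_⟩
      obtain ⟨c, -, rfl⟩ := List.mem_map.1 h1
      have : extendLists A (cliqueLists A l) r = cliqueLists A (l + 1) r := rfl
      rw [this, mem_cliqueLists] at h2
      exact h.1 (h2.1.subset List.mem_cons_self)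

/-- The values of `f` at `a, …, a + k - 1`. -/
def seg (f : ℕ → ℕ) (a k : ℕ) : List ℕ := (List.range' a k).map f

theorem seg_succ (f : ℕ → ℕ) (a k : ℕ) : seg f a (k + 1) = f a :: seg f (a + 1) k := by
  simp [seg, List.range'_succ]

theorem seg_concat (f : ℕ → ℕ) (a k : ℕ) : seg f a (k + 1) = seg f a k ++ [f (a + k)] := by
  simp [seg, List.range'_1_concat]

theorem seg_zero (f : ℕ → ℕ) (a : ℕ) : seg f a 0 = [] := rfl

theorem length_seg (f : ℕ → ℕ) (a k : ℕ) : (seg f a k).length = k := by simp [seg]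

theorem seg_congr {f g : ℕ → ℕ} {a k : ℕ} (h : ∀ j, a ≤ j → j < a + k → f j = g j) :
    seg f a k = seg g a k :=
  List.map_congr_left fun j hj => by
    rw [List.mem_range'_1] at hj
    exact h j hj.1 hj.2

theorem mem_seg {f : ℕ → ℕ} {a k v : ℕ} : v ∈ seg f a k ↔ ∃ j, a ≤ j ∧ j < a + k ∧ f j = v := by
  simp [seg, and_assoc]

theorem seg_sublist {f : ℕ → ℕ} {a k b j : ℕ} (h : b ≤ a) (e : a + k = b + j) :
    (seg f a k).Sublist (seg f b j) := by
  obtain ⟨d, rfl⟩ := Nat.exists_eq_add_of_le h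
  obtain rfl : j = d + k := by omega
  refine List.Sublist.map f ?_
  rw [← List.range'_append_1]
  exact List.sublist_append_right _ _

/-- This turns the recursion over a filtered list into the index loop of the program, which scans
all places and tests `P` at each one without ever storing the filtered list. -/
theorem extendLists_filter_seg {A : ℕ → ℕ → Bool} {rec : List ℕ → List (List ℕ)} {f : ℕ → ℕ}
    {P : ℕ → Bool} (a k : ℕ) :
    extendLists A rec ((seg f a k).filter P) = (List.range k).flatMap fun y =>
      if P (f (a + y)) then
        (rec ((seg f (a + y + 1) (k - (y + 1))).filter fun w => P w && A (f (a + y)) w)).map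
          (f (a + y) :: ·)
      else [] := by
  induction k generalizing a with
  | zero => rfl
  | succ k ih =>
    rw [seg_succ, List.filter_cons, List.range_succ_eq_map, List.flatMap_cons, List.flatMap_map,
      Nat.add_sub_cancel, Nat.add_zero]
    have h : ∀ y, a + 1 + y = a + (y + 1) := fun y => by omega
    have ih := ih (a + 1)
    simp only [h] at ih
    simp only [Nat.succ_eq_add_one, Nat.add_sub_add_right, Nat.add_zero]
    split_ifs with hP
    · rw [extendLists, ih, List.filter_filter]
      congr! 5
      exact Bool.and_comm _ _
    · rw [ih, List.nil_append]

theorem extendLists_seg {A : ℕ → ℕ → Bool} {rec : List ℕ → List (List ℕ)} {f : ℕ → ℕ} (a k : ℕ) :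
    extendLists A rec (seg f a k) = (List.range k).flatMap fun y =>
        (rec ((seg f (a + y + 1) (k - (y + 1))).filter (A (f (a + y))))).map (f (a + y) :: ·) := by
  have := extendLists_filter_seg (A := A) (rec := rec) (f := f) (P := fun _ => true) a k
  simpa using this

/-- One edge branching is two vertex branchings: the arcs in lexicographic order enumerate the
possible first two entries, and the common out-neighbours are what both filters leave. -/
theorem cliqueLists_add_two {A : ℕ → ℕ → Bool} {f : ℕ → ℕ} (l p : ℕ) :
    cliqueLists A (l + 2) (seg f 0 p) = (List.range p).flatMap fun x =>
      (List.range (p - (x + 1))).flatMap fun y =>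
        if A (f x) (f (x + 1 + y)) then
          (cliqueLists A l ((seg f (x + 1 + y + 1) (p - (x + 1 + y + 1))).filter fun w =>
            A (f x) w && A (f (x + 1 + y)) w)).map fun c => f x :: f (x + 1 + y) :: c
        else [] := by
  rw [cliqueLists, extendLists_seg]
  congr 1
  funext x
  rw [Nat.zero_add, cliqueLists, extendLists_filter_seg, List.map_flatMap]
  congr 1
  funext y
  rw [Nat.sub_sub, ← add_assoc]
  split_ifs
  · rw [List.map_map]
    rfl
  · rfl

theorem cliqueLists_one {A : ℕ → ℕ → Bool} (vs : List ℕ) :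
    cliqueLists A 1 vs = vs.map fun v => [v] := by
  rw [cliqueLists]
  induction vs with
  | nil => rfl
  | cons u r ih => rw [extendLists, ih]; rfl

theorem cliqueLists_eq_nil {A : ℕ → ℕ → Bool} {l : ℕ} {vs : List ℕ} (h : vs.length < l) :
    cliqueLists A l vs = [] := by
  refine List.eq_nil_iff_forall_not_mem.2 fun c hc => ?_
  rw [mem_cliqueLists] at hc
  have := hc.1.length_le
  omega

/-- The words printed for the lists `L` of vertices that complete the partial clique `P`. -/
def printed (P : List ℕ) (L : List (List ℕ)) : List ℕ := L.flatMap fun c => P ++ c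

theorem printed_flatMap {ι : Type*} (P : List ℕ) (l : List ι) (F : ι → List (List ℕ)) :
    printed P (l.flatMap F) = l.flatMap fun x => printed P (F x) := List.flatMap_assoc

theorem printed_map_cons (P : List ℕ) (u v : ℕ) (L : List (List ℕ)) :
    printed P (L.map fun c => u :: v :: c) = printed (P ++ [u, v]) L := by
  simp [printed, List.flatMap_map]

/-- A colouring of the entries of the list `vs` is proper for `A`, positive and non-increasing. -/
structure GoodColours (A : ℕ → ℕ → Bool) (cl : ℕ → ℕ) (vs : List ℕ) : Prop where
  sorted : vs.Pairwise fun u v => cl v ≤ cl u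
  proper : ∀ u ∈ vs, ∀ v ∈ vs, A u v = true → cl u ≠ cl v
  pos : ∀ u ∈ vs, 1 ≤ cl u

namespace GoodColours

variable {A : ℕ → ℕ → Bool} {cl : ℕ → ℕ} {vs : List ℕ}

theorem sublist (h : GoodColours A cl vs) {ws : List ℕ} (hs : ws.Sublist vs) :
    GoodColours A cl ws :=
  ⟨h.sorted.sublist hs, fun u hu v hv => h.proper u (hs.subset hu) v (hs.subset hv),
    fun u hu => h.pos u (hs.subset hu)⟩

theorem strict (h : GoodColours A cl vs) (hc : vs.Pairwise fun u v => A u v = true) :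
    vs.Pairwise fun u v => cl v < cl u :=
  (h.sorted.and hc).imp_of_mem fun hu hv h' =>
    lt_of_le_of_ne h'.1 (h.proper _ hu _ hv h'.2).symm

/-- Along a clique in list order the colours strictly decrease and stay positive. This justifies
pruning rule (1). -/
theorem length_le {u : ℕ} (h : GoodColours A cl (u :: vs))
    (hc : (u :: vs).Pairwise fun u v => A u v = true) : vs.length + 1 ≤ cl u := by
  induction vs generalizing u with
  | nil => exact h.pos u List.mem_cons_self
  | cons v r ih =>
    have h1 := ih (h.sublist (List.sublist_cons_self _ _)) (List.pairwise_cons.1 hc).2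
    have h2 := (List.pairwise_cons.1 (h.strict hc)).1 v List.mem_cons_self
    rw [List.length_cons]
    omega

/-- The vertices of a clique have distinct colours. This justifies pruning rule (2). -/
theorem cliqueLists_eq_nil (h : GoodColours A cl vs) {l : ℕ}
    (hl : (vs.toFinset.image cl).card < l) : cliqueLists A l vs = [] := by
  refine List.eq_nil_iff_forall_not_mem.2 fun c hc => ?_
  rw [mem_cliqueLists] at hc
  have h1 : (c.map cl).Nodup := List.pairwise_map.2
    (((h.sublist hc.1).strict hc.2.2).imp fun h => h.ne')
  have h2 : (c.map cl).toFinset ⊆ vs.toFinset.image cl := fun x hx => by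
    obtain ⟨v, hv, rfl⟩ := List.mem_map.1 (List.mem_toFinset.1 hx)
    exact Finset.mem_image_of_mem _ (List.mem_toFinset.2 (hc.1.subset hv))
  have h3 := Finset.card_le_card h2
  rw [List.toFinset_card_of_nodup h1, List.length_map] at h3
  omega

end GoodColours

/-! ### The recursive procedure: output, memory and time. -/

/-- Whether `u` and `v` are joined by an edge behind place `i`. -/
def NamedGraph.later {n m : ℕ} (D : NamedGraph n m) (pos : ℕ → ℕ) (i u v : ℕ) : Bool :=
  decide (D.name u v ≠ 0 ∧ i < pos (D.name u v))

/-- The memory holds the edge names, the places of the edges and the colours `cl`. -/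
structure ListMem {n m : ℕ} (D : NamedGraph n m) (pos cl : ℕ → ℕ) (μ : Loc → ℕ) : Prop where
  eid : ∀ u v, μ (.eid u v) = D.name u v
  pos : ∀ f, μ (.pos f) = pos f
  col : ∀ v, μ (.col v) = cl v

/-- The cells that are written at the branches `(S, g, l)` with `|S| ≥ s`. -/
def listCells (B M s : ℕ) : Set Loc
  | .lev s' j => s < s' ∧ s' + j < B
  | .part j => s ≤ j ∧ j < B
  | .frame s' r => s' < B ∧ r < 3
  | .mark c => c ≤ M
  | _ => False

namespace ListMem

variable {n m : ℕ} {D : NamedGraph n m} {pos cl : ℕ → ℕ} {μ ν : Loc → ℕ}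

theorem congr (h : ListMem D pos cl μ) {W : Set Loc} (e : ∀ x, x ∉ W → ν x = μ x)
    (h1 : ∀ u v, Loc.eid u v ∉ W) (h2 : ∀ f, Loc.pos f ∉ W) (h3 : ∀ v, Loc.col v ∉ W) :
    ListMem D pos cl ν :=
  ⟨fun u v => (e _ (h1 u v)).trans (h.eid u v), fun f => (e _ (h2 f)).trans (h.pos f),
    fun v => (e _ (h3 v)).trans (h.col v)⟩

theorem congr_listCells {B M s : ℕ} (h : ListMem D pos cl μ)
    (e : ∀ x, x ∉ listCells B M s → ν x = μ x) : ListMem D pos cl ν :=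
  h.congr e (fun _ _ h => h) (fun _ h => h) fun _ h => h

end ListMem

namespace EBBkCH

open Prog NamedGraph

variable {n m : ℕ} {D : NamedGraph n m} {pos cl : ℕ → ℕ} {μ : Loc → ℕ} {W : Set Loc} {c : ℝ}

theorem later_bind {α : Type} {i u v : ℕ} {f : Bool → Prog α}
    {Q : α → (Loc → ℕ) → List ℕ → Prop} (he : ∀ u v, μ (.eid u v) = D.name u v)
    (hp : ∀ f, μ (.pos f) = pos f)
    (hf : Spec (f (D.later pos i u v)) μ W (c - 4) Q) : Spec (later i u v >>= f) μ W c Q := by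
  refine Spec.bind (W' := ∅) (R := fun b ν o => b = D.later pos i u v ∧ μ = ν ∧ o = []) 4 ?_
    (Set.empty_subset _) ?_
  · refine Spec.rd_bind ?_
    rw [he]
    refine Spec.branch (fun h => Spec.pure (by norm_num) ⟨?_, rfl, rfl⟩)
      (fun h => Spec.rd_bind ?_)
    · simp [NamedGraph.later, h]
    rw [hp]
    refine Spec.branch (fun h' => Spec.pure (by norm_num) ⟨?_, rfl, rfl⟩)
      (fun h' => Spec.pure (by norm_num) ⟨?_, rfl, rfl⟩)
    · simp [NamedGraph.later, h, h']
    · simp [NamedGraph.later, h']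
  · rintro _ _ _ ⟨rfl, rfl, rfl⟩ -
    exact hf

theorem printS_bind {α : Type} {s : ℕ} {f : Unit → Prog α} {P : List ℕ}
    {Q : α → (Loc → ℕ) → List ℕ → Prop} (hP : seg (fun j => μ (.part j)) 0 s = P)
    (hf : Spec (f ()) μ W (c - (3 * s + 1)) fun b ν o => Q b ν (P ++ o)) :
    Spec (printS s >>= f) μ W c Q := by
  subst hP
  refine Spec.bind (W' := ∅)
    (R := fun _ ν o => μ = ν ∧ o = seg (fun j => μ (.part j)) 0 s) (3 * s + 1) ?_
    (Set.empty_subset _) ?_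
  · refine Spec.foldN_const (fun t _ ν o => μ = ν ∧ o = seg (fun j => μ (.part j)) 0 t) 2
      (by linarith) ⟨rfl, rfl⟩ ?_ fun _ _ _ h _ => h
    rintro t - _ _ _ ⟨rfl, rfl⟩ -
    refine Spec.rd_bind (Spec.prt (by norm_num) ⟨rfl, ?_⟩)
    rw [seg_concat, Nat.zero_add]
  · rintro _ _ _ ⟨rfl, rfl⟩ -
    exact hf

theorem commonOut_spec {i s p y u v B : ℕ} (hm : ListMem D pos cl μ) (hB : s + p < B + y) :
    Spec (commonOut i s p y u v) μ {x | ∃ j, s + 2 + j < B ∧ x = .lev (s + 2) j}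
      (12 * (p - (y + 1) : ℕ) + 1) fun q ν o => o = [] ∧
        seg (fun j => ν (.lev (s + 2) j)) 0 q =
          (seg (fun j => μ (.lev s j)) (y + 1) (p - (y + 1))).filter fun w =>
            D.later pos i u w && D.later pos i v w := by
  refine Spec.foldN_const (fun z q ν o => q ≤ z ∧ o = [] ∧
    seg (fun j => ν (.lev (s + 2) j)) 0 q =
      (seg (fun j => μ (.lev s j)) (y + 1) z).filter fun w =>
        D.later pos i u w && D.later pos i v w) 11 (by linarith) ⟨le_rfl, rfl, rfl⟩ ?_
      fun _ _ _ h _ => h.2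
  rintro z hz q ν _ ⟨hq, rfl, hν⟩ hfr
  have hm' : ListMem D pos cl ν := hm.congr hfr (by simp) (by simp) (by simp)
  refine Spec.rd_bind ?_
  rw [hfr _ (by simp)]
  refine later_bind hm'.eid hm'.pos (later_bind hm'.eid hm'.pos ?_)
  refine Spec.branch (fun h => Spec.wr_bind ⟨q, by omega, rfl⟩ (Spec.pure (by norm_num)
    ⟨by omega, rfl, ?_⟩)) (fun h => Spec.pure (by norm_num) ⟨by omega, rfl, ?_⟩)
  · rw [seg_concat, seg_concat, List.filter_append, ← hν, Nat.zero_add, Function.update_self]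
    congr 1
    · exact seg_congr fun j _ hj => Function.update_of_ne (by simp; omega) _ _
    · simp [h.1, h.2]
  · rw [seg_concat, List.filter_append, hν]
    simp only [List.filter_cons, List.filter_nil, Bool.and_eq_true, h, if_false, List.append_nil]

theorem countColours_spec {s q M : ℕ} {vs : List ℕ} (hm : ∀ v, μ (.col v) = cl v)
    (hmark : ∀ c, μ (.mark c) = 0) (hvs : seg (fun j => μ (.lev s j)) 0 q = vs)
    (hM : ∀ v ∈ vs, cl v ≤ M) :
    Spec (countColours s q) μ {x | ∃ c ≤ M, x = .mark c} (10 * q + 2) fun r ν o =>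
      o = [] ∧ r = (vs.toFinset.image cl).card ∧ ∀ c, ν (.mark c) = 0 := by
  subst hvs
  set f : ℕ → ℕ := fun j => μ (.lev s j) with hf
  have hle : ∀ j < q, cl (f j) ≤ M := fun j hj => hM _ (mem_seg.2 ⟨j, by omega, by omega, rfl⟩)
  let T : ℕ → Finset ℕ := fun t => (seg f 0 t).toFinset.image cl
  have hT : ∀ t, T (t + 1) = insert (cl (f t)) (T t) := by
    intro t
    simp only [T, seg_concat, List.toFinset_append, Finset.image_union, Nat.zero_add]
    rw [Finset.union_comm]
    simp
  refine Spec.bind (R := fun r ν o => o = [] ∧ r = (T q).card ∧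
    ∀ c, ν (.mark c) = if c ∈ T q then 1 else 0) (6 * q + 1) ?_ subset_rfl ?_
  · refine Spec.foldN_const (fun t r ν o => o = [] ∧ r = (T t).card ∧
      ∀ c, ν (.mark c) = if c ∈ T t then 1 else 0) 5 (by linarith)
      ⟨rfl, rfl, fun c => by simp [T, seg_zero, hmark]⟩ ?_ fun _ _ _ h _ => h
    rintro t ht _ ν _ ⟨rfl, rfl, hν⟩ hfr
    refine Spec.rd_bind (Spec.rd_bind (Spec.rd_bind ?_))
    rw [hfr (.lev s t) (by simp), hfr (.col _) (by simp), hm, hν]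
    refine Spec.branch (fun h => Spec.wr_bind ⟨_, hle t ht, rfl⟩ (Spec.pure (by norm_num)
      ⟨rfl, ?_, fun c => ?_⟩)) (fun h => Spec.pure (by norm_num) ⟨rfl, ?_, fun c => ?_⟩)
    · have : cl (f t) ∉ T t := by simpa using h
      rw [hT, Finset.card_insert_of_notMem this]
    · rw [hT, Function.update_apply, hν]
      by_cases e : c = cl (f t)
      · rw [if_pos (congrArg _ e), if_pos (Finset.mem_insert.2 (Or.inl e))]
      · rw [if_neg fun h => e (Loc.mark.inj h)]
        simp [e]
    · have : cl (f t) ∈ T t := by simpa using h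
      rw [hT, Finset.insert_eq_of_mem this]
    · have : cl (f t) ∈ T t := by simpa using h
      rw [hT, Finset.insert_eq_of_mem this, hν]
  rintro _ ν _ ⟨rfl, rfl, hν⟩ hfr
  refine Spec.bind (R := fun _ ν' o => o = [] ∧ ∀ c, ν' (.mark c) = 0) (4 * q + 1) ?_ subset_rfl ?_
  -- After `t` steps a mark can be non-zero only on a colour in `T q` that is not in `T t`; at `t =
  -- q` none is left, and the table is clean for its next use.
  · refine Spec.foldN_const (fun t _ ν' o => o = [] ∧
      ∀ c, c ∉ T q ∨ c ∈ T t → ν' (.mark c) = 0) 3 (by linarith)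
      ⟨rfl, fun c hc => by rw [hν, if_neg]; simpa [T, seg_zero] using hc⟩ ?_
      fun _ ν' _ h _ => ⟨h.1, fun c => h.2 c (em _).symm⟩
    rintro t ht _ ν' _ ⟨rfl, hν'⟩ hfr'
    refine Spec.rd_bind (Spec.rd_bind ?_)
    rw [hfr' (.lev s t) (by simp), hfr (.lev s t) (by simp), hfr' (.col _) (by simp),
      hfr (.col _) (by simp), hm]
    refine Spec.wr ⟨_, hle t ht, rfl⟩ (by norm_num) ⟨rfl, fun c hc => ?_⟩
    rw [Function.update_apply]
    split_ifs with e
    · rfl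
    · refine hν' c (hc.imp_right fun h => ?_)
      rw [hT, Finset.mem_insert] at h
      exact h.resolve_left fun h => e (congrArg _ h)
  rintro _ ν' _ ⟨rfl, hν'⟩ -
  exact Spec.pure (by linarith) ⟨rfl, rfl, hν'⟩

theorem sum_sub_le (k : ℕ) : ∑ y ∈ Finset.range k, ((k - (y + 1) : ℕ) : ℝ) ≤ (k : ℝ) ^ 2 / 2 := by
  have h := Finset.sum_range_reflect (fun j => (j : ℝ)) k
  simp only [Nat.sub_sub, Nat.add_comm 1] at h
  rw [h]
  clear h
  induction k with
  | zero => simp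
  | succ k ih =>
    rw [Finset.sum_range_succ]
    push_cast
    nlinarith

/-- For each pair of places the summand counts the places behind both, so the sum counts triples: it
equals `p.choose 3`. -/
theorem sum_sum_sub_le (p : ℕ) : ∑ x ∈ Finset.range p, ∑ y ∈ Finset.range (p - (x + 1)),
    ((p - (x + 1 + y + 1) : ℕ) : ℝ) ≤ (p : ℝ) ^ 3 / 6 := by
  have h1 : ∀ x ∈ Finset.range p, ∑ y ∈ Finset.range (p - (x + 1)),
      ((p - (x + 1 + y + 1) : ℕ) : ℝ) ≤ ((p - (x + 1) : ℕ) : ℝ) ^ 2 / 2 := fun x _ => by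
    refine le_trans (le_of_eq ?_) (sum_sub_le _)
    refine Finset.sum_congr rfl fun y _ => ?_
    rw [Nat.sub_sub, Nat.add_assoc]
  refine (Finset.sum_le_sum h1).trans ?_
  have h := Finset.sum_range_reflect (fun j => (j : ℝ) ^ 2 / 2) p
  simp only [Nat.sub_sub, Nat.add_comm 1] at h
  rw [h]
  clear h h1
  induction p with
  | zero => simp
  | succ p ih =>
    rw [Finset.sum_range_succ]
    have : (0 : ℝ) ≤ p := Nat.cast_nonneg p
    push_cast
    nlinarith

/-- A bound for the time of the recursive procedure. -/
noncomputable def listTime (K : ℝ) (l p : ℕ) : ℝ := 3 + 1440 * K * ((p : ℝ) / 2) ^ l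

theorem listTime_mono {K : ℝ} (hK : 0 ≤ K) {l p q : ℕ} (h : q ≤ p) :
    listTime K l q ≤ listTime K l p := by
  unfold listTime
  have : (q : ℝ) ≤ p := Nat.cast_le.2 h
  gcongr

theorem three_le_listTime {K : ℝ} (hK : 0 ≤ K) (l p : ℕ) : 3 ≤ listTime K l p := by
  unfold listTime
  have : 0 ≤ 1440 * K * ((p : ℝ) / 2) ^ l := by positivity
  linarith

/-- With `a = (p/2)^l`, the recursive calls sum to at most `720 K a · p³/6 = 120 K a p³`, while
`listTime K (l + 3) p` offers `180 K a p³`. Since `p ≥ 2` gives `a ≥ 1`, the remaining `60 K a p³`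
covers the local work, which is cubic in `p`. -/
theorem sum_listTime_le {K : ℝ} (hK : 1 ≤ K) {l p : ℕ} (hp : 2 ≤ p) :
    ∑ x ∈ Finset.range p, (∑ y ∈ Finset.range (p - (x + 1)),
      (20 + 22 * (p : ℝ) + listTime K (l + 1) (p - (x + 1 + y + 1)) + 1) + 3) + 2 ≤
        listTime K (l + 3) p := by
  have hp' : (2 : ℝ) ≤ p := by exact_mod_cast hp
  set a : ℝ := ((p : ℝ) / 2) ^ l with ha
  have ha1 : 1 ≤ a := one_le_pow₀ (by linarith)
  have h1 : ∀ x ∈ Finset.range p, ∑ y ∈ Finset.range (p - (x + 1)),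
      (20 + 22 * (p : ℝ) + listTime K (l + 1) (p - (x + 1 + y + 1)) + 1) + 3 ≤
        p * (24 + 22 * p) + 720 * K * a * ∑ y ∈ Finset.range (p - (x + 1)),
          ((p - (x + 1 + y + 1) : ℕ) : ℝ) + 3 := by
    intro x _
    have h2 : ∀ y ∈ Finset.range (p - (x + 1)),
        20 + 22 * (p : ℝ) + listTime K (l + 1) (p - (x + 1 + y + 1)) + 1 ≤
          (24 + 22 * p) + 720 * K * a * ((p - (x + 1 + y + 1) : ℕ) : ℝ) := by
      intro y _
      -- One factor keeps the true number of candidates. Bounding all factors by `p/2` would leave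
      -- the number of pairs, about `p²/2`, which exceeds the allowed `p²/4`.
      have h3 : (((p - (x + 1 + y + 1) : ℕ) : ℝ) / 2) ^ (l + 1) ≤
          a * (((p - (x + 1 + y + 1) : ℕ) : ℝ) / 2) := by
        have h4 : ((p - (x + 1 + y + 1) : ℕ) : ℝ) ≤ p := Nat.cast_le.2 (Nat.sub_le _ _)
        rw [pow_succ, ha]
        gcongr
      have h5 := mul_le_mul_of_nonneg_left h3 (by positivity : 0 ≤ 1440 * K)
      unfold listTime
      linarith
    have h3 := (Finset.sum_le_sum h2).trans_eq (by
      rw [Finset.sum_add_distrib, ← Finset.mul_sum, Finset.sum_const, Finset.card_range,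
        nsmul_eq_mul])
    have h4 : ((p - (x + 1) : ℕ) : ℝ) * (24 + 22 * p) ≤ p * (24 + 22 * p) := by
      gcongr
      exact Nat.sub_le _ _
    linarith
  have h2 := (Finset.sum_le_sum h1).trans_eq (by
    rw [Finset.sum_add_distrib, Finset.sum_add_distrib, ← Finset.mul_sum, Finset.sum_const,
      Finset.sum_const, Finset.card_range, nsmul_eq_mul, nsmul_eq_mul])
  have h3 := mul_le_mul_of_nonneg_left (sum_sum_sub_le p) (by positivity : 0 ≤ 720 * K * a)
  have h4 : listTime K (l + 3) p = 3 + 180 * (K * a) * (p : ℝ) ^ 3 := by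
    rw [listTime, pow_add, ← ha]
    ring
  have h5 : 1 ≤ K * a := one_le_mul_of_one_le_of_one_le hK ha1
  have h6 : (p : ℝ) ^ 2 * 2 ≤ (p : ℝ) ^ 3 := by nlinarith [sq_nonneg (p : ℝ)]
  have h7 : (p : ℝ) ^ 3 ≤ K * a * (p : ℝ) ^ 3 := le_mul_of_one_le_left (by positivity) h5
  have h8 : (p : ℝ) * 2 ≤ (p : ℝ) ^ 2 := by nlinarith
  rw [Finset.mul_sum] at h3
  linarith

end EBBkCH

namespace EBBkCH

open Prog NamedGraph

variable {n m : ℕ} {D : NamedGraph n m} {pos cl : ℕ → ℕ}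

/-- The recursive procedure lists the cliques of `g` that complete `S`. -/
def ListSpec (D : NamedGraph n m) (pos cl : ℕ → ℕ) (i B M : ℕ) (K : ℝ) (l : ℕ) : Prop :=
  ∀ (s p : ℕ) (μ : Loc → ℕ) (P vs : List ℕ), ListMem D pos cl μ → (∀ c, μ (.mark c) = 0) →
    s + p ≤ B → seg (fun j => μ (.lev s j)) 0 p = vs → seg (fun j => μ (.part j)) 0 s = P →
    (3 ≤ l → GoodColours (D.later pos i) cl vs ∧ ∀ v ∈ vs, cl v ≤ M) → (s + l : ℕ) ≤ K →
    Spec (listRec i l s p) μ (listCells B M s) (listTime K l p) fun _ ν o =>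
      o = printed P (cliqueLists (D.later pos i) l vs) ∧ ∀ c, ν (.mark c) = 0

theorem listRec_one {i B M : ℕ} {K : ℝ} (hK : 1 ≤ K) : ListSpec D pos cl i B M K 1 := by
  rintro s p μ P vs hm hmark hB rfl hP - hsK
  rw [listRec]
  have h0 : (0 : ℝ) ≤ K := by linarith
  refine Spec.branch (fun h => Spec.skip (by linarith [three_le_listTime h0 1 p])
    ⟨?_, hmark⟩) (fun h => ?_)
  · rw [cliqueLists_eq_nil (by rwa [length_seg])]
    rfl
  refine Spec.foldN_const (fun t _ ν o => μ = ν ∧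
    o = printed P ((seg (fun j => μ (.lev s j)) 0 t).map fun v => [v])) (3 * s + 3) ?_ ⟨rfl, rfl⟩ ?_ ?_
  · have : (s : ℝ) + 1 ≤ K := by exact_mod_cast hsK
    have h2 : (p : ℝ) * (3 * s + 3 + 1) ≤ p * (7 * K) := by gcongr; linarith
    have h3 : (0 : ℝ) ≤ p * K := by positivity
    unfold listTime
    linarith
  · rintro t - _ _ _ ⟨rfl, rfl⟩ -
    refine Spec.rd_bind (printS_bind hP (Spec.prt (by linarith) ⟨rfl, ?_⟩))
    rw [seg_concat]
    simp [printed, List.flatMap_append]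
  · rintro _ _ _ ⟨rfl, rfl⟩ -
    exact ⟨by rw [cliqueLists_one], hmark⟩

theorem listRec_two {i B M : ℕ} {K : ℝ} (hK : 1 ≤ K) : ListSpec D pos cl i B M K 2 := by
  rintro s p μ P vs hm hmark hB rfl hP - hsK
  rw [listRec]
  have h0 : (0 : ℝ) ≤ K := by linarith
  refine Spec.branch (fun h => Spec.skip (by linarith [three_le_listTime h0 2 p])
    ⟨?_, hmark⟩) (fun h => ?_)
  · rw [cliqueLists_eq_nil (by rwa [length_seg])]
    rfl
  set f : ℕ → ℕ := fun j => μ (.lev s j) with hf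
  let F : ℕ → ℕ → List ℕ := fun x y =>
    if D.later pos i (f x) (f (x + 1 + y)) then P ++ [f x, f (x + 1 + y)] else []
  refine Spec.foldN_const (fun t _ ν o => μ = ν ∧ o = (List.range t).flatMap fun x =>
      (List.range (p - (x + 1))).flatMap (F x)) (p * (3 * s + 10) + 2) ?_ ⟨rfl, rfl⟩ ?_ ?_
  · have h1 : (s : ℝ) + 2 ≤ K := by exact_mod_cast hsK
    have hp : (2 : ℝ) ≤ p := by exact_mod_cast not_lt.1 h
    have h2 : (p : ℝ) * (p * (3 * s + 10)) ≤ p * (p * (13 * K)) := by gcongr; linarith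
    have h3 : (p : ℝ) * p * 1 ≤ p * p * K := by gcongr
    have h4 : (p : ℝ) * 2 ≤ p * p := by gcongr
    unfold listTime
    linarith
  · rintro x hx _ _ _ ⟨rfl, rfl⟩ -
    refine Spec.rd_bind ?_
    refine Spec.foldN_const (fun t _ ν o => μ = ν ∧ o = (List.range t).flatMap (F x)) (3 * s + 9)
      ?_ ⟨rfl, rfl⟩ ?_ ?_
    · have : ((p - (x + 1) : ℕ) : ℝ) * (3 * s + 9 + 1) ≤ p * (3 * s + 9 + 1) := by
        gcongr
        exact Nat.sub_le _ _
      linarith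
    · rintro y - _ _ _ ⟨rfl, rfl⟩ -
      refine Spec.rd_bind (later_bind hm.eid hm.pos (Spec.branch (fun h => printS_bind hP
        (Spec.prt_bind (Spec.prt (by linarith) ⟨rfl, ?_⟩)))
        (fun h => Spec.skip (by linarith [(Nat.cast_nonneg s : (0 : ℝ) ≤ s)]) ⟨rfl, ?_⟩)))
      · rw [List.range_succ, List.flatMap_append]
        simp only [F, hf, h, if_true, List.flatMap_singleton]
      · rw [List.range_succ, List.flatMap_append]
        simp only [F, hf, h, List.flatMap_singleton]
        rfl
    · rintro _ _ _ ⟨rfl, rfl⟩ -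
      refine ⟨rfl, ?_⟩
      rw [List.range_succ, List.flatMap_append, List.flatMap_singleton]
  · rintro _ _ _ ⟨rfl, rfl⟩ -
    refine ⟨?_, hmark⟩
    rw [cliqueLists_add_two, printed_flatMap]
    congr 1
    funext x
    rw [printed_flatMap]
    congr 1
    funext y
    simp only [F]
    split_ifs
    · simp [cliqueLists, printed]
    · rfl

theorem listRec_add_three {i B M l : ℕ} {K : ℝ} (hK : 1 ≤ K)
    (ih : ListSpec D pos cl i B M K (l + 1)) : ListSpec D pos cl i B M K (l + 3) := by
  rintro s p μ P vs hm hmark hB rfl hP hcl hsK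
  obtain ⟨hgood, hM⟩ := hcl (by omega)
  rw [listRec]
  have h0 : (0 : ℝ) ≤ K := by linarith
  refine Spec.branch (fun h => Spec.skip (by linarith [three_le_listTime h0 (l + 3) p])
    ⟨?_, hmark⟩) (fun h => ?_)
  · rw [cliqueLists_eq_nil (by rwa [length_seg])]
    rfl
  set f : ℕ → ℕ := fun j => μ (.lev s j) with hf
  set A := D.later pos i with hA
  let G : ℕ → ℕ → List (List ℕ) := fun x y =>
    cliqueLists A (l + 1) ((seg f (x + 1 + y + 1) (p - (x + 1 + y + 1))).filter fun w =>
      A (f x) w && A (f (x + 1 + y)) w)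
  let F : ℕ → ℕ → List ℕ := fun x y =>
    if A (f x) (f (x + 1 + y)) then printed (P ++ [f x, f (x + 1 + y)]) (G x y) else []
  -- The `22 p` is `12 p` for the common out-neighbours plus `10 p` for counting their colours; `20`
  -- covers the remaining reads, jumps and writes of one arc.
  refine Spec.foldN (fun t _ ν o => (o = (List.range t).flatMap fun x =>
      (List.range (p - (x + 1))).flatMap (F x)) ∧ ∀ c, ν (.mark c) = 0)
    (fun x => (∑ y ∈ Finset.range (p - (x + 1)),
      (20 + 22 * (p : ℝ) + listTime K (l + 1) (p - (x + 1 + y + 1)) + 1)) + 2) ?_ ⟨rfl, hmark⟩ ?_ ?_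
  · have := sum_listTime_le hK (l := l) (p := p) (by omega)
    simp only [add_assoc] at this ⊢
    norm_num at this ⊢
    linarith
  swap
  · rintro _ ν _ ⟨rfl, hν⟩ -
    refine ⟨?_, hν⟩
    rw [cliqueLists_add_two, printed_flatMap]
    congr 1
    funext x
    rw [printed_flatMap]
    congr 1
    funext y
    simp only [F]
    split_ifs
    · rw [printed_map_cons]
    · rfl
  rintro x hx _ ν _ ⟨rfl, hν⟩ hfr
  refine Spec.rd_bind ?_
  rw [hfr (.lev s x) (fun h => absurd h.1 (lt_irrefl s)), show μ (.lev s x) = f x from rfl]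
  refine Spec.foldN (fun t _ ν o => o = (List.range t).flatMap (F x) ∧ ∀ c, ν (.mark c) = 0)
    (fun y => 20 + 22 * (p : ℝ) + listTime K (l + 1) (p - (x + 1 + y + 1))) (by linarith)
    ⟨rfl, hν⟩ ?_ ?_
  swap
  · rintro _ ν' _ ⟨rfl, hν'⟩ -
    refine ⟨?_, hν'⟩
    rw [List.range_succ, List.flatMap_append, List.flatMap_singleton]
  clear hν
  rintro y hy _ ν' _ ⟨rfl, hν⟩ hfr'
  replace hfr : ∀ z, z ∉ listCells B M s → ν' z = μ z := fun z hz => (hfr' z hz).trans (hfr z hz)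
  clear hfr' ν
  rename' ν' => ν
  have hm' : ListMem D pos cl ν := hm.congr_listCells hfr
  have hlev : ∀ j, ν (.lev s j) = f j := fun j =>
    hfr (.lev s j) fun h => absurd h.1 (lt_irrefl s)
  refine Spec.rd_bind ?_
  rw [hlev, List.range_succ, List.flatMap_append, List.flatMap_singleton]
  have hT := three_le_listTime h0 (l + 1) (p - (x + 1 + y + 1))
  have hp0 : (0 : ℝ) ≤ p := Nat.cast_nonneg p
  have hsub : ∀ Z, ((seg f (x + 1 + y + 1) (p - (x + 1 + y + 1))).filter Z).Sublist
    (seg f 0 p) := fun Z => List.filter_sublist.trans (seg_sublist (Nat.zero_le _) (by omega))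
  have hsub2 : (f x :: f (x + 1 + y) :: seg f (x + 1 + y + 1) (p - (x + 1 + y + 1))).Sublist
      (seg f 0 p) := by
    refine List.Sublist.trans ?_ (seg_sublist (Nat.zero_le x)
      (by omega : x + (p - (x + 1) + 1) = 0 + p))
    rw [← seg_succ, seg_succ f x]
    exact (seg_sublist (by omega) (by omega)).cons_cons _
  refine later_bind hm'.eid hm'.pos (Spec.branch (fun hb => ?_) (fun hb => Spec.skip ?_ ⟨?_, hν⟩))
  rotate_left
  · linarith
  · simp only [F]
    rw [if_neg hb]
  have hF : F x y = printed (P ++ [f x, f (x + 1 + y)]) (G x y) := if_pos hb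
  refine Spec.rd_bind (Spec.rd_bind ?_)
  rw [hm'.col, hm'.col]
  refine Spec.branch (fun hcol => Spec.skip (by linarith) ⟨?_, hν⟩) (fun hcol => ?_)
  -- A completion `c` would make `f x` the head of a clique of size `l + 3` and `f (x + 1 + y)` the
  -- head of one of size `l + 2`; rule (1) says that one of the two colours is too small for this.
  · have : G x y = [] := by
      refine List.eq_nil_iff_forall_not_mem.2 fun c hc => ?_
      obtain ⟨hc1, hc2, hc3⟩ := mem_cliqueLists.1 hc
      have hA2 : ∀ w ∈ c, A (f x) w = true ∧ A (f (x + 1 + y)) w = true := fun w hw => by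
        simpa using (List.mem_filter.1 (hc1.subset hw)).2
      have hc4 : (f (x + 1 + y) :: c).Pairwise fun u v => A u v = true :=
        List.pairwise_cons.2 ⟨fun w hw => (hA2 w hw).2, hc3⟩
      have hc5 : (f x :: f (x + 1 + y) :: c).Pairwise fun u v => A u v = true := by
        refine List.pairwise_cons.2 ⟨fun w hw => ?_, hc4⟩
        rcases List.mem_cons.1 hw with rfl | hw
        exacts [hb, (hA2 w hw).1]
      have hg1 : GoodColours A cl (f x :: f (x + 1 + y) :: c) :=
        hgood.sublist ((((hc1.trans List.filter_sublist).cons_cons _).cons_cons _).trans hsub2)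
      have h1 := hg1.length_le hc5
      have h2 := (hg1.sublist (List.sublist_cons_self _ _)).length_le hc4
      rw [List.length_cons] at h1
      omega
    rw [hF, this]
    rfl
  have hN : ((p - (x + 1 + y + 1) : ℕ) : ℝ) ≤ p := Nat.cast_le.2 (Nat.sub_le _ _)
  refine Spec.bind _ (commonOut_spec (B := B) hm' (by omega)) ?_ ?_
  · rintro _ ⟨j, hj, rfl⟩
    exact ⟨by omega, hj⟩
  rintro q ν₁ _ ⟨rfl, hq⟩ hfr₁
  simp only [hlev] at hq
  have hqle : q ≤ p - (x + 1 + y + 1) := by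
    have := congrArg List.length hq
    rw [length_seg] at this
    rw [this]
    exact (List.length_filter_le _ _).trans_eq (length_seg _ _ _)
  have hq' : (q : ℝ) ≤ (p - (x + 1 + y + 1) : ℕ) := Nat.cast_le.2 hqle
  refine Spec.bind _ (countColours_spec (cl := cl) (M := M) ?_ ?_ hq ?_) ?_ ?_
  · exact fun v => (hfr₁ _ (by simp)).trans (hm'.col v)
  · exact fun c => (hfr₁ _ (by simp)).trans (hν c)
  · exact fun v hv => hM v ((hsub _).subset hv)
  · rintro _ ⟨c, hc, rfl⟩
    exact hc
  rintro r ν₂ _ ⟨rfl, rfl, hν₂⟩ hfr₂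
  have hG : G x y = cliqueLists A (l + 1) _ := rfl
  refine Spec.branch (fun hlt => Spec.skip (by linarith) ⟨?_, hν₂⟩) (fun hlt => ?_)
  · rw [hF, hG, (hgood.sublist (hsub _)).cliqueLists_eq_nil hlt]
    rfl
  have hs1 : s + 1 < B := by omega
  refine Spec.wr_bind ⟨le_rfl, by omega⟩ (Spec.wr_bind ⟨by omega, by omega⟩
    (Spec.wr_bind ⟨by omega, by omega⟩ (Spec.wr_bind ⟨by omega, by omega⟩
    (Spec.wr_bind ⟨by omega, by omega⟩ ((ih (s + 2) q _ (P ++ [f x, f (x + 1 + y)])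
      ((seg f (x + 1 + y + 1) (p - (x + 1 + y + 1))).filter fun w =>
        A (f x) w && A (f (x + 1 + y)) w) ?_ ?_ ?_ ?_ ?_ ?_ ?_).mono ?_ ?_ ?_)))))
  · have h1 := hm'.congr hfr₁ (by simp) (by simp) (by simp)
    have h2 := h1.congr hfr₂ (by simp) (by simp) (by simp)
    exact ⟨fun u v => by simpa using h2.eid u v, fun g => by simpa using h2.pos g,
      fun v => by simpa using h2.col v⟩
  · intro c
    simpa using hν₂ c
  -- Here `|S|` grows by two while `u`, `v` and all places up to that of `v` are no longer
  -- candidates. So `q + 2 ≤ p`, and `s + p ≤ B` persists.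
  · omega
  · rw [← hq]
    refine seg_congr fun j _ _ => ?_
    simpa using hfr₂ (.lev (s + 2) j) (by simp)
  · rw [seg_concat, seg_concat, List.append_assoc, ← hP]
    congr 1
    · refine seg_congr fun j _ hj => ?_
      have h1 : j ≠ s := by omega
      have h2 : j ≠ s + 1 := by omega
      have h3 : ν₂ (.part j) = μ (.part j) := by
        rw [hfr₂ _ (by simp), hfr₁ _ (by simp), hfr _ fun h => by have := h.1; omega]
      simpa [h1, h2] using h3
    · simp
  · exact fun _ => ⟨hgood.sublist (hsub _), fun v hv => hM v ((hsub _).subset hv)⟩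
  · exact_mod_cast (by omega : s + 2 + (l + 1) = s + (l + 3)) ▸ hsK
  · rintro (_ | _ | _ | _ | _ | _ | _ | _ | _ | _ | _ | _ | _ | ⟨s', j⟩ | _ | _) hx <;>
      first | exact hx | exact hx.elim | skip
    · exact ⟨(by omega : s < s + 2).trans hx.1, hx.2⟩
    · exact ⟨by have := hx.1; omega, hx.2⟩
  · have := listTime_mono h0 (l := l + 1) hqle
    linarith
  · rintro _ ν₃ _ ⟨rfl, hν₃⟩ -
    exact ⟨by rw [hF, hG]; rfl, hν₃⟩

/-- Each level takes two off `l`, hence the two base cases. The value `l = 0` does not arise, as the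
root starts at `k - 2 ≥ 1`. -/
theorem listRec_spec {i B M : ℕ} {K : ℝ} (hK : 1 ≤ K) :
    ∀ l, ListSpec D pos cl i B M K (l + 1)
  | 0 => listRec_one hK
  | 1 => listRec_two hK
  | l + 2 => listRec_add_three hK (listRec_spec hK l)

end EBBkCH

/-! ### Building an instance at the root: vertices, colours, order. -/

namespace NamedGraph

variable {n m : ℕ} {D : NamedGraph n m} {pos : ℕ → ℕ}

theorem later_comm (i u v : ℕ) : D.later pos i u v = D.later pos i v u := by
  rw [later, later, D.name_comm]

theorem later_self (i u : ℕ) : D.later pos i u u = false := by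
  simp [later, D.name_self]

end NamedGraph

namespace EBBkCH

open Prog NamedGraph

variable {n m : ℕ} {D : NamedGraph n m} {pos cl : ℕ → ℕ} {μ : Loc → ℕ}

theorem instanceVertices_spec {i f N : ℕ} (h : GraphMem D m μ) (hp : ∀ f, μ (.pos f) = pos f)
    (h1 : 1 ≤ f) (h2 : f ≤ m) (hN : D.supp pos (i + 1) f ≤ N) :
    Spec (instanceVertices i f) μ {x | ∃ j < N, x = .cand j} (9 * D.minDeg f + 7) fun q ν o =>
      o = [] ∧ q ≤ N ∧ (seg (fun j => ν (.cand j)) 0 q).Nodup ∧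
        ∀ w, w ∈ seg (fun j => ν (.cand j)) 0 q ↔ w ∈ D.tri pos (i + 1) f := by
  have hW : ∀ x ∈ graphCells, x ∉ {x | ∃ j < N, x = Loc.cand j} := by
    rintro x hx ⟨j, -, rfl⟩
    exact hx
  have hle : ∀ l : List ℕ, l.Nodup → (∀ w ∈ l, w ∈ D.tri pos (i + 1) f) → l.length ≤ N := by
    intro l hl hl'
    rw [← List.toFinset_card_of_nodup hl]
    exact (Finset.card_le_card fun w hw => hl' w (List.mem_toFinset.1 hw)).trans hN
  refine foldTriangles_spec h h1 h2 hW pos (fun P q ν o => o = [] ∧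
      (seg (fun j => ν (.cand j)) 0 q).Nodup ∧
        ∀ w, w ∈ seg (fun j => ν (.cand j)) 0 q ↔ w ∈ P ∧ w ∈ D.tri pos (i + 1) f) (d := 4)
    (by norm_num) (by linarith) ⟨rfl, List.nodup_nil, fun w => by simp [seg_zero]⟩ ?_ ?_
  · rintro P w q ν _ - hw hwP ⟨rfl, hν, hmem⟩ hfr f₁ f₂ hf
    have hwt : w ∈ D.tri pos (i + 1) f ↔ i < pos f₁ ∧ i < pos f₂ := by
      rw [mem_tri, and_iff_right (mem_tri_zero.1 hw)]
      rcases hf with ⟨rfl, rfl⟩ | ⟨rfl, rfl⟩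
      · rfl
      · rw [and_comm]
        rfl
    have hpν : ∀ f, ν (.pos f) = pos f := fun f => (hfr _ (by simp)).trans (hp f)
    refine Spec.rd_bind (Spec.rd_bind ?_)
    rw [hpν, hpν]
    refine Spec.branch (fun hb => ?_) (fun hb => Spec.pure (by norm_num) ⟨rfl, hν, fun x => ?_⟩)
    · have hb' := hwt.2 hb
      have hnew : (seg (fun j => ν (.cand j)) 0 q ++ [w]).Nodup := by
        rw [List.nodup_append']
        refine ⟨hν, List.nodup_singleton _, ?_⟩
        rw [List.disjoint_singleton, hmem]
        exact fun h => hwP h.1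
      have hmem' : ∀ x, x ∈ seg (fun j => ν (.cand j)) 0 q ++ [w] ↔
          x ∈ insert w P ∧ x ∈ D.tri pos (i + 1) f := by
        intro x
        rw [List.mem_append, hmem, List.mem_singleton, Finset.mem_insert]
        constructor
        · rintro (⟨h1, h2⟩ | rfl)
          exacts [⟨Or.inr h1, h2⟩, ⟨Or.inl rfl, hb'⟩]
        · rintro ⟨rfl | h1, h2⟩
          exacts [Or.inr rfl, Or.inl ⟨h1, h2⟩]
      have hlen := hle _ hnew fun x hx => ((hmem' x).1 hx).2
      rw [List.length_append, length_seg, List.length_singleton] at hlen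
      refine Spec.wr_bind ⟨q, hlen, rfl⟩ (Spec.pure (by norm_num) ⟨rfl, ?_⟩)
      have e : seg (fun j => Function.update ν (.cand q) w (.cand j)) 0 (q + 1) =
          seg (fun j => ν (.cand j)) 0 q ++ [w] := by
        rw [seg_concat, Nat.zero_add, Function.update_self]
        congr 1
        exact seg_congr fun j _ hj => Function.update_of_ne (by simp; omega) _ _
      rw [e]
      exact ⟨hnew, hmem'⟩
    · rw [hmem, Finset.mem_insert]
      constructor
      · rintro ⟨h1, h2⟩
        exact ⟨Or.inr h1, h2⟩
      · rintro ⟨rfl | h1, h2⟩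
        exacts [absurd (hwt.1 h2) hb, ⟨h1, h2⟩]
  · rintro q ν _ ⟨rfl, hν, hmem⟩ -
    have hmem' : ∀ w, w ∈ seg (fun j => ν (.cand j)) 0 q ↔ w ∈ D.tri pos (i + 1) f := by
      intro w
      rw [hmem, and_iff_right_iff_imp]
      exact fun hw => mem_tri_zero.2 (mem_tri.1 hw).1
    have := hle _ hν fun w hw => (hmem' w).1 hw
    rw [length_seg] at this
    exact ⟨rfl, this, hν, hmem'⟩

theorem seg_injOn {f : ℕ → ℕ} {p : ℕ} (h : (seg f 0 p).Nodup) {s t : ℕ} (hs : s < p) (ht : t < p)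
    (e : f s = f t) : s = t := by
  have := List.inj_on_of_nodup_map h (x := s) (by simpa using hs) (y := t) (by simpa using ht) e
  exact this

/-- The `t`-th vertex gets a colour of at most `t + 1`, so `N` bounds all colours. Entries of `col`
left from other instances do no harm: only vertices already coloured in this instance are read. The
marks are cleared after each vertex. -/
theorem colour_spec {i p N : ℕ} {f : ℕ → ℕ} (he : ∀ u v, μ (.eid u v) = D.name u v)
    (hp : ∀ f, μ (.pos f) = pos f) (hmark : ∀ c, μ (.mark c) = 0) (hf : ∀ j, μ (.cand j) = f j)
    (hnd : (seg f 0 p).Nodup) (hn : ∀ j < p, f j < n) (hpN : p ≤ N) :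
    Spec (colour i p) μ {x | (∃ v < n, x = .col v) ∨ ∃ c ≤ N, x = .mark c} (p * (16 * p + 6) + 1)
      fun _ ν o => o = [] ∧ (∀ c, ν (.mark c) = 0) ∧
        (∀ u ∈ seg f 0 p, 1 ≤ ν (.col u) ∧ ν (.col u) ≤ N) ∧
        ∀ u ∈ seg f 0 p, ∀ v ∈ seg f 0 p, D.later pos i u v = true → ν (.col u) ≠ ν (.col v) := by
  have hinj := fun {s t : ℕ} => seg_injOn hnd (s := s) (t := t)
  refine Spec.foldN_const (fun j _ ν o => o = [] ∧ (∀ c, ν (.mark c) = 0) ∧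
    (∀ t < j, 1 ≤ ν (.col (f t)) ∧ ν (.col (f t)) ≤ t + 1) ∧
    ∀ s t, s < t → t < j → D.later pos i (f s) (f t) = true →
      ν (.col (f s)) ≠ ν (.col (f t))) (16 * p + 5) (by linarith)
    ⟨rfl, hmark, fun t ht => by omega, fun s t _ ht => by omega⟩ ?_ ?_
  swap
  · rintro _ ν _ ⟨rfl, hν, hb, hc⟩ -
    refine ⟨rfl, hν, fun u hu => ?_, fun u hu v hv huv => ?_⟩
    · obtain ⟨t, -, ht, rfl⟩ := mem_seg.1 hu
      have := hb t (by omega)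
      omega
    · obtain ⟨s, -, hs, rfl⟩ := mem_seg.1 hu
      obtain ⟨t, -, ht, rfl⟩ := mem_seg.1 hv
      rcases lt_trichotomy s t with h | rfl | h
      · exact hc s t h (by omega) huv
      · rw [later_self] at huv
        simp at huv
      · exact (hc t s h (by omega) (later_comm i _ _ ▸ huv)).symm
  rintro j hj _ ν _ ⟨rfl, hν, hb, hc⟩ hfr
  have hjp : (j : ℝ) ≤ p := Nat.cast_le.2 hj.le
  have he' : ∀ u v, ν (.eid u v) = D.name u v := fun u v => (hfr _ (by simp)).trans (he u v)
  have hp' : ∀ f, ν (.pos f) = pos f := fun u => (hfr _ (by simp)).trans (hp u)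
  have hf' : ∀ j, ν (.cand j) = f j := fun u => (hfr _ (by simp)).trans (hf u)
  have hWm : {x | ∃ c ≤ N, x = Loc.mark c} ⊆
      {x | (∃ v < n, x = Loc.col v) ∨ ∃ c ≤ N, x = .mark c} := fun _ => Or.inr
  refine Spec.rd_bind ?_
  rw [hf']
  refine Spec.bind (W' := {x | ∃ c ≤ N, x = .mark c}) (R := fun _ ν' o => o = [] ∧
    ∀ c, ν' (.mark c) ≠ 0 ↔ ∃ t < j, D.later pos i (f t) (f j) = true ∧ ν (.col (f t)) = c)
    (9 * j + 1) ?_ hWm ?_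
  · refine Spec.foldN_const (fun s _ ν' o => o = [] ∧ ∀ c, ν' (.mark c) ≠ 0 ↔
      ∃ t < s, D.later pos i (f t) (f j) = true ∧ ν (.col (f t)) = c) 8 (by linarith)
      ⟨rfl, fun c => by simp [hν]⟩ ?_ fun _ _ _ h _ => h
    rintro s hs _ ν' _ ⟨rfl, hν'⟩ hfr'
    refine Spec.rd_bind ?_
    rw [hfr' _ (by simp), hf']
    refine later_bind (fun u v => (hfr' _ (by simp)).trans (he' u v))
      (fun u => (hfr' _ (by simp)).trans (hp' u)) (Spec.branch (fun h => Spec.rd_bind ?_)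
      (fun h => Spec.skip (by norm_num) ⟨rfl, fun c => ?_⟩))
    · rw [hfr' _ (by simp)]
      have := hb s hs
      refine Spec.wr ⟨_, by omega, rfl⟩ (by norm_num) ⟨rfl, fun c => ?_⟩
      rw [Function.update_apply]
      split_ifs with e
      · exact iff_of_true one_ne_zero ⟨s, by omega, h, (Loc.mark.inj e).symm⟩
      · rw [hν']
        refine exists_congr fun t => and_congr_left fun ht => ?_
        have : t ≠ s := by
          rintro rfl
          exact e (congrArg _ ht.2.symm)
        omega
    · rw [hν']
      refine exists_congr fun t => and_congr_left fun ht => ?_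
      have : t ≠ s := by
        rintro rfl
        exact h ht.1
      omega
  rintro _ ν₁ _ ⟨rfl, hν₁⟩ hfr₁
  refine Spec.bind (W' := ∅) (R := fun c ν' o => o = [] ∧ ν₁ = ν' ∧ 1 ≤ c ∧ c ≤ j + 1 ∧
    ν₁ (.mark c) = 0) (3 * j + 1) ?_ (Set.empty_subset _) ?_
  -- After `t` tests either a free colour has been reached, and the search stays there, or `c = t +
  -- 1` because every test so far found a mark.
  · refine Spec.foldN_const (fun t c ν' o => o = [] ∧ ν₁ = ν' ∧ 1 ≤ c ∧ c ≤ t + 1 ∧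
      (ν₁ (.mark c) = 0 ∨ c = t + 1)) 2 (by linarith) ⟨rfl, rfl, le_rfl, le_rfl, Or.inr rfl⟩ ?_ ?_
    · rintro t - c _ _ ⟨rfl, rfl, hc1, hc2, hc3⟩ -
      refine Spec.rd_bind (Spec.branch (fun h => Spec.pure (by norm_num)
        ⟨rfl, rfl, hc1, by omega, Or.inl h⟩) (fun h => Spec.pure (by norm_num)
        ⟨rfl, rfl, by omega, by omega, Or.inr ?_⟩))
      rw [hc3.resolve_left h]
    · rintro c _ _ ⟨rfl, rfl, hc1, hc2, hc3⟩ -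
      refine ⟨rfl, rfl, hc1, hc2, ?_⟩
      -- After `j` tests the only doubtful case is `c = j + 1`, and this colour is free because the
      -- earlier vertices have colours at most `j`.
      by_contra h
      obtain rfl := hc3.resolve_left h
      obtain ⟨t, ht, -, e⟩ := (hν₁ _).1 h
      have := hb t ht
      omega
  rintro c _ _ ⟨rfl, rfl, hc1, hc2, hc3⟩ -
  refine Spec.wr_bind (Or.inl ⟨_, hn j hj, rfl⟩) ?_
  set ν₂ := Function.update ν₁ (.col (f j)) c with hν₂
  have hcol : ∀ t < j, ν₂ (.col (f t)) = ν (.col (f t)) := fun t ht => by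
    rw [hν₂, Function.update_of_ne, hfr₁ _ (by simp)]
    simp only [ne_eq, Loc.col.injEq]
    intro e
    have := hinj (ht.trans hj) hj e
    omega
  have hcolj : ν₂ (.col (f j)) = c := by rw [hν₂, Function.update_self]
  have hcand : ∀ t, ν₂ (.cand t) = f t := fun t => by
    rw [hν₂, Function.update_of_ne (by simp), hfr₁ _ (by simp), hf']
  have hmk : ∀ c, ν₂ (.mark c) = ν₁ (.mark c) := fun c => by
    rw [hν₂, Function.update_of_ne (by simp)]
  refine (Spec.foldN_const (W := {x | ∃ c ≤ N, x = .mark c}) (c := 4 * j + 1)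
    (Q := fun _ ν' o => o = [] ∧ ∀ c, ν' (.mark c) = 0) (fun s _ ν' o => o = [] ∧
    ∀ c, ν' (.mark c) ≠ 0 → ∃ t, s ≤ t ∧ t < j ∧ ν (.col (f t)) = c) 3 (by linarith) ⟨rfl, ?_⟩ ?_
    ?_).mono hWm (by linarith) ?_
  · intro c h
    rw [hmk, hν₁] at h
    obtain ⟨t, ht, -, e⟩ := h
    exact ⟨t, Nat.zero_le _, ht, e⟩
  · rintro s hs _ ν' _ ⟨rfl, hν'⟩ hfr'
    refine Spec.rd_bind (Spec.rd_bind ?_)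
    rw [hfr' (.cand s) (by simp), hcand, hfr' (.col _) (by simp), hcol s hs]
    have := hb s hs
    refine Spec.wr ⟨_, by omega, rfl⟩ (by norm_num) ⟨rfl, fun c h => ?_⟩
    rw [Function.update_apply] at h
    split_ifs at h with e
    · exact absurd rfl h
    · obtain ⟨t, ht1, ht2, ht3⟩ := hν' c h
      refine ⟨t, ?_, ht2, ht3⟩
      have : t ≠ s := by
        rintro rfl
        exact e (congrArg _ ht3.symm)
      omega
  · rintro _ ν' _ ⟨rfl, hν'⟩ -
    refine ⟨rfl, fun c => ?_⟩
    by_contra h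
    obtain ⟨t, h1, h2, -⟩ := hν' c h
    omega
  · rintro _ ν' _ ⟨rfl, hν'⟩ hfr'
    have hc' : ∀ v, ν' (.col v) = ν₂ (.col v) := fun v => hfr' _ (by simp)
    refine ⟨rfl, hν', fun t ht => ?_, fun s t hst ht hA => ?_⟩
    · rw [hc']
      rcases Nat.lt_succ_iff_lt_or_eq.1 ht with h | rfl
      · rw [hcol t h]
        exact hb t h
      · rw [hcolj]
        exact ⟨hc1, hc2⟩
    · rw [hc', hc', hcol s (by omega)]
      rcases Nat.lt_succ_iff_lt_or_eq.1 ht with h | rfl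
      · rw [hcol t h]
        exact hc s t hst h hA
      · rw [hcolj]
        intro e
        exact (hν₁ c).2 ⟨s, hst, hA, e⟩ hc3

/-- The inner loop computes the rank of a vertex with respect to decreasing colour and increasing
name. Ranks form a permutation of the places, so every place is filled once and the colours are
non-increasing. -/
theorem orderByColour_spec {p : ℕ} {f : ℕ → ℕ} (hcl : ∀ v, μ (.col v) = cl v)
    (hf : ∀ j, μ (.cand j) = f j) (hnd : (seg f 0 p).Nodup) :
    Spec (orderByColour p) μ {x | ∃ j < p, x = .lev 2 j} (p * (4 * p + 5) + 1) fun _ ν o =>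
      o = [] ∧ (seg (fun j => ν (.lev 2 j)) 0 p).Nodup ∧
        (∀ w, w ∈ seg (fun j => ν (.lev 2 j)) 0 p ↔ w ∈ seg f 0 p) ∧
        (seg (fun j => ν (.lev 2 j)) 0 p).Pairwise fun u v => cl v ≤ cl u := by
  let r : ℕ → ℕ → Prop := fun u v => cl v < cl u ∨ (cl u = cl v ∧ u < v)
  let hrd : DecidableRel r := fun _ _ => inferInstanceAs (Decidable (_ ∨ _))
  have hri : ∀ x, ¬r x x := fun x => by simp [r]
  have hrt : ∀ x y z, r x y → r y z → r x z := fun x y z => by simp only [r]; omega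
  set A := (seg f 0 p).toFinset with hA
  have hrc : ∀ x ∈ A, ∀ y ∈ A, x ≠ y → r x y ∨ r y x := fun x _ y _ => by
    simp only [r]; omega
  have hcard : A.card = p := by rw [hA, List.toFinset_card_of_nodup hnd, length_seg]
  have hmemA : ∀ {t}, t < p → f t ∈ A := fun ht =>
    List.mem_toFinset.2 (mem_seg.2 ⟨_, Nat.zero_le _, by omega, rfl⟩)
  refine Spec.foldN_const (fun j _ ν o => o = [] ∧
    ∀ t < j, ν (.lev 2 (rank A r (f t))) = f t) (4 * p + 4) (by linarith)
    ⟨rfl, fun t ht => by omega⟩ ?_ ?_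
  · rintro j hj _ ν _ ⟨rfl, hν⟩ hfr
    refine Spec.rd_bind (Spec.rd_bind ?_)
    rw [hfr (.cand j) (by simp), hf, hfr (.col _) (by simp), hcl]
    refine Spec.bind (W' := ∅) (R := fun q ν' o => ν = ν' ∧ o = [] ∧ q = rank A r (f j)) (4 * p + 1)
      ?_ (Set.empty_subset _) ?_
    · refine Spec.foldN_const (fun t q ν' o => ν = ν' ∧ o = [] ∧
        q = ((seg f 0 t).filter fun u => decide (r u (f j))).length) 3 (by linarith) ⟨rfl, rfl, rfl⟩
        ?_ ?_
      · rintro t ht _ _ _ ⟨rfl, rfl, rfl⟩ -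
        refine Spec.rd_bind (Spec.rd_bind ?_)
        rw [hfr (.cand t) (by simp), hf, hfr (.col _) (by simp), hcl]
        refine Spec.branch (fun h => Spec.pure (by norm_num) ⟨rfl, rfl, ?_⟩)
          (fun h => Spec.pure (by norm_num) ⟨rfl, rfl, ?_⟩) <;>
        rw [seg_concat, List.filter_append, List.length_append, Nat.zero_add]
        · have h' : r (f t) (f j) := h
          simp [h']
        · have h' : ¬r (f t) (f j) := h
          simp [h']
      · rintro _ _ _ ⟨rfl, rfl, rfl⟩ -
        refine ⟨rfl, rfl, ?_⟩
        rw [rank, hA, ← List.toFinset_card_of_nodup (hnd.filter _), List.toFinset_filter]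
        congr 1
        ext u
        simp
    · rintro _ _ _ ⟨rfl, rfl, rfl⟩ -
      refine Spec.wr ⟨_, (rank_lt_card hri (hmemA hj)).trans_eq hcard, rfl⟩ (by linarith)
        ⟨rfl, fun t ht => ?_⟩
      by_cases e : t = j
      · rw [e, Function.update_self]
      · rw [Function.update_of_ne]
        · exact hν t (by omega)
        · simp only [ne_eq, Loc.lev.injEq, true_and]
          intro e'
          exact e (seg_injOn hnd (by omega) hj
            (rank_injOn hri hrt hrc (hmemA (by omega)) (hmemA hj) e'))
  · rintro _ ν _ ⟨rfl, hν⟩ -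
    have hex : ∀ q < p, ∃ t < p, rank A r (f t) = q := fun q hq => by
      obtain ⟨x, hx, e⟩ := exists_rank_eq hri hrt hrc (hq.trans_eq hcard.symm)
      obtain ⟨t, -, ht, rfl⟩ := mem_seg.1 (List.mem_toFinset.1 hx)
      exact ⟨t, by omega, e⟩
    refine ⟨rfl, ?_, fun w => ?_, ?_⟩
    · refine List.Nodup.map_on (fun x hx y hy e => ?_) List.nodup_range'
      obtain ⟨s, hs, rfl⟩ := hex x (by simpa using hx)
      obtain ⟨t, ht, rfl⟩ := hex y (by simpa using hy)
      rw [hν s hs, hν t ht] at e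
      rw [e]
    · rw [mem_seg, mem_seg]
      constructor
      · rintro ⟨q, -, hq, rfl⟩
        obtain ⟨t, ht, rfl⟩ := hex q (by omega)
        exact ⟨t, Nat.zero_le _, by omega, (hν t ht).symm⟩
      · rintro ⟨t, -, ht, rfl⟩
        have := (rank_lt_card hri (hmemA (t := t) (by omega))).trans_eq hcard
        exact ⟨_, Nat.zero_le _, by omega, hν t (by omega)⟩
    · refine List.pairwise_map.2 (List.Pairwise.imp_of_mem (R := (· < ·)) ?_
        (List.pairwise_lt_range' ..))
      intro x y hx hy hxy
      obtain ⟨s, hs, rfl⟩ := hex x (by simpa using hx)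
      obtain ⟨t, ht, rfl⟩ := hex y (by simpa using hy)
      rw [hν s hs, hν t ht]
      by_contra h
      exact absurd (rank_lt_rank hri hrt (hmemA ht) (Or.inl (not_le.1 h))) (not_lt.2 hxy.le)

theorem copyVertices_spec {p : ℕ} {f : ℕ → ℕ} (hf : ∀ j, μ (.cand j) = f j) :
    Spec (copyVertices p) μ {x | ∃ j < p, x = .lev 2 j} (3 * p + 1) fun _ ν o =>
      o = [] ∧ seg (fun j => ν (.lev 2 j)) 0 p = seg f 0 p := by
  refine Spec.foldN_const (fun j _ ν o => o = [] ∧ ∀ t < j, ν (.lev 2 t) = f t) 2 (by linarith)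
    ⟨rfl, fun t ht => by omega⟩ ?_ fun _ ν o h _ => ⟨h.1, seg_congr fun j _ hj => h.2 j (by omega)⟩
  rintro j hj _ ν _ ⟨rfl, hν⟩ hfr
  refine Spec.rd_bind (Spec.wr ⟨j, hj, rfl⟩ (by norm_num) ⟨rfl, fun t ht => ?_⟩)
  rw [hfr _ (by simp), hf, Function.update_apply]
  split_ifs with e
  · simp only [Loc.lev.injEq, true_and] at e
    rw [e]
  · refine hν t ?_
    have : t ≠ j := by
      rintro rfl
      exact e rfl
    omega

end EBBkCH

/-! ### Each clique is found exactly once, at its first edge. -/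

/-- A sublist of a duplicate-free list is thus determined by its set of entries, so distinct clique
lists are distinct vertex sets. -/
theorem List.Sublist.eq_filter_mem {vs c : List ℕ} (h : c.Sublist vs) (hn : vs.Nodup) :
    c = vs.filter fun x => decide (x ∈ c) := by
  induction h with
  | slnil => rfl
  | @cons l₁ l₂ a h ih =>
    rw [List.nodup_cons] at hn
    have : a ∉ l₁ := fun ha => hn.1 (h.subset ha)
    rw [List.filter_cons_of_neg (by simpa using this)]
    exact ih hn.2
  | @cons_cons l₁ l₂ a h ih =>
    rw [List.nodup_cons] at hn
    rw [List.filter_cons_of_pos (by simp), List.cons_inj_right]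
    refine (ih hn.2).trans (List.filter_congr fun x hx => ?_)
    have : x ≠ a := by
      rintro rfl
      exact hn.1 hx
    simp [this]

namespace NamedGraph

variable {n m : ℕ} {D : NamedGraph n m} {pos ord : ℕ → ℕ}

/-- `s` is a clique of size `k` that contains the edge `f` and whose edges have place at least
`i`. -/
def IsCliqueFrom (D : NamedGraph n m) (pos : ℕ → ℕ) (k i f : ℕ) (s : Finset ℕ) : Prop :=
  s.card = k ∧ (∀ u ∈ s, ∀ v ∈ s, u ≠ v → D.name u v ≠ 0 ∧ i ≤ pos (D.name u v)) ∧
    D.fst f ∈ s ∧ D.snd f ∈ s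

/-- Given a clique whose first edge is `ab`, at place `i`, the remaining vertices are joined to `a`,
to `b` and to each other by edges strictly behind place `i`. So they form a clique of the instance,
and conversely. -/
theorem blocks_of_edge {i f l a b : ℕ} {ws : List ℕ} (h1 : 1 ≤ f) (h2 : f ≤ m) (hf : pos f = i)
    (hi : ∀ g, 1 ≤ g → g ≤ m → pos g = i → g = f)
    (hab : (a = D.fst f ∧ b = D.snd f) ∨ (a = D.snd f ∧ b = D.fst f)) (hws : ws.Nodup)
    (hmem : ∀ w, w ∈ ws ↔ w ∈ D.tri pos (i + 1) f) :
    (((cliqueLists (D.later pos i) l ws).map fun c => [a, b] ++ c).map List.toFinset).Nodup ∧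
      ∀ s, s ∈ ((cliqueLists (D.later pos i) l ws).map fun c => [a, b] ++ c).map List.toFinset ↔
        D.IsCliqueFrom pos (l + 2) i f s := by
  have hfab : D.name a b = f := by
    rcases hab with ⟨rfl, rfl⟩ | ⟨rfl, rfl⟩
    · exact D.name_ends f h1 h2
    · rw [D.name_comm]
      exact D.name_ends f h1 h2
  have hab0 : D.name a b ≠ 0 := by omega
  have hne := D.name_ne hab0
  have hmem' : ∀ w, w ∈ ws ↔ (D.name a w ≠ 0 ∧ D.name b w ≠ 0) ∧
      i + 1 ≤ pos (D.name a w) ∧ i + 1 ≤ pos (D.name b w) := fun w => by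
    rw [hmem, ← hfab, mem_tri_name hab0]
  have ha : a ∉ ws := fun h => ((hmem' a).1 h).1.1 (D.name_self a)
  have hb : b ∉ ws := fun h => ((hmem' b).1 h).1.2 (D.name_self b)
  have hfs : ∀ s : Finset ℕ, D.fst f ∈ s ∧ D.snd f ∈ s ↔ a ∈ s ∧ b ∈ s := fun s => by
    rcases hab with ⟨rfl, rfl⟩ | ⟨rfl, rfl⟩
    · rfl
    · rw [and_comm]
  have htf : ∀ c : List ℕ, ([a, b] ++ c).toFinset = insert a (insert b c.toFinset) := fun c => by
    simp
  rw [List.map_map]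
  refine ⟨List.Nodup.map_on (fun c hc d hd e => ?_) (nodup_cliqueLists hws), fun s => ?_⟩
  · rw [mem_cliqueLists] at hc hd
    rw [hc.1.eq_filter_mem hws, hd.1.eq_filter_mem hws]
    refine List.filter_congr fun x hx => ?_
    have hxa : x ≠ a := fun e => ha (e ▸ hx)
    have hxb : x ≠ b := fun e => hb (e ▸ hx)
    have := congrArg (fun s : Finset ℕ => x ∈ s) e
    simpa [hxa, hxb] using this
  rw [List.mem_map, IsCliqueFrom, hfs]
  constructor
  · rintro ⟨c, hc, rfl⟩
    obtain ⟨hc1, hc2, hc3⟩ := mem_cliqueLists.1 hc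
    have hca : a ∉ c := fun h => ha (hc1.subset h)
    have hcb : b ∉ c := fun h => hb (hc1.subset h)
    simp only [Function.comp_apply, htf]
    refine ⟨?_, ?_, by simp, by simp⟩
    · rw [Finset.card_insert_of_notMem (by simp [hne, hca]),
        Finset.card_insert_of_notMem (by simpa using hcb),
        List.toFinset_card_of_nodup (hws.sublist hc1), hc2]
    · have key : ∀ w ∈ c, (D.name a w ≠ 0 ∧ i ≤ pos (D.name a w)) ∧
          (D.name b w ≠ 0 ∧ i ≤ pos (D.name b w)) := fun w hw => by
        have := (hmem' w).1 (hc1.subset hw)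
        exact ⟨⟨this.1.1, by omega⟩, ⟨this.1.2, by omega⟩⟩
      have hc4 : ∀ u ∈ c, ∀ v ∈ c, u ≠ v → D.later pos i u v = true := by
        have hsymm : ∀ u v, D.later pos i u v = true → D.later pos i v u = true :=
          fun u v h => later_comm i u v ▸ h
        have hc5 : c.Pairwise fun u v => u ≠ v → D.later pos i u v = true := by
          refine hc3.imp ?_
          exact fun h _ => h
        exact fun u hu v hv huv => hc5.forall_of_forall_of_flip (fun x _ h => absurd rfl h)
          (by refine hc3.imp ?_; exact fun h _ => hsymm _ _ h) hu hv huv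
      have hself : ∀ u v, D.name u v ≠ 0 ∧ i ≤ pos (D.name u v) →
          D.name v u ≠ 0 ∧ i ≤ pos (D.name v u) := fun u v h => D.name_comm u v ▸ h
      intro u hu v hv huv
      simp only [Finset.mem_insert, List.mem_toFinset] at hu hv
      rcases hu with rfl | rfl | hu <;> rcases hv with rfl | rfl | hv
      · exact absurd rfl huv
      · exact ⟨hab0, by rw [hfab, hf]⟩
      · exact (key v hv).1
      · exact hself _ _ ⟨hab0, by rw [hfab, hf]⟩
      · exact absurd rfl huv
      · exact (key v hv).2
      · exact hself _ _ (key u hu).1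
      · exact hself _ _ (key u hu).2
      · have := hc4 u hu v hv huv
        simp only [later, decide_eq_true_eq] at this
        exact ⟨this.1, this.2.le⟩
  · rintro ⟨hs1, hs2, has, hbs⟩
    -- Only `f` stands at place `i`, so every other edge of the clique lies strictly behind it.
    have hlt : ∀ u ∈ s, ∀ v ∈ s, u ≠ v → (u ≠ a ∨ v ≠ b) → (u ≠ b ∨ v ≠ a) →
        i < pos (D.name u v) := by
      intro u hu v hv huv e1 e2
      obtain ⟨h3, h4⟩ := hs2 u hu v hv huv
      refine lt_of_le_of_ne h4 fun e => ?_
      have := hi _ (Nat.one_le_iff_ne_zero.2 h3) (D.name_le _ _) e.symm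
      rcases D.name_inj hab0 (this.trans hfab.symm) with h | h <;> omega
    have hsws : ∀ w ∈ s, w ≠ a → w ≠ b → w ∈ ws := by
      intro w hw hwa hwb
      rw [hmem']
      exact ⟨⟨(hs2 a has w hw hwa.symm).1, (hs2 b hbs w hw hwb.symm).1⟩,
        hlt a has w hw hwa.symm (Or.inr hwb) (Or.inr hwa),
        hlt b hbs w hw hwb.symm (Or.inr hwb) (Or.inr hwa)⟩
    set c := ws.filter fun x => decide (x ∈ s) with hc
    have hcs : insert a (insert b c.toFinset) = s := by
      ext x
      simp only [Finset.mem_insert, List.mem_toFinset, hc, List.mem_filter, decide_eq_true_eq]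
      constructor
      · rintro (rfl | rfl | h)
        exacts [has, hbs, h.2]
      · intro hx
        by_cases h3 : x = a
        · exact Or.inl h3
        · by_cases h4 : x = b
          · exact Or.inr (Or.inl h4)
          · exact Or.inr (Or.inr ⟨hsws x hx h3 h4, hx⟩)
    have hcws : c.Sublist ws := List.filter_sublist
    have hca : a ∉ c := fun h => ha (hcws.subset h)
    have hcb : b ∉ c := fun h => hb (hcws.subset h)
    refine ⟨c, mem_cliqueLists.2 ⟨hcws, ?_, ?_⟩, (htf c).trans hcs⟩
    · rw [← hcs, Finset.card_insert_of_notMem (by simp [hne, hca]),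
        Finset.card_insert_of_notMem (by simpa using hcb),
        List.toFinset_card_of_nodup (hws.sublist hcws)] at hs1
      omega
    · refine List.Pairwise.imp_of_mem ?_ (hws.sublist hcws)
      intro u v hu hv huv
      have hu' := List.mem_filter.1 hu
      have hv' := List.mem_filter.1 hv
      have hus : u ∈ s := by simpa using hu'.2
      have hvs : v ∈ s := by simpa using hv'.2
      have hua : u ≠ a := fun e => hca (e ▸ hu)
      have hub : u ≠ b := fun e => hcb (e ▸ hu)
      simp only [later, decide_eq_true_eq]
      exact ⟨(hs2 u hus v hvs huv).1, hlt u hus v hvs huv (Or.inl hua) (Or.inl hub)⟩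

/-- Each of the two edges lies in `s`, so neither can precede the other. -/
theorem isCliqueFrom_unique (h : IsOrder m ord pos) {k i j : ℕ} {s : Finset ℕ} (hi : i < m)
    (hj : j < m) (h1 : D.IsCliqueFrom pos k i (ord i) s) (h2 : D.IsCliqueFrom pos k j (ord j) s) :
    i = j := by
  have key : ∀ i j, i < m → j < m → D.IsCliqueFrom pos k i (ord i) s →
      D.IsCliqueFrom pos k j (ord j) s → i ≤ j := by
    intro i j hi hj h1 h2
    have := (h1.2.1 _ h2.2.2.1 _ h2.2.2.2 (D.fst_ne_snd (h.one_le j hj) (h.le j hj))).2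
    rwa [D.name_ends _ (h.one_le j hj) (h.le j hj), h.pos_ord j hj] at this
  exact le_antisymm (key i j hi hj h1 h2) (key j i hj hi h2 h1)

/-- The place is the least one occupied by an edge with both ends in `s`; such an edge exists
because `k ≥ 2`. -/
theorem exists_isCliqueFrom_iff (h : IsOrder m ord pos) {k : ℕ} (hk : 2 ≤ k) {s : Finset ℕ} :
    (∃ i < m, D.IsCliqueFrom pos k i (ord i) s) ↔
      s.card = k ∧ ∀ u ∈ s, ∀ v ∈ s, u ≠ v → D.name u v ≠ 0 := by
  constructor
  · rintro ⟨i, -, h1, h2, -⟩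
    exact ⟨h1, fun u hu v hv huv => (h2 u hu v hv huv).1⟩
  · rintro ⟨h1, h2⟩
    have hex : ∃ i, i < m ∧ D.fst (ord i) ∈ s ∧ D.snd (ord i) ∈ s := by
      obtain ⟨u, hu, v, hv, huv⟩ := Finset.one_lt_card.1 (by omega : 1 < s.card)
      have h3 := h2 u hu v hv huv
      have h4 := Nat.one_le_iff_ne_zero.2 h3
      refine ⟨pos (D.name u v), h.pos_lt _ h4 (D.name_le _ _), ?_⟩
      rw [h.ord_pos _ h4 (D.name_le _ _)]
      rcases D.ends_name u v h3 with ⟨e1, e2⟩ | ⟨e1, e2⟩ <;> rw [e1, e2]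
      exacts [⟨hu, hv⟩, ⟨hv, hu⟩]
    classical
    obtain ⟨i1, i2⟩ := Nat.find_spec hex
    refine ⟨Nat.find hex, i1, h1, fun u hu v hv huv => ⟨h2 u hu v hv huv, ?_⟩, i2⟩
    have h3 := h2 u hu v hv huv
    have h4 := Nat.one_le_iff_ne_zero.2 h3
    refine Nat.find_min' hex ⟨h.pos_lt _ h4 (D.name_le _ _), ?_⟩
    rw [h.ord_pos _ h4 (D.name_le _ _)]
    rcases D.ends_name u v h3 with ⟨e1, e2⟩ | ⟨e1, e2⟩ <;> rw [e1, e2]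
    exacts [⟨hu, hv⟩, ⟨hv, hu⟩]

end NamedGraph

/-! ### The branching step at the root. -/

namespace EBBkCH

open Prog NamedGraph

variable {n m : ℕ} {D : NamedGraph n m} {pos ord : ℕ → ℕ} {μ : Loc → ℕ}

/-- The cells that are written during the branching at the root and below. -/
def rootCells (n N : ℕ) : Set Loc
  | .cand j => j < N
  | .col v => v < n
  | .mark c => c ≤ N
  | .lev s j => 2 ≤ s ∧ s + j < N + 2
  | .part j => j < N + 2
  | .frame s r => s < N + 2 ∧ r < 3
  | _ => False

/-- A bound for the time spent at one edge at the root, besides the scan for triangles. -/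
noncomputable def edgeTime (k N : ℕ) : ℝ :=
  18 + (if k - 2 = 1 then 3 * (N : ℝ) + 1 else N * (20 * N + 11) + 2) + listTime k (k - 2) N

theorem rootStep_spec {i k N : ℕ} (hk : 3 ≤ k) (hg : GraphMem D m μ) (hO : IsOrder m ord pos)
    (hpos : ∀ f, μ (.pos f) = pos f) (hord : ∀ p, μ (.ord p) = ord p)
    (hmark : ∀ c, μ (.mark c) = 0) (hi : i < m) (hN : D.supp pos (i + 1) (ord i) ≤ N) :
    Spec (do
      let f ← rd (.ord i)
      let (a, b) ← ends f
      wr (.part 0) a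
      wr (.part 1) b
      let p ← instanceVertices i f
      branch (k - 2 = 1) (copyVertices p)
        (do
          colour i p
          orderByColour p)
      listRec i (k - 2) 2 p) μ (rootCells n N) (9 * D.minDeg (ord i) + edgeTime k N)
      fun _ ν o => (∀ c, ν (.mark c) = 0) ∧ ∃ L : List (List ℕ), o = L.flatten ∧
        (∀ c ∈ L, c.length = k) ∧ (L.map List.toFinset).Nodup ∧
        ∀ s, s ∈ L.map List.toFinset ↔ D.IsCliqueFrom pos k i (ord i) s := by
  obtain ⟨l, rfl⟩ : ∃ l, k = l + 3 := ⟨k - 3, by omega⟩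
  have hf1 := hO.one_le i hi
  have hf2 := hO.le i hi
  have hfi := hO.pos_ord i hi
  refine Spec.rd_bind ?_
  rw [hord]
  generalize ord i = f at *
  refine Spec.bind (W' := ∅) (R := fun ab ν o => μ = ν ∧ o = [] ∧
    ((ab.1 = D.fst f ∧ ab.2 = D.snd f) ∨ (ab.1 = D.snd f ∧ ab.2 = D.fst f))) 5
    (ends_spec hg hf1 hf2 le_rfl fun a b hab _ => ⟨rfl, rfl, hab⟩) (Set.empty_subset _) ?_
  rintro ⟨a, b⟩ _ _ ⟨rfl, rfl, hab⟩ -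
  dsimp only at hab ⊢
  have hN1 : (1 : ℕ) < N + 2 := by omega
  refine Spec.wr_bind (Nat.zero_lt_of_lt hN1) (Spec.wr_bind hN1 ?_)
  set μ₁ := Function.update (Function.update μ (.part 0) a) (.part 1) b with hμ₁
  have hμ₁' : ∀ x, (∀ j, x ≠ Loc.part j) → μ₁ x = μ x := fun x hx => by
    rw [hμ₁, Function.update_of_ne (hx 1), Function.update_of_ne (hx 0)]
  have hg₁ : GraphMem D m μ₁ := hg.congr fun x hx => hμ₁' x fun j e => by
    rw [e] at hx
    exact hx
  refine Spec.bind _ (instanceVertices_spec hg₁ (fun g => (hμ₁' _ (by simp)).trans (hpos g)) hf1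
    hf2 hN) ?_ ?_
  · rintro _ ⟨j, hj, rfl⟩
    exact hj
  rintro q μ₂ _ ⟨rfl, hqN, hnd, hmem⟩ hfr₂
  have hmark₂ : ∀ c, μ₂ (.mark c) = 0 := fun c => by
    rw [hfr₂ _ (by simp), hμ₁' _ (by simp), hmark]
  have hpos₂ : ∀ g, μ₂ (.pos g) = pos g := fun g => by
    rw [hfr₂ _ (by simp), hμ₁' _ (by simp), hpos]
  have heid₂ : ∀ u v, μ₂ (.eid u v) = D.name u v := fun u v => by
    rw [hfr₂ _ (by simp), hg₁.eid_all]
  have hpart₂ : ∀ j, μ₂ (.part j) = μ₁ (.part j) := fun j => hfr₂ _ (by simp)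
  set fc : ℕ → ℕ := fun j => μ₂ (.cand j) with hfc
  have hlev : {x | ∃ j < q, x = Loc.lev 2 j} ⊆ {x | x ∈ rootCells n N ∧ ∀ j, x ≠ .part j} := by
    rintro _ ⟨j, hj, rfl⟩
    exact ⟨⟨le_rfl, by omega⟩, by simp⟩
  have hqN' : (q : ℝ) ≤ N := Nat.cast_le.2 hqN
  have hl : l + 3 - 2 = l + 1 := rfl
  rw [hl]
  -- The cells `part` are excluded from the writes of this phase, so the partial clique `[a, b]` is
  -- still in place when the recursion starts.
  refine Spec.bind (W' := {x | x ∈ rootCells n N ∧ ∀ j, x ≠ .part j}) (R := fun _ ν o => o = [] ∧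
    (∀ c, ν (.mark c) = 0) ∧ (seg (fun j => ν (.lev 2 j)) 0 q).Nodup ∧
      (∀ w, w ∈ seg (fun j => ν (.lev 2 j)) 0 q ↔ w ∈ D.tri pos (i + 1) f) ∧
      (3 ≤ l + 1 → GoodColours (D.later pos i) (fun v => ν (.col v))
        (seg (fun j => ν (.lev 2 j)) 0 q) ∧
        ∀ v ∈ seg (fun j => ν (.lev 2 j)) 0 q, ν (.col v) ≤ N))
    (1 + if l + 1 = 1 then 3 * (N : ℝ) + 1 else N * (20 * N + 11) + 2) ?_ (fun _ h => h.1) ?_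
  · refine Spec.branch (fun h => ?_) (fun h => ?_)
    · rw [if_pos h]
      refine (copyVertices_spec (f := fc) fun _ => rfl).mono hlev (by linarith) ?_
      rintro _ ν _ ⟨rfl, hν⟩ hfr
      rw [hν]
      -- This is the case `k = 3`, where `l = 1` and nothing is required of the colours.
      exact ⟨rfl, fun c => (hfr _ (by simp)).trans (hmark₂ c), hnd, hmem, fun h' => by omega⟩
    · rw [if_neg h]
      have hN2 : (q : ℝ) * (16 * q + 6) ≤ N * (16 * N + 6) := by gcongr
      have hN3 : (q : ℝ) * (4 * q + 5) ≤ N * (4 * N + 5) := by gcongr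
      refine Spec.bind _ (colour_spec (n := n) (f := fc) heid₂ hpos₂ hmark₂ (fun _ => rfl) hnd ?_
        hqN) ?_ ?_
      · intro j hj
        have := (hmem (fc j)).1 (mem_seg.2 ⟨j, Nat.zero_le _, by omega, rfl⟩)
        exact Finset.mem_range.1 (Finset.mem_filter.1 this).1
      · rintro _ (⟨v, hv, rfl⟩ | ⟨c, hc, rfl⟩)
        exacts [⟨hv, by simp⟩, ⟨hc, by simp⟩]
      rintro _ μ₃ _ ⟨rfl, hmark₃, hc1, hc2⟩ hfr₃
      refine (orderByColour_spec (cl := fun v => μ₃ (.col v)) (f := fc) (fun _ => rfl)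
        (fun j => hfr₃ _ (by simp)) hnd).mono hlev (by linarith) ?_
      rintro _ ν _ ⟨rfl, h1, h2, h3⟩ hfr
      have hcol : ∀ v, ν (.col v) = μ₃ (.col v) := fun v => hfr _ (by simp)
      refine ⟨rfl, fun c => (hfr _ (by simp)).trans (hmark₃ c), h1,
        fun w => (h2 w).trans (hmem w), fun _ => ?_⟩
      simp only [hcol]
      exact ⟨⟨h3, fun u hu v hv => hc2 u ((h2 u).1 hu) v ((h2 v).1 hv),
        fun u hu => (hc1 u ((h2 u).1 hu)).1⟩, fun u hu => (hc1 u ((h2 u).1 hu)).2⟩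
  rintro _ ν _ ⟨rfl, hν, h1, h2, h3⟩ hfr
  have hpart : ∀ j, ν (.part j) = μ₁ (.part j) := fun j =>
    (hfr _ fun h => h.2 j rfl).trans (hpart₂ j)
  have hk1 : (1 : ℝ) ≤ ((l + 3 : ℕ) : ℝ) := by
    push_cast
    linarith [(Nat.cast_nonneg l : (0 : ℝ) ≤ l)]
  -- The bound `B = N + 2` counts the two ends of the edge and at most `N` candidates; `M = N`
  -- bounds the greedy colours; `K = k` is the size `s + l` of the cliques to be printed.
  refine (listRec_spec (D := D) (pos := pos) (cl := fun v => ν (.col v)) (i := i) (B := N + 2)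
    (M := N) hk1 l 2 q ν [a, b] _ ⟨fun u v => (hfr (.eid u v) fun h => h.1).trans (heid₂ u v),
      fun g => (hfr (.pos g) fun h => h.1).trans (hpos₂ g), fun _ => rfl⟩ hν (by omega) rfl ?_ h3
      (by norm_cast; omega)).mono ?_ ?_ ?_
  · rw [seg_succ, seg_succ, seg_zero, hpart, hpart, hμ₁]
    simp
  · rintro (_ | _ | _ | _ | _ | _ | _ | _ | _ | _ | _ | _ | _ | ⟨s', j⟩ | _ | _) hx <;>
      first | exact hx | exact hx.elim | skip
    · exact ⟨hx.1.le, hx.2⟩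
    · exact hx.2
  · have := listTime_mono (by linarith : (0 : ℝ) ≤ ((l + 3 : ℕ) : ℝ)) (l := l + 1) hqN
    rw [edgeTime, hl]
    linarith
  · rintro _ ν' _ ⟨rfl, hν'⟩ -
    obtain ⟨b1, b2⟩ := blocks_of_edge (D := D) (pos := pos) (l := l + 1) hf1 hf2 hfi
      (fun g g1 g2 e => hO.pos_inj g1 g2 hf1 hf2 (e.trans hfi.symm)) hab h1 h2
    refine ⟨hν', _, ?_, ?_, b1, b2⟩
    · rw [List.nil_append, List.nil_append]
      rfl
    · intro c hc
      obtain ⟨c, hc', rfl⟩ := List.mem_map.1 hc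
      have := (mem_cliqueLists.1 hc').2.1
      rw [List.length_append, this]
      simp only [List.length_cons, List.length_nil]
      omega

theorem root_spec {k N : ℕ} (hk : 3 ≤ k) (hg : GraphMem D m μ) (hO : IsOrder m ord pos)
    (hpos : ∀ f, μ (.pos f) = pos f) (hord : ∀ p, μ (.ord p) = ord p)
    (hmark : ∀ c, μ (.mark c) = 0) (hN : ∀ i < m, D.supp pos (i + 1) (ord i) ≤ N) :
    Spec (root m k) μ (rootCells n N)
      (9 * ∑ j ∈ Finset.range m, (D.minDeg (j + 1) : ℝ) + m * (edgeTime k N + 1) + 1)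
      fun _ _ o => ∃ L : List (List ℕ), o = L.flatten ∧ (∀ c ∈ L, c.length = k) ∧
        (L.map List.toFinset).Nodup ∧ ∀ s, s ∈ L.map List.toFinset ↔
          s.card = k ∧ ∀ u ∈ s, ∀ v ∈ s, u ≠ v → D.name u v ≠ 0 := by
  refine Spec.foldN (fun i _ ν o => (∀ c, ν (.mark c) = 0) ∧ ∃ L : List (List ℕ), o = L.flatten ∧
    (∀ c ∈ L, c.length = k) ∧ (L.map List.toFinset).Nodup ∧
    ∀ s, s ∈ L.map List.toFinset ↔ ∃ j < i, D.IsCliqueFrom pos k j (ord j) s)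
    (fun i => 9 * D.minDeg (ord i) + edgeTime k N) ?_
    ⟨hmark, [], rfl, by simp, List.nodup_nil, by simp⟩ ?_ ?_
  · have := sum_ord hO fun f => (D.minDeg f : ℝ)
    rw [Finset.sum_add_distrib, Finset.sum_add_distrib, ← Finset.mul_sum, this]
    simp only [Finset.sum_const, Finset.card_range, nsmul_eq_mul]
    linarith
  · rintro i hi _ ν _ ⟨hν, L, rfl, hL1, hL2, hL3⟩ hfr
    refine (rootStep_spec hk (hg.congr fun x hx => hfr x ?_) hO
      (fun f => (hfr (.pos f) fun h => h).trans (hpos f))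
      (fun f => (hfr (.ord f) fun h => h).trans (hord f))
      hν hi (hN i hi)).mono subset_rfl le_rfl ?_
    · rcases x with _ | _ | _ | _ | _ | _ | _ | _ | _ | _ | _ | _ | _ | _ | _ | _ <;>
        first | exact hx.elim | exact fun h => h
    · rintro _ ν' _ ⟨hν', L', rfl, hL1', hL2', hL3'⟩ -
      refine ⟨hν', L ++ L', List.flatten_append.symm, fun c hc => ?_, ?_, fun s => ?_⟩
      · rcases List.mem_append.1 hc with h | h
        exacts [hL1 c h, hL1' c h]
      · rw [List.map_append, List.nodup_append']
        refine ⟨hL2, hL2', fun s h1 h2 => ?_⟩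
        rw [hL3] at h1
        rw [hL3'] at h2
        obtain ⟨j, hj, h1⟩ := h1
        exact hj.ne (isCliqueFrom_unique hO (hj.trans hi) hi h1 h2)
      · rw [List.map_append, List.mem_append, hL3, hL3']
        constructor
        · rintro (⟨j, hj, h⟩ | h)
          exacts [⟨j, by omega, h⟩, ⟨i, by omega, h⟩]
        · rintro ⟨j, hj, h⟩
          rcases Nat.lt_succ_iff_lt_or_eq.1 hj with h' | rfl
          exacts [Or.inl ⟨j, h', h⟩, Or.inr h]
  · rintro _ _ _ ⟨-, L, rfl, hL1, hL2, hL3⟩ -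
    exact ⟨L, rfl, hL1, hL2, fun s => (hL3 s).trans (exists_isCliqueFrom_iff hO (by omega))⟩

end EBBkCH

/-! ### Degeneracy: sums of smaller degrees, and `δ(δ + 1) ≤ 2m`. -/

section Degeneracy

variable {n m : ℕ} {G : SimpleGraph (Fin n)}

theorem bddAbove_degeneracy (G : SimpleGraph (Fin n)) :
    BddAbove {d | ∃ A : Set (Fin n), A.Nonempty ∧ ∀ v ∈ A, d ≤ {w | w ∈ A ∧ G.Adj v w}.ncard} := by
  refine ⟨n, ?_⟩
  rintro d ⟨A, ⟨v, hv⟩, h⟩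
  exact (h v hv).trans ((Set.ncard_le_card _).trans_eq (by simp))

theorem le_degeneracy {d : ℕ} {A : Set (Fin n)} (hA : A.Nonempty)
    (h : ∀ v ∈ A, d ≤ {w | w ∈ A ∧ G.Adj v w}.ncard) : d ≤ degeneracy G :=
  le_csSup (bddAbove_degeneracy G) ⟨A, hA, h⟩

/-- Otherwise `A` would show that the degeneracy is at least one more than it is. -/
theorem exists_ncard_le_degeneracy {A : Set (Fin n)} (hA : A.Nonempty) :
    ∃ v ∈ A, {w | w ∈ A ∧ G.Adj v w}.ncard ≤ degeneracy G := by
  by_contra! h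
  exact absurd (le_degeneracy (G := G) hA fun v hv => h v hv) (Nat.not_succ_le_self _)

open Classical in
-- Remove a vertex `v` with at most `δ` neighbours in `A`. The ordered pairs containing `v`
-- contribute at most `2δ · d v`, since each minimum is at most `d v`; induction handles the rest.
theorem sum_min_le_degeneracy (G : SimpleGraph (Fin n)) (d : Fin n → ℕ) (A : Finset (Fin n)) :
    ∑ u ∈ A, ∑ w ∈ A, (if G.Adj u w then min (d u) (d w) else 0) ≤
      2 * degeneracy G * ∑ v ∈ A, d v := by
  induction A using Finset.strongInduction with
  | H A ih =>
    rcases A.eq_empty_or_nonempty with rfl | hA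
    · simp
    obtain ⟨v, hv, hdeg⟩ := exists_ncard_le_degeneracy (G := G) (A := (A : Set (Fin n)))
      (by simpa using hA)
    rw [Finset.mem_coe] at hv
    have ih := ih _ (Finset.erase_ssubset hv)
    rw [← Finset.insert_erase hv]
    have hnot := Finset.notMem_erase v A
    set A' := A.erase v with hA'
    have h1 : ∑ w ∈ A', (if G.Adj v w then min (d v) (d w) else 0) ≤ degeneracy G * d v := by
      calc ∑ w ∈ A', (if G.Adj v w then min (d v) (d w) else 0)
          ≤ ∑ w ∈ A', (if G.Adj v w then d v else 0) := Finset.sum_le_sum fun w _ => by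
            split_ifs
            exacts [min_le_left _ _, le_rfl]
        _ = (A'.filter fun w => G.Adj v w).card * d v := by
            rw [← Finset.sum_filter, Finset.sum_const, smul_eq_mul]
        _ ≤ degeneracy G * d v := by
            refine Nat.mul_le_mul_right _ (le_trans ?_ hdeg)
            rw [← Set.ncard_coe_finset]
            refine Set.ncard_le_ncard (fun w hw => ?_) (Set.toFinite _)
            rw [Finset.mem_coe, Finset.mem_filter] at hw
            exact ⟨Finset.mem_of_mem_erase hw.1, hw.2⟩
    have h2 : ∑ u ∈ A', (if G.Adj u v then min (d u) (d v) else 0) ≤ degeneracy G * d v := by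
      refine le_trans (le_of_eq (Finset.sum_congr rfl fun u _ => ?_)) h1
      rw [G.adj_comm, min_comm]
    rw [Finset.sum_insert hnot, Finset.sum_insert hnot, Finset.sum_insert hnot]
    simp only [Finset.sum_insert hnot, SimpleGraph.irrefl, if_false, zero_add,
      Finset.sum_add_distrib]
    linarith

open Classical in
theorem sum_ncard_adj {π : Fin m → Sym2 (Fin n)} (hπ : IsEdgeOrdering G π) :
    ∑ v, {w | G.Adj v w}.ncard = 2 * m := by
  have h := G.sum_degrees_eq_twice_card_edges
  rw [hπ.card_eq, ← SimpleGraph.coe_edgeFinset, Set.ncard_coe_finset, ← h]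
  refine Finset.sum_congr rfl fun v _ => ?_
  rw [← SimpleGraph.card_neighborFinset_eq_degree, ← Set.ncard_coe_finset,
    SimpleGraph.coe_neighborFinset]
  rfl

/-- A set attaining `δ` contains a vertex together with its `δ` neighbours, so it has at least `δ +
1` vertices, all of degree at least `δ`; the degree sum is `2m`. -/
theorem degeneracy_mul_le {π : Fin m → Sym2 (Fin n)} (hπ : IsEdgeOrdering G π) (hn : 0 < n) :
    degeneracy G * (degeneracy G + 1) ≤ 2 * m := by
  have hne : {d | ∃ A : Set (Fin n), A.Nonempty ∧
      ∀ v ∈ A, d ≤ {w | w ∈ A ∧ G.Adj v w}.ncard}.Nonempty :=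
    ⟨0, Set.univ, ⟨⟨0, hn⟩, trivial⟩, fun _ _ => Nat.zero_le _⟩
  obtain ⟨A, ⟨v, hv⟩, h⟩ := Nat.sSup_mem hne (bddAbove_degeneracy G)
  change ∀ v ∈ A, degeneracy G ≤ _ at h
  have hcard : degeneracy G + 1 ≤ A.ncard := by
    have h1 : {w | w ∈ A ∧ G.Adj v w} ⊂ A :=
      ⟨fun w hw => hw.1, fun hs => G.irrefl (hs hv).2⟩
    exact (Nat.succ_le_succ (h v hv)).trans (Set.ncard_lt_ncard h1 (Set.toFinite _))
  classical
  rw [← sum_ncard_adj hπ]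
  calc degeneracy G * (degeneracy G + 1) ≤ degeneracy G * A.toFinset.card := by
        rw [← Set.ncard_eq_toFinset_card']
        gcongr
    _ = ∑ v ∈ A.toFinset, degeneracy G := by rw [Finset.sum_const, smul_eq_mul, mul_comm]
    _ ≤ ∑ v ∈ A.toFinset, {w | G.Adj v w}.ncard := Finset.sum_le_sum fun v hv =>
        (h v (Set.mem_toFinset.1 hv)).trans
          (Set.ncard_le_ncard (fun w hw => hw.2) (Set.toFinite _))
    _ ≤ ∑ v, {w | G.Adj v w}.ncard := Finset.sum_le_sum_of_subset (Finset.subset_univ _)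

end Degeneracy

/-! ### The number `τ`: independence of the ordering, and `τ < δ`. -/

section Truss

variable {n m : ℕ} {G : SimpleGraph (Fin n)} {π π' : Fin m → Sym2 (Fin n)}

theorem suffixGraph_adj {i : Fin m} {u w : Fin n} :
    (suffixGraph π i).Adj u w ↔ (∃ t, i ≤ t ∧ π t = s(u, w)) ∧ u ≠ w := by
  rw [suffixGraph, SimpleGraph.fromEdgeSet_adj]
  rfl

theorem numCommonNbrs_mono {H H' : SimpleGraph (Fin n)} (h : H ≤ H') (e : Sym2 (Fin n)) :
    numCommonNbrs H e ≤ numCommonNbrs H' e :=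
  Set.ncard_le_ncard (fun _ hw u hu => h (hw u hu)) (Set.toFinite _)

theorem numCommonNbrs_le_tau (π : Fin m → Sym2 (Fin n)) (i : Fin m) :
    numCommonNbrs (suffixGraph π i) (π i) ≤ tau π :=
  Finset.le_sup (f := fun i => numCommonNbrs (suffixGraph π i) (π i)) (Finset.mem_univ i)

/-- Consider the edges of `π` from place `i` on, and the one among them that comes first in `π'`.
All of them are still present when `π'` reaches it, so it has at least as many common neighbours
there as in the suffix of `π`, where no edge has fewer than `π i`. Applied both ways, this makes `τ`
the same for all truss-based orderings. -/
theorem tau_le_tau (h : IsTrussOrdering G π) (h' : IsEdgeOrdering G π') : tau π ≤ tau π' := by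
  refine Finset.sup_le fun i _ => ?_
  classical
  have hex : ∀ t, ∃ j, π' j = π t := fun t => by
    have : π t ∈ Set.range π' := by
      rw [h'.2, ← h.1.2]
      exact ⟨t, rfl⟩
    exact this
  let J : Finset (Fin m) := Finset.univ.filter fun j => ∃ t, i ≤ t ∧ π' j = π t
  have hJ : J.Nonempty := by
    obtain ⟨j, hj⟩ := hex i
    exact ⟨j, Finset.mem_filter.2 ⟨Finset.mem_univ _, i, le_rfl, hj⟩⟩
  obtain ⟨t, ht, hjt⟩ := (Finset.mem_filter.1 (J.min'_mem hJ)).2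
  refine (h.2 i t ht).trans (le_trans ?_ (numCommonNbrs_le_tau π' (J.min' hJ)))
  rw [hjt]
  refine numCommonNbrs_mono (fun u w huw => ?_) _
  rw [suffixGraph_adj] at huw ⊢
  obtain ⟨⟨t', ht', e⟩, hne⟩ := huw
  obtain ⟨j, hj⟩ := hex t'
  exact ⟨⟨j, J.min'_le j (Finset.mem_filter.2 ⟨Finset.mem_univ _, t', ht', hj⟩), hj.trans e⟩, hne⟩

/-- At a place attaining `τ`, every edge of the suffix graph has at least `τ` common neighbours. So
each vertex on such an edge has degree at least `τ + 1`, counting the other end as well. -/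
theorem tau_lt_degeneracy (h : IsTrussOrdering G π) (hm : 0 < m) : tau π < degeneracy G := by
  have : Nonempty (Fin m) := ⟨⟨0, hm⟩⟩
  obtain ⟨i, -, hi⟩ := Finset.exists_mem_eq_sup Finset.univ Finset.univ_nonempty
    fun i => numCommonNbrs (suffixGraph π i) (π i)
  have hG : ∀ {u w}, (suffixGraph π i).Adj u w → G.Adj u w := fun {u w} huw => by
    obtain ⟨⟨t, -, e⟩, -⟩ := suffixGraph_adj.1 huw
    have : π t ∈ G.edgeSet := h.1.2 ▸ ⟨t, rfl⟩
    rwa [e] at this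
  change _ + 1 ≤ _
  rw [tau, hi]
  refine le_degeneracy (A := {v | ∃ w, (suffixGraph π i).Adj v w}) ?_ ?_
  · have hmem : π i ∈ G.edgeSet := h.1.2 ▸ ⟨i, rfl⟩
    generalize hp : π i = e at hmem
    induction e using Sym2.ind with
    | _ u w => exact ⟨u, w, suffixGraph_adj.2 ⟨⟨i, le_rfl, hp⟩, G.ne_of_adj hmem⟩⟩
  · rintro v ⟨w, hvw⟩
    obtain ⟨⟨t, ht, e⟩, -⟩ := suffixGraph_adj.1 hvw
    refine (Nat.succ_le_succ (h.2 i t ht)).trans ?_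
    rw [e, numCommonNbrs]
    refine Set.ncard_lt_ncard ⟨fun x hx => ?_, fun hs => ?_⟩ (Set.toFinite _)
    · have := hx v (Sym2.mem_mk_left v w)
      exact ⟨⟨v, this.symm⟩, hG this⟩
    · have : w ∈ {w_1 | w_1 ∈ {v | ∃ w, (suffixGraph π i).Adj v w} ∧ G.Adj v w_1} :=
        ⟨⟨v, hvw.symm⟩, hG hvw⟩
      exact (suffixGraph π i).irrefl (hs this w (Sym2.mem_mk_right v w))

end Truss

/-! ### From the edge list and `SimpleGraph` to named graphs. -/

section Transfer

variable {n m : ℕ} {G : SimpleGraph (Fin n)} {inp : Fin m → Fin n × Fin n}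

/-- The `b`-th end of the edge with the name `f`. -/
def edgeEnd (inp : Fin m → Fin n × Fin n) (b : Bool) (f : ℕ) : ℕ :=
  if h : 0 < f ∧ f - 1 < m then
    if b then ((inp ⟨f - 1, h.2⟩).2 : ℕ) else ((inp ⟨f - 1, h.2⟩).1 : ℕ)
  else 0

open Classical in
/-- The name of the edge between `u` and `v`, or `0`. -/
noncomputable def edgeName (inp : Fin m → Fin n × Fin n) (u v : ℕ) : ℕ :=
  if h : ∃ j : Fin m, s(((inp j).1 : ℕ), ((inp j).2 : ℕ)) = s(u, v) then (h.choose : ℕ) + 1 else 0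

theorem edgeEnd_false (j : Fin m) : edgeEnd inp false (j + 1) = (inp j).1 := by
  simp [edgeEnd]

theorem edgeEnd_true (j : Fin m) : edgeEnd inp true (j + 1) = (inp j).2 := by
  simp [edgeEnd]

theorem IsEdgeOrdering.edge_inj (h : IsEdgeOrdering G (edgesOf inp)) {i j : Fin m}
    (e : s(((inp i).1 : ℕ), ((inp i).2 : ℕ)) = s(((inp j).1 : ℕ), ((inp j).2 : ℕ))) : i = j := by
  refine h.1 (Sym2.map.injective Fin.val_injective ?_)
  simpa only [edgesOf, Sym2.map_mk] using e

theorem IsEdgeOrdering.edgeName_eq (h : IsEdgeOrdering G (edgesOf inp)) {u v : ℕ} {j : Fin m}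
    (e : s(((inp j).1 : ℕ), ((inp j).2 : ℕ)) = s(u, v)) : edgeName inp u v = j + 1 := by
  have hex : ∃ j : Fin m, s(((inp j).1 : ℕ), ((inp j).2 : ℕ)) = s(u, v) := ⟨j, e⟩
  rw [edgeName, dif_pos hex, h.edge_inj (hex.choose_spec.trans e.symm)]

theorem exists_of_edgeName_ne {u v : ℕ} (h : edgeName inp u v ≠ 0) :
    ∃ j : Fin m, s(((inp j).1 : ℕ), ((inp j).2 : ℕ)) = s(u, v) := by
  by_contra hex
  exact h (dif_neg hex)

theorem IsEdgeOrdering.ends_ne (h : IsEdgeOrdering G (edgesOf inp)) (j : Fin m) :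
    (inp j).1 ≠ (inp j).2 := by
  have : edgesOf inp j ∈ G.edgeSet := h.2 ▸ ⟨j, rfl⟩
  exact G.ne_of_adj this

/-- The graph with edge list `inp`. -/
noncomputable def IsEdgeOrdering.toNamedGraph (h : IsEdgeOrdering G (edgesOf inp)) :
    NamedGraph n m where
  fst := edgeEnd inp false
  snd := edgeEnd inp true
  name := edgeName inp
  name_comm u v := by simp only [edgeName, Sym2.eq_swap (a := u)]
  name_self u := by
    by_contra hu
    obtain ⟨j, hj⟩ := exists_of_edgeName_ne hu
    have := h.ends_ne j
    rw [Sym2.eq_iff] at hj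
    omega
  name_le u v := by
    by_cases hu : edgeName inp u v = 0
    · omega
    · obtain ⟨j, hj⟩ := exists_of_edgeName_ne hu
      rw [h.edgeName_eq hj]
      exact j.2
  name_ends f h1 h2 := by
    obtain ⟨j, rfl⟩ : ∃ j : Fin m, f = j + 1 := ⟨⟨f - 1, by omega⟩, by simp; omega⟩
    rw [edgeEnd_false, edgeEnd_true, h.edgeName_eq rfl]
  ends_name u v hu := by
    obtain ⟨j, hj⟩ := exists_of_edgeName_ne hu
    rw [h.edgeName_eq hj, edgeEnd_false, edgeEnd_true]
    exact Sym2.eq_iff.1 hj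
  lt_of_name u v hu := by
    obtain ⟨j, hj⟩ := exists_of_edgeName_ne hu
    rw [Sym2.eq_iff] at hj
    omega

theorem IsEdgeOrdering.name_ne_zero (h : IsEdgeOrdering G (edgesOf inp)) {u v : Fin n} :
    h.toNamedGraph.name u v ≠ 0 ↔ G.Adj u v := by
  constructor
  · intro hu
    obtain ⟨j, hj⟩ := exists_of_edgeName_ne hu
    have e : edgesOf inp j = s(u, v) := by
      refine Sym2.map.injective Fin.val_injective ?_
      simpa only [edgesOf, Sym2.map_mk] using hj
    have : edgesOf inp j ∈ G.edgeSet := h.2 ▸ ⟨j, rfl⟩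
    rwa [e] at this
  · intro huv
    have : s(u, v) ∈ Set.range (edgesOf inp) := h.2 ▸ huv
    obtain ⟨j, hj⟩ := this
    have e := congrArg (Sym2.map Fin.val) hj
    simp only [edgesOf, Sym2.map_mk] at e
    have : edgeName inp u v = j + 1 := h.edgeName_eq e
    change edgeName inp u v ≠ 0
    omega

theorem IsEdgeOrdering.card_nbrs (h : IsEdgeOrdering G (edgesOf inp)) (u : Fin n) :
    (h.toNamedGraph.nbrs m u).card = {w | G.Adj u w}.ncard := by
  rw [← Set.ncard_image_of_injective _ Fin.val_injective, ← Set.ncard_coe_finset]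
  congr 1
  ext w
  rw [Finset.mem_coe, NamedGraph.mem_nbrs_all]
  constructor
  · intro hw
    have hwn : w < n := (h.toNamedGraph).lt_of_name w u (h.toNamedGraph.name_comm u w ▸ hw)
    exact ⟨⟨w, hwn⟩, h.name_ne_zero.1 hw, rfl⟩
  · rintro ⟨w, hw, rfl⟩
    exact h.name_ne_zero.2 hw

open Classical in
-- The edge list injects into the ordered adjacent pairs, whose sum is at most `2δ · 2m`. A factor
-- of two is given away, as each edge occurs in two ordered pairs.
theorem IsEdgeOrdering.sum_minDeg_le (h : IsEdgeOrdering G (edgesOf inp)) :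
    ∑ j ∈ Finset.range m, h.toNamedGraph.minDeg (j + 1) ≤ 4 * degeneracy G * m := by
  set d : Fin n → ℕ := fun u => {w | G.Adj u w}.ncard with hd
  have h1 : ∑ j ∈ Finset.range m, h.toNamedGraph.minDeg (j + 1) =
      ∑ j : Fin m, min (d (inp j).1) (d (inp j).2) := by
    rw [Finset.sum_range]
    refine Finset.sum_congr rfl fun j _ => ?_
    change min ((h.toNamedGraph.nbrs m (edgeEnd inp false (j + 1))).card)
      ((h.toNamedGraph.nbrs m (edgeEnd inp true (j + 1))).card) = _
    rw [edgeEnd_false, edgeEnd_true, h.card_nbrs, h.card_nbrs]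
  have h2 : ∑ j : Fin m, min (d (inp j).1) (d (inp j).2) ≤
      ∑ u, ∑ w, (if G.Adj u w then min (d u) (d w) else 0) := by
    rw [← Finset.sum_product', ← Finset.sum_filter]
    have hinj : Function.Injective inp := fun i j e => h.edge_inj (by rw [e])
    rw [← Finset.sum_image (s := Finset.univ) (g := inp)
      (f := fun p : Fin n × Fin n => min (d p.1) (d p.2)) hinj.injOn]
    refine Finset.sum_le_sum_of_subset fun p hp => ?_
    obtain ⟨j, -, rfl⟩ := Finset.mem_image.1 hp
    have : edgesOf inp j ∈ G.edgeSet := h.2 ▸ ⟨j, rfl⟩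
    exact Finset.mem_filter.2 ⟨Finset.mem_product.2 ⟨Finset.mem_univ _, Finset.mem_univ _⟩, this⟩
  have h3 := sum_min_le_degeneracy G d Finset.univ
  rw [hd, sum_ncard_adj h] at h3
  rw [h1]
  exact (h2.trans h3).trans_eq (by ring)

theorem IsEdgeOrdering.graphMem_initial (h : IsEdgeOrdering G (edgesOf inp)) :
    GraphMem h.toNamedGraph 0 (EBBkCH.initial inp).mem := by
  have h0 : ∀ u, h.toNamedGraph.nbrs 0 u = ∅ := fun u => by
    ext v
    rw [NamedGraph.mem_nbrs]
    simp
  refine ⟨fun f h1 h2 => ?_, fun u => ?_, fun u => ?_, fun u v => ?_⟩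
  · simp [EBBkCH.initial, IsEdgeOrdering.toNamedGraph, edgeEnd]
  · rw [h0]
    rfl
  · rw [h0]
    rfl
  · split_ifs with h1
    · exact (Nat.le_zero.1 h1).symm
    · rfl

/-- The permutation of the edges given by an ordering of their names. -/
def IsOrder.perm {ord pos : ℕ → ℕ} (h : IsOrder m ord pos) : Equiv.Perm (Fin m) where
  toFun i := ⟨ord i - 1, by have := h.one_le i i.2; have := h.le i i.2; omega⟩
  invFun j := ⟨pos (j + 1), h.pos_lt _ (Nat.le_add_left _ _) j.2⟩
  left_inv i := by
    have := h.one_le i i.2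
    ext
    simp only
    rw [Nat.sub_add_cancel this, h.pos_ord i i.2]
  right_inv j := by
    ext
    simp only
    rw [h.ord_pos _ (Nat.le_add_left _ _) j.2, Nat.add_sub_cancel]

theorem IsOrder.perm_add_one {ord pos : ℕ → ℕ} (h : IsOrder m ord pos) (i : Fin m) :
    ((h.perm i : Fin m) : ℕ) + 1 = ord i := Nat.sub_add_cancel (h.one_le i i.2)

theorem IsEdgeOrdering.name_edge (h : IsEdgeOrdering G (edgesOf inp)) {u v : Fin n} {j : Fin m}
    (e : edgesOf inp j = s(u, v)) : h.toNamedGraph.name u v = j + 1 := by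
  have e' := congrArg (Sym2.map Fin.val) e
  simp only [edgesOf, Sym2.map_mk] at e'
  exact h.edgeName_eq e'

theorem IsEdgeOrdering.suffixGraph_adj_iff (h : IsEdgeOrdering G (edgesOf inp)) {ord pos : ℕ → ℕ}
    (hO : IsOrder m ord pos) (i : Fin m) {u v : Fin n} :
    (suffixGraph (fun i => edgesOf inp (hO.perm i)) i).Adj u v ↔
      h.toNamedGraph.name u v ≠ 0 ∧ i ≤ pos (h.toNamedGraph.name u v) := by
  rw [suffixGraph_adj]
  constructor
  · rintro ⟨⟨t, ht, e⟩, -⟩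
    rw [h.name_edge e, hO.perm_add_one, hO.pos_ord t t.2]
    have := hO.one_le t t.2
    exact ⟨by omega, ht⟩
  · rintro ⟨h1, h2⟩
    have hadj := h.name_ne_zero.1 h1
    have : s(u, v) ∈ Set.range (edgesOf inp) := h.2 ▸ hadj
    obtain ⟨j, hj⟩ := this
    rw [h.name_edge hj] at h2
    refine ⟨⟨hO.perm.symm j, ?_, ?_⟩, G.ne_of_adj hadj⟩
    · exact h2
    · simpa using hj

theorem IsEdgeOrdering.numCommonNbrs_eq (h : IsEdgeOrdering G (edgesOf inp)) {ord pos : ℕ → ℕ}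
    (hO : IsOrder m ord pos) (i j : Fin m) :
    numCommonNbrs (suffixGraph (fun i => edgesOf inp (hO.perm i)) i) (edgesOf inp j) =
      h.toNamedGraph.supp pos i (j + 1) := by
  rw [numCommonNbrs, NamedGraph.supp, ← Set.ncard_coe_finset,
    ← Set.ncard_image_of_injective _ Fin.val_injective]
  have e : h.toNamedGraph.name (inp j).1 (inp j).2 = j + 1 := h.name_edge rfl
  have h0 : h.toNamedGraph.name (inp j).1 (inp j).2 ≠ 0 := by omega
  congr 1
  ext w
  rw [Finset.mem_coe, ← e, NamedGraph.mem_tri_name h0]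
  constructor
  · rintro ⟨w, hw, rfl⟩
    have h1 := (h.suffixGraph_adj_iff hO i).1 (hw _ (Sym2.mem_mk_left _ _))
    have h2 := (h.suffixGraph_adj_iff hO i).1 (hw _ (Sym2.mem_mk_right _ _))
    exact ⟨⟨h1.1, h2.1⟩, h1.2, h2.2⟩
  · rintro ⟨⟨h1, h2⟩, h3, h4⟩
    have hwn : w < n := h.toNamedGraph.lt_of_name w _ (h.toNamedGraph.name_comm _ w ▸ h1)
    refine ⟨⟨w, hwn⟩, fun u hu => ?_, rfl⟩
    rw [h.suffixGraph_adj_iff hO]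
    rcases Sym2.mem_iff.1 hu with rfl | rfl
    exacts [⟨h1, h3⟩, ⟨h2, h4⟩]

theorem IsEdgeOrdering.isTrussOrdering (h : IsEdgeOrdering G (edgesOf inp)) {ord pos : ℕ → ℕ}
    (hT : IsTruss h.toNamedGraph ord pos) :
    IsTrussOrdering G fun i => edgesOf inp (hT.order.perm i) := by
  refine ⟨⟨h.1.comp hT.order.perm.injective, ?_⟩, fun i j hij => ?_⟩
  · rw [← h.2]
    exact hT.order.perm.surjective.range_comp (edgesOf inp)
  · rw [h.numCommonNbrs_eq, h.numCommonNbrs_eq, hT.order.perm_add_one, hT.order.perm_add_one]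
    refine hT.min i i.2 _ (hT.order.one_le j j.2) (hT.order.le j j.2) ?_
    rw [hT.order.pos_ord j j.2]
    exact hij

/-- The instance uses edges strictly behind place `i`, while `τ` is defined with the suffix from `i`
on; only this monotonicity is needed. -/
theorem IsEdgeOrdering.supp_le_tau (h : IsEdgeOrdering G (edgesOf inp)) {ord pos : ℕ → ℕ}
    (hO : IsOrder m ord pos) {i : ℕ} (hi : i < m) :
    h.toNamedGraph.supp pos (i + 1) (ord i) ≤ tau fun i => edgesOf inp (hO.perm i) := by
  have h1 := numCommonNbrs_le_tau (fun i => edgesOf inp (hO.perm i)) ⟨i, hi⟩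
  rw [h.numCommonNbrs_eq, hO.perm_add_one] at h1
  refine le_trans (Finset.card_le_card fun w hw => ?_) h1
  rw [NamedGraph.mem_tri] at hw ⊢
  exact ⟨hw.1, (Nat.le_succ i).trans hw.2.1, (Nat.le_succ i).trans hw.2.2⟩

/-- As `k ≥ 2`, every printed vertex has a neighbour in its block and is therefore below `n`, so the
blocks lift to `Fin n`. -/
theorem IsEdgeOrdering.listsCliques (h : IsEdgeOrdering G (edgesOf inp)) {k : ℕ} (hk : 2 ≤ k)
    (hn : 0 < n) {L : List (List ℕ)} (hlen : ∀ c ∈ L, c.length = k)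
    (hnd : (L.map List.toFinset).Nodup)
    (hmem : ∀ s, s ∈ L.map List.toFinset ↔
      s.card = k ∧ ∀ u ∈ s, ∀ v ∈ s, u ≠ v → h.toNamedGraph.name u v ≠ 0) :
    ListsCliques G k L.flatten := by
  -- Reduction modulo `n` only serves to make the lift total; it is the identity on the vertices
  -- that occur.
  let g : ℕ → Fin n := fun u => ⟨u % n, Nat.mod_lt _ hn⟩
  have hlt : ∀ c ∈ L, ∀ u ∈ c, u < n := by
    intro c hc u hu
    obtain ⟨h1, h2⟩ := (hmem c.toFinset).1 (List.mem_map_of_mem hc)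
    have hu' := List.mem_toFinset.2 hu
    obtain ⟨v, hv, huv⟩ := Finset.exists_mem_ne (by omega : 1 < c.toFinset.card) u
    exact h.toNamedGraph.lt_of_name u v (h2 u hu' v hv huv.symm)
  have hval : ∀ c ∈ L, (c.map g).map Fin.val = c := by
    intro c hc
    rw [List.map_map]
    exact (List.map_congr_left fun u hu => Nat.mod_eq_of_lt (hlt c hc u hu)).trans (List.map_id c)
  have hfin : ((L.map (List.map g)).map List.toFinset).map (Finset.image Fin.val) =
      L.map List.toFinset := by
    rw [List.map_map, List.map_map]
    refine List.map_congr_left fun c hc => ?_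
    conv_rhs => rw [← hval c hc]
    ext x
    simp
  refine ⟨L.map (List.map g), ?_, ?_, ?_, fun s => ?_⟩
  · rw [List.map_flatten, List.map_map]
    congr 1
    exact ((List.map_congr_left fun c hc => hval c hc).trans (List.map_id L)).symm
  · intro c hc
    obtain ⟨c, hc', rfl⟩ := List.mem_map.1 hc
    rw [List.length_map, hlen c hc']
  · refine List.Nodup.of_map (Finset.image Fin.val) ?_
    rwa [hfin]
  · rw [← List.mem_map_of_injective (Finset.image_injective Fin.val_injective), hfin, hmem,
      Finset.card_image_of_injective _ Fin.val_injective, SimpleGraph.isNClique_iff, and_comm]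
    refine and_congr_left fun _ => ?_
    simp only [Finset.forall_mem_image]
    constructor
    · intro h1 u hu v hv huv
      exact h.name_ne_zero.1 (h1 hu hv fun e => huv (Fin.ext e))
    · intro h1 u hu v hv huv
      exact h.name_ne_zero.2 (h1 hu hv fun e => huv (congrArg Fin.val e))

end Transfer

/-! ### Space bounds, the time per edge, and the final assembly. -/

namespace EBBkCH

open Prog NamedGraph

variable {n m : ℕ} {D : NamedGraph n m}

theorem card_union_image_le {ι : Type*} {F : Finset Loc} {A : Finset ι} {f : ι → Loc} {a b : ℕ}
    (hF : F.card ≤ a) (hA : A.card ≤ b) : (F ∪ A.image f).card ≤ a + b :=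
  (Finset.card_union_le _ _).trans (Nat.add_le_add hF (Finset.card_image_le.trans hA))

/-- Only cells of actual vertices and edges are touched: `n` degrees, `2m` entries of neighbour
lists, and `2m` entries of the edge dictionary, although the latter is indexed by pairs of vertices.
-/
theorem readCells_bound (D : NamedGraph n m)
    (hD : ∑ u ∈ Finset.range n, (D.nbrs m u).card = 2 * m) :
    ∃ F : Finset Loc, (∀ x ∈ readCells n m D, x ∈ F) ∧ F.card ≤ n + 4 * m := by
  refine ⟨∅ ∪ (Finset.range n).image Loc.deg ∪
    ((Finset.range n).sigma fun u => Finset.range (D.nbrs m u).card).image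
      (fun x => Loc.adj x.1 x.2) ∪
    (Finset.range m).image (fun j => Loc.eid (D.fst (j + 1)) (D.snd (j + 1))) ∪
    (Finset.range m).image (fun j => Loc.eid (D.snd (j + 1)) (D.fst (j + 1))), ?_, ?_⟩
  · intro x hx
    simp only [Finset.mem_union, Finset.mem_image, Finset.mem_sigma, Finset.mem_range]
    rcases x with _ | _ | _ | ⟨u, v⟩ | _ | _ | _ | _ | _ | _ | _ | _ | _ | _ | _ | _ <;>
      first
      | exact hx.elim
      | exact Or.inl (Or.inl (Or.inl (Or.inr ⟨_, hx, rfl⟩)))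
      | exact Or.inl (Or.inl (Or.inr ⟨⟨_, _⟩, ⟨hx.1, hx.2⟩, rfl⟩))
      | skip
    have h0 : D.name u v ≠ 0 := hx
    have hle := D.name_le u v
    have h1 : D.name u v - 1 + 1 = D.name u v := by omega
    rcases D.ends_name u v hx with ⟨e1, e2⟩ | ⟨e1, e2⟩
    · exact Or.inl (Or.inr ⟨D.name u v - 1, by omega, by rw [h1, e1, e2]⟩)
    · exact Or.inr ⟨D.name u v - 1, by omega, by rw [h1, e1, e2]⟩
  · refine (card_union_image_le (card_union_image_le (card_union_image_le (card_union_image_le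
      (a := 0) le_rfl (Finset.card_range n).le) (b := 2 * m) ?_) (Finset.card_range m).le)
      (Finset.card_range m).le).trans (by omega)
    rw [Finset.card_sigma]
    simp [hD]

theorem orderCells_bound (m : ℕ) :
    ∃ F : Finset Loc, (∀ x ∈ orderCells m, x ∈ F) ∧ F.card ≤ 6 * m + 6 := by
  refine ⟨∅ ∪ (Finset.range (m + 1)).image Loc.sup ∪ (Finset.range (m + 1)).image Loc.cnt ∪
    (Finset.range (m + 1)).image Loc.nxt ∪ (Finset.range (m + 1)).image Loc.bin ∪
    (Finset.range (m + 1)).image Loc.ord ∪ (Finset.range (m + 1)).image Loc.pos, ?_, ?_⟩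
  · intro x hx
    change orderCells m x at hx
    rcases x with _ | _ | _ | _ | _ | _ | _ | _ | _ | _ | _ | _ | _ | _ | _ | _ <;>
      first
      | exact hx.elim
      | simp only [orderCells] at hx
        simp only [Finset.mem_union, Finset.mem_image, Finset.mem_range]
        simp
        omega
  · have h := (Finset.card_range (m + 1)).le
    exact (card_union_image_le (card_union_image_le (card_union_image_le (card_union_image_le
      (card_union_image_le (card_union_image_le (a := 0) le_rfl h) h) h) h) h) h).trans (by omega)

/-- No term depends on `k`: the size of `S` plus the number of candidates stays within `N + 2`, and
this also bounds the depth of the recursion. -/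
theorem rootCells_bound (n N : ℕ) :
    ∃ F : Finset Loc, (∀ x ∈ rootCells n N, x ∈ F) ∧ F.card ≤ n + 8 * (N + 2) * (N + 2) := by
  refine ⟨∅ ∪ (Finset.range N).image Loc.cand ∪ (Finset.range n).image Loc.col ∪
    (Finset.range (N + 1)).image Loc.mark ∪
    (Finset.range (N + 2) ×ˢ Finset.range (N + 2)).image (fun x => Loc.lev x.1 x.2) ∪
    (Finset.range (N + 2)).image Loc.part ∪
    (Finset.range (N + 2) ×ˢ Finset.range 3).image (fun x => Loc.frame x.1 x.2), ?_, ?_⟩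
  · intro x hx
    change rootCells n N x at hx
    rcases x with _ | _ | _ | _ | _ | _ | _ | _ | _ | _ | _ | _ | _ | _ | _ | _ <;>
      first
      | exact hx.elim
      | simp only [rootCells] at hx
        simp only [Finset.mem_union, Finset.mem_image, Finset.mem_product, Finset.mem_range,
          Prod.exists]
        simp
        omega
  · have h1 : (Finset.range (N + 2) ×ˢ Finset.range (N + 2)).card ≤ (N + 2) * (N + 2) := by simp
    have h2 : (Finset.range (N + 2) ×ˢ Finset.range 3).card ≤ (N + 2) * 3 := by simp
    refine (card_union_image_le (card_union_image_le (card_union_image_le (card_union_image_le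
      (card_union_image_le (card_union_image_le (a := 0) le_rfl (Finset.card_range _).le)
      (Finset.card_range _).le) (Finset.card_range _).le) h1) (Finset.card_range _).le) h2).trans ?_
    nlinarith

/-- For `k = 3` only work linear in `N` fits, which is why the vertices are merely copied. For `k ≥
4` and `N ≥ 2`, colouring and sorting cost at most `31 N² = 124 (N/2)²`, and the exponent `k - 2` is
at least `2`. For `N ≤ 1` the cost is a constant, charged to the edge. -/
theorem edgeTime_le {k : ℕ} (hk : 3 ≤ k) (N : ℕ) :
    edgeTime k N ≤ 60 + 1600 * (k * ((N : ℝ) / 2) ^ (k - 2)) := by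
  have hk' : (3 : ℝ) ≤ k := by exact_mod_cast hk
  have hpow : (0 : ℝ) ≤ ((N : ℝ) / 2) ^ (k - 2) := by positivity
  have hle : ((N : ℝ) / 2) ^ (k - 2) ≤ k * ((N : ℝ) / 2) ^ (k - 2) :=
    le_mul_of_one_le_left hpow (by linarith)
  rw [edgeTime, listTime]
  split_ifs with h
  · have hN : (0 : ℝ) ≤ k * ((N : ℝ) / 2) := by positivity
    simp only [h, pow_one] at hle ⊢
    linarith
  · have key : N * (20 * (N : ℝ) + 11) ≤ 31 + 124 * ((N : ℝ) / 2) ^ (k - 2) := by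
      rcases Nat.lt_or_ge N 2 with hN | hN
      · have : (N : ℝ) ≤ 1 := by exact_mod_cast Nat.lt_succ_iff.1 hN
        have h0 : (0 : ℝ) ≤ N := Nat.cast_nonneg N
        nlinarith
      · have hN' : (2 : ℝ) ≤ N := by exact_mod_cast hN
        have : ((N : ℝ) / 2) ^ 2 ≤ ((N : ℝ) / 2) ^ (k - 2) :=
          pow_le_pow_right₀ (by linarith) (by omega)
        nlinarith
    linarith

end EBBkCH

open EBBkCH Prog in
theorem mainTheorem3 :
    ∃ C : ℝ, ∀ (n m k : ℕ) (G : SimpleGraph (Fin n)) (inp : Fin m → Fin n × Fin n),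
      3 ≤ k → 0 < m → IsEdgeOrdering G (edgesOf inp) →
      -- all `k`-cliques are listed, each exactly once
      ListsCliques G k (EBBkCH.run inp k).out ∧
      -- the edge ordering used at the root is the truss-based one
      (∃ σ : Equiv.Perm (Fin m),
        (∀ i : Fin m, (EBBkCH.run inp k).mem (.ord i) = σ i + 1) ∧
        IsTrussOrdering G (fun i => edgesOf inp (σ i))) ∧
      -- time, where `τ` may be taken from any truss-based ordering
      (∀ π : Fin m → Sym2 (Fin n), IsTrussOrdering G π →
        tau π < degeneracy G ∧
        ((EBBkCH.run inp k).time : ℝ) ≤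
          C * ((degeneracy G : ℝ) * m + (k : ℝ) * m * ((tau π : ℝ) / 2) ^ (k - 2))) ∧
      -- space
      ((EBBkCH.run inp k).space : ℝ) ≤ C * ((m : ℝ) + n) := by
  refine ⟨2000, fun n m k G inp hk hm h => ?_⟩
  set D := h.toNamedGraph with hD
  obtain ⟨o₁, ⟨rfl, hg₁⟩, ho₁, hfr₁, hu₁, ht₁⟩ :=
    readGraph_spec h.graphMem_initial (EBBkCH.initial inp) rfl
  set σ₁ := (readGraph m (EBBkCH.initial inp)).2 with hσ₁
  obtain ⟨o₂, ⟨rfl, hT⟩, ho₂, hfr₂, hu₂, ht₂⟩ :=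
    trussOrder_spec (D := D) hg₁ (fun s => hfr₁ (.cnt s) fun h => h) σ₁ rfl
  set σ₂ := (trussOrder m σ₁).2 with hσ₂
  set π₀ := fun i => edgesOf inp (hT.order.perm i) with hπ₀
  have hπ : IsTrussOrdering G π₀ := h.isTrussOrdering hT
  have hmark : ∀ c, σ₂.mem (.mark c) = 0 := fun c =>
    (hfr₂ (.mark c) fun h => h).trans (hfr₁ (.mark c) fun h => h)
  have hg₂ : GraphMem D m σ₂.mem := hg₁.congr fun x hx =>
    hfr₂ x (graphCells_notMem_orderCells x hx)
  obtain ⟨o₃, ⟨L, rfl, hL1, hL2, hL3⟩, ho₃, hfr₃, hu₃, ht₃⟩ := root_spec hk hg₂ hT.order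
    (fun _ => rfl) (fun _ => rfl) hmark (fun i hi => h.supp_le_tau hT.order hi) σ₂ rfl
  -- By unfolding, the state after the third phase is the final state of the whole program.
  rw [show root m k σ₂ = ((), EBBkCH.run inp k) from rfl] at ho₃ hfr₃ hu₃ ht₃
  dsimp only at ho₃ hfr₃ hu₃ ht₃
  have hn : 0 < n := Fin.pos (inp ⟨0, hm⟩).1
  have hlt := tau_lt_degeneracy hπ hm
  refine ⟨?_, ⟨hT.order.perm, fun i => ?_, hπ⟩, fun π hπ' => ?_, ?_⟩
  · rw [ho₃, ho₂, ho₁]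
    exact h.listsCliques (by omega) hn hL1 hL2 hL3
  · rw [hfr₃ (.ord i) fun h => h, hT.order.perm_add_one]
  · have htau : tau π = tau π₀ := le_antisymm (tau_le_tau hπ' hπ.1) (tau_le_tau hπ hπ'.1)
    rw [htau]
    refine ⟨hlt, ?_⟩
    have hsum : ∑ j ∈ Finset.range m, (D.minDeg (j + 1) : ℝ) ≤ 4 * degeneracy G * m := by
      exact_mod_cast h.sum_minDeg_le
    have hm' : (1 : ℝ) ≤ m := by exact_mod_cast hm
    have hδ : (1 : ℝ) ≤ degeneracy G := by exact_mod_cast Nat.one_le_of_lt hlt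
    have h1 : (m : ℝ) ≤ degeneracy G * m := le_mul_of_one_le_left (by linarith) hδ
    have h2 := mul_le_mul_of_nonneg_left (edgeTime_le hk (tau π₀)) (by linarith : (0 : ℝ) ≤ m)
    have h3 : (0 : ℝ) ≤ m * (k * ((tau π₀ : ℝ) / 2) ^ (k - 2)) := by positivity
    have ht₀ : ((EBBkCH.initial inp).time : ℝ) = 0 := Nat.cast_zero
    rw [ht₀] at ht₁
    nlinarith
  · obtain ⟨F₁, hF₁, c₁⟩ := readCells_bound D (by
      rw [Finset.sum_range, ← sum_ncard_adj h]
      exact Finset.sum_congr rfl fun u _ => h.card_nbrs u)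
    obtain ⟨F₂, hF₂, c₂⟩ := orderCells_bound m
    obtain ⟨F₃, hF₃, c₃⟩ := rootCells_bound n (tau π₀)
    have hsub : (EBBkCH.run inp k).used ⊆ ((EBBkCH.initial inp).used ∪ F₁) ∪ F₂ ∪ F₃ := by
      intro x hx
      simp only [Finset.mem_union]
      rcases hu₃ x hx with hx | hx
      · rcases hu₂ x hx with hx | hx
        · rcases hu₁ x hx with hx | hx
          · exact Or.inl (Or.inl (Or.inl hx))
          · exact Or.inl (Or.inl (Or.inr (hF₁ x hx)))
        · exact Or.inl (Or.inr (hF₂ x hx))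
      · exact Or.inr (hF₃ x hx)
    have h0 : (EBBkCH.initial inp).used.card ≤ m * 2 :=
      Finset.card_image_le.trans (by simp)
    have hcard := Finset.card_le_card hsub
    have hc1 := Finset.card_union_le ((EBBkCH.initial inp).used ∪ F₁ ∪ F₂) F₃
    have hc2 := Finset.card_union_le ((EBBkCH.initial inp).used ∪ F₁) F₂
    have hc3 := Finset.card_union_le (EBBkCH.initial inp).used F₁
    have hδ := degeneracy_mul_le h hn
    -- Since `τ + 2 ≤ 2(τ + 1)` and `τ < δ`, the square is at most `2(τ + 1)(τ + 2) ≤ 2δ(δ + 1) ≤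
    -- 4m`.
    have hN : (tau π₀ + 2) * (tau π₀ + 2) ≤ 4 * m := by
      have : (tau π₀ + 1) * (tau π₀ + 2) ≤ degeneracy G * (degeneracy G + 1) :=
        Nat.mul_le_mul hlt (Nat.succ_le_succ hlt)
      nlinarith
    have : (EBBkCH.run inp k).space ≤ 2000 * (m + n) := by
      change (EBBkCH.run inp k).used.card ≤ _
      nlinarith
    exact_mod_cast this
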